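/- Let $\alpha\in(0,2)$. For $h>0$ put $v_j=jh$ ($j\in\mathbb Z$) and $$M_j=\mu_\alpha(v_j),\qquad \mu_\alpha(v)=\frac1{2\pi}\int_{\mathbb R}e^{iv\xi-|\xi|^\alpha/\alpha}\,d\xi .$$ Let $C_{1,\alpha}=\dfrac{2^\alpha\Gamma(\frac{1+\alpha}2)}{\sqrt\pi\,|\Gamma(-\frac\alpha2)|}$, and for $t>0$ let $\varphi_\alpha(t)=\dfrac{t^{2-\alpha}}{(2-\alpha)(\alpha-1)\alpha}$ if $\alpha\ne1$ and $\varphi_1(t)=t-t\ln t$. Writing $\varphi=\varphi_\alpha$, let $\beta^h_k=\beta^h_{-k}=\frac{C_{1,\alpha}}{h^{1+\alpha}}b_k$ for $k\ge1$, where $$b_1=\tfrac1{2-\alpha}-\varphi''(1)-\tfrac{\varphi'(3)+3\varphi'(1)}2+\varphi(3)-\varphi(1),$$ $$b_k=2[\varphi'(k+1)+\varphi'(k-1)-\varphi(k+1)+\varphi(k-1)]\quad(k\ge2\text{ even}),$$ $$b_k=-\tfrac{\varphi'(k+2)+6\varphi'(k)+\varphi'(k-2)}2+\varphi(k+2)-\varphi(k-2)\quad(k\ge3\text{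 odd}).$$ For real sequences indexed by $\mathbb Z$, define $(\Lambda^h_\alpha f)_j=\sum_{k\ge1}\beta^h_k(f_{j+k}+f_{j-k}-2f_j)h$, $$(VM)_{j+\frac12}=-(VM)_{-j-\frac12}=-\frac12\sum_{k=-j}^{j}(\Lambda_\alpha^hM)_k\,h\quad(j\ge0),$$ $$(\Gamma^h_\alpha f)_j=\frac{\mathcal F_{j+\frac12}-\mathcal F_{j-\frac12}}h,\qquad \mathcal F_{j+\frac12}=(VM)_{j+\frac12}\Big(\frac{f_j}{2M_j}+\frac{f_{j+1}}{2M_{j+1}}\Big),$$ the discrete Lévy–Fokker–Planck operator $L^h_\alpha=\Gamma^h_\alpha+\Lambda^h_\alpha$, the centered difference $(D_hf)_j=\frac{f_{j+1}-f_{j-1}}{2h}$, and $[D_h,L_\alpha^h]=D_hL_\alpha^h-L_\alpha^hD_h$. Let $\ell^2_h(M^{-1})$ be the space of real sequences with $\|f\|^2_{\ell^2_h(M^{-1})}=\sum_jf_j^2M_j^{-1}h<\infty$, with inner product $\langle f,g\rangle_{\ell^2_h(M^{-1})}=\sum_jf_jg_jM_j^{-1}h$. **Lemma.** For every $h_0>0$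 there is a constant $C>0$, depending only on $\alpha$ and $h_0$, such that for all $h\in(0,h_0]$ and all $f,g\in\ell^2_h(M^{-1})$ one has $[D_h,L^h_\alpha]f\in\ell^2_h(M^{-1})$ and $$\big|\langle[D_h,L^h_\alpha]f,g\rangle_{\ell^2_h(M^{-1})}\big|\le C\Big(\|f\|_{\ell^2_h(M^{-1})}\|g\|_{\ell^2_h(M^{-1})}+\|D_hf\|_{\ell^2_h(M^{-1})}\|g\|_{\ell^2_h(M^{-1})}\Big).$$ -/

import Mathlib

namespace LevyFP

noncomputable section

/-- The constant `C_{1,α} = 2^α Γ((1+α)/2) / (π^{1/2} |Γ(-α/2)|)` of the one-dimensional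
fractional Laplacian. -/
def fracLapConst (α : ℝ) : ℝ :=
  2 ^ α * Real.Gamma ((1 + α) / 2) / (Real.sqrt Real.pi * |Real.Gamma (-(α / 2))|)

/-- The function `φ_α`, a third primitive of `t ↦ t^{-1-α}` on `(0, ∞)`. -/
def phi (α : ℝ) (t : ℝ) : ℝ :=
  if α = 1 then t - t * Real.log t
  else t ^ (2 - α) / ((2 - α) * (α - 1) * α)

/-- The Huang–Oberman weight `β_k^h`, an even function of `k`. The value at `k = 0` plays no
role and is set to zero. -/
def beta (α h : ℝ) (k : ℤ) : ℝ :=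
  let φ := phi α
  let φ' := deriv φ
  let φ'' := deriv φ'
  let n : ℝ := |(k : ℝ)|
  fracLapConst α / h ^ (1 + α) *
    if k = 0 then 0
    else if |k| = 1 then
      1 / (2 - α) - φ'' 1 - (φ' 3 + 3 * φ' 1) / 2 + φ 3 - φ 1
    else if Even k then
      2 * (φ' (n + 1) + φ' (n - 1) - φ (n + 1) + φ (n - 1))
    else
      -(φ' (n + 2) + 6 * φ' n + φ' (n - 2)) / 2 + φ (n + 2) - φ (n - 2)

/-- The discrete fractional Laplacian
`(Λ_α^h f)_j = ∑_{k ≥ 1} β_k^h (f_{j+k} + f_{j-k} - 2 f_j) h`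
(with the sign convention that it approximates `-(-Δ)^{α/2}`). -/
def Lam (α h : ℝ) (f : ℤ → ℝ) (j : ℤ) : ℝ :=
  ∑' n : ℕ, beta α h ((n : ℤ) + 1) *
    (f (j + ((n : ℤ) + 1)) + f (j - ((n : ℤ) + 1)) - 2 * f j) * h

/-- The symmetric stable density
`μ_α(v) = (2π)^{-1} ∫ exp(i v ξ - |ξ|^α / α) dξ` (this integral is real). -/
def mu (α v : ℝ) : ℝ :=
  1 / (2 * Real.pi) *
    (∫ ξ : ℝ, Complex.exp (Complex.I * (v : ℂ) * (ξ : ℂ) - ((|ξ| ^ α / α : ℝ) : ℂ))).re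

/-- The discrete equilibrium `M_j = μ_α(v_j)`, `v_j = j h`. -/
def M (α h : ℝ) (j : ℤ) : ℝ := mu α ((j : ℝ) * h)

/-- `VM α h j` is `(VM)_{j+1/2}`: for `n ≥ 0`,
`(VM)_{n+1/2} = -(VM)_{-n-1/2} = -(1/2) ∑_{k=-n}^{n} (Λ_α^h M)_k h`
(note that `Int.negSucc n + 1/2 = -n - 1/2`). -/
def VM (α h : ℝ) : ℤ → ℝ
  | Int.ofNat n => -(1 / 2) * ∑ k ∈ Finset.Icc (-(n : ℤ)) (n : ℤ), Lam α h (M α h) k * h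
  | Int.negSucc n => 1 / 2 * ∑ k ∈ Finset.Icc (-(n : ℤ)) (n : ℤ), Lam α h (M α h) k * h

/-- `flux α h f j` is the numerical flux `F_{j+1/2}`. -/
def flux (α h : ℝ) (f : ℤ → ℝ) (j : ℤ) : ℝ :=
  VM α h j * (f j / (2 * M α h j) + f (j + 1) / (2 * M α h (j + 1)))

/-- The discrete drift operator `Γ_α^h`, approximating `∂_v (v ·)`. -/
def Gam (α h : ℝ) (f : ℤ → ℝ) (j : ℤ) : ℝ :=
  (flux α h f j - flux α h f (j - 1)) / h

/-- The discrete Lévy–Fokker–Planck operator `L_α^h = Γ_α^h + Λ_α^h`. -/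
def L (α h : ℝ) (f : ℤ → ℝ) (j : ℤ) : ℝ := Gam α h f j + Lam α h f j

/-- The centered finite difference `(D_h f)_j = (f_{j+1} - f_{j-1}) / (2h)`. -/
def D (h : ℝ) (f : ℤ → ℝ) (j : ℤ) : ℝ := (f (j + 1) - f (j - 1)) / (2 * h)

/-- The commutator `[A, B] = A B - B A` of two operators on real sequences indexed by `ℤ`. -/
def comm (A B : (ℤ → ℝ) → (ℤ → ℝ)) (f : ℤ → ℝ) : ℤ → ℝ := A (B f) - B (A f)

/-- Membership in `ℓ²_h(γ)`. -/
def MemL2 (h : ℝ) (γ : ℤ → ℝ) (g : ℤ → ℝ) : Prop :=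
  Summable fun j => g j ^ 2 * γ j * h

/-- The norm of `ℓ²_h(γ)`. -/
def normL2 (h : ℝ) (γ : ℤ → ℝ) (g : ℤ → ℝ) : ℝ :=
  Real.sqrt (∑' j, g j ^ 2 * γ j * h)

/-- The inner product of `ℓ²_h(γ)`. -/
def innerL2 (h : ℝ) (γ : ℤ → ℝ) (f g : ℤ → ℝ) : ℝ :=
  ∑' j, f j * g j * γ j * h

end

end LevyFP

open MeasureTheory Set Filter Topology

namespace LevyFP

noncomputable section

/-! ### The stable density and its derivatives -/

/-! The operator `Lam` is translation invariant, so it commutes with `D`, and only the commutator of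
`D` with the drift `Gam` remains. Write the flux as F_{j+1/2} = p_j f_j + q_j f_{j+1} with p_j =
VM_j/(2M_j) and q_j = VM_j/(2M_{j+1}). Then 2h[D,Γ]f is a combination of shifts of f whose
coefficients are the difference quotients P of p (`leftQuot`) and Q of q (`rightQuot`). If all of
them were equal to one number c, the combination would collapse to c(f_{j+2} - f_{j-2}) =
2hc((Df)_{j+1} + (Df)_{j-1}). Hence, if P is bounded and both P_{j+1} - P_j and Q_j - P_j are O(h),
uniformly in j and h, the commutator is pointwise at most a constant times neighbouring values of
|Df| and |f| (`exists_abs_comm_le`). Since 1/M is comparable at neighbouring nodes, this passes to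
the weighted norm, and Cauchy–Schwarz finishes.

The bounds on P and Q come from VM_{j+1} - VM_j = -h(ΛM)_{j+1}. It gives P_j =
-(1/2)((ΛM)_{j+1}/M_{j+1} + VM_j dM_j/(M_j M_{j+1})), where dM is the forward difference quotient of
M, and Q_j - P_j is a difference of two consecutive values of the second quotient. Both quotients
must be bounded and must change by O(h) per step. With w = 1+|v|, the orders are w^{-(1+α)} for M
and ΛM, w^{-(2+α)} for dM, and w^{-α} for VM; in each quotient the powers cancel exactly.
`GridSymbol` is the calculus of such orders, closed under products and inverses.

Three facts carry the analysis. First, M has order exactly w^{-(1+α)}, and each derivative of the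
density gains a power of w: the upper bounds come from rotating the Fourier contour
(`abs_dens_le_rpow`), the lower bound from splitting off an integrable part of the Lévy measure and
keeping a single jump of it (`exists_le_dens_zero`). Second, the weights satisfy β_k =
O((kh)^{-(1+α)}) because, for k ≥ 2, they are errors of quadrature rules applied to derivatives of
φ, so that `Lam` preserves the decay w^{-(1+α)} (`abs_beta_le`, `abs_Lam_le`). Third, ΛM sums to
zero over the grid, so the partial sums defining VM are, up to sign, tails and decay like w^{-α}
(`hasSum_Lam_zero`, `gridSymbol_VM`). -/

/-- `(1/π) Re ∫_{t>0} (i t)^k e^{i v t - t^α/α} dt`, the `k`-th derivative of the stable density. -/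
def dens (α : ℝ) (k : ℕ) (v : ℝ) : ℝ :=
  1 / Real.pi * (∫ t in Ioi (0 : ℝ), (Complex.I * t) ^ k *
    Complex.exp (Complex.I * v * t - ((t ^ α / α : ℝ) : ℂ))).re

theorem integrableOn_pow_mul_exp_neg_mul_rpow {α b : ℝ} (hα : 0 < α) (hb : 0 < b) (k : ℕ) :
    IntegrableOn (fun t : ℝ => t ^ k * Real.exp (-b * t ^ α)) (Ioi 0) := by
  have := integrableOn_rpow_mul_exp_neg_mul_rpow (p := α) (s := k) (b := b)
    (by have : (0 : ℝ) ≤ k := k.cast_nonneg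
        linarith) hα hb
  simpa only [Real.rpow_natCast] using this

theorem norm_dens_integrand {α : ℝ} (k : ℕ) (v : ℝ) {t : ℝ} (ht : 0 < t) :
    ‖(Complex.I * t) ^ k * Complex.exp (Complex.I * v * t - ((t ^ α / α : ℝ) : ℂ))‖ =
      t ^ k * Real.exp (-(1 / α) * t ^ α) := by
  rw [norm_mul, norm_pow, norm_mul, Complex.norm_I, one_mul, Complex.norm_real, Complex.norm_exp,
    Real.norm_of_nonneg ht.le]
  congr 2
  simp
  ring

theorem aestronglyMeasurable_dens_integrand {α : ℝ} (hα : 0 < α) (k : ℕ) (v : ℝ) :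
    AEStronglyMeasurable (fun t : ℝ => (Complex.I * t) ^ k *
      Complex.exp (Complex.I * v * t - ((t ^ α / α : ℝ) : ℂ))) (volume.restrict (Ioi 0)) := by
  have : Continuous fun t : ℝ => t ^ α := Real.continuous_rpow_const hα.le
  exact Continuous.aestronglyMeasurable (by fun_prop)

theorem integrable_dens_integrand {α : ℝ} (hα : 0 < α) (k : ℕ) (v : ℝ) :
    IntegrableOn (fun t : ℝ => (Complex.I * t) ^ k *
      Complex.exp (Complex.I * v * t - ((t ^ α / α : ℝ) : ℂ))) (Ioi 0) := by
  refine Integrable.mono' (integrableOn_pow_mul_exp_neg_mul_rpow hα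
    (one_div_pos.2 hα) k) (aestronglyMeasurable_dens_integrand hα k v) ?_
  filter_upwards [ae_restrict_mem measurableSet_Ioi] with t ht
  exact (norm_dens_integrand k v ht).le

theorem hasDerivAt_dens {α : ℝ} (hα : 0 < α) (k : ℕ) (v : ℝ) :
    HasDerivAt (dens α k) (dens α (k + 1) v) v := by
  have key := (hasDerivAt_integral_of_dominated_loc_of_deriv_le
    (μ := volume.restrict (Ioi (0 : ℝ))) (x₀ := v) (s := univ)
    (F := fun (v : ℝ) (t : ℝ) => (Complex.I * t) ^ k *
      Complex.exp (Complex.I * (v : ℂ) * (t : ℂ) - ((t ^ α / α : ℝ) : ℂ)))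
    (F' := fun (v : ℝ) (t : ℝ) => (Complex.I * t) ^ (k + 1) *
      Complex.exp (Complex.I * (v : ℂ) * (t : ℂ) - ((t ^ α / α : ℝ) : ℂ)))
    (bound := fun t => t ^ (k + 1) * Real.exp (-(1 / α) * t ^ α))
    univ_mem (Eventually.of_forall fun v => aestronglyMeasurable_dens_integrand hα k v)
    (integrable_dens_integrand hα k v) (aestronglyMeasurable_dens_integrand hα (k + 1) v)
    ?_ (integrableOn_pow_mul_exp_neg_mul_rpow hα (one_div_pos.2 hα) (k + 1)) ?_).2
  · have h2 := (Complex.reCLM.hasFDerivAt.comp_hasDerivAt v key).const_mul (1 / Real.pi)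
    exact h2
  · filter_upwards [ae_restrict_mem measurableSet_Ioi] with t ht v _
    exact (norm_dens_integrand (k + 1) v ht).le
  · refine Eventually.of_forall fun t v _ => ?_
    have h1 : HasDerivAt (fun v : ℝ => (v : ℂ)) 1 v := Complex.ofRealCLM.hasDerivAt
    have h2 := ((((h1.const_mul Complex.I).mul_const (t : ℂ)).sub_const
      ((t ^ α / α : ℝ) : ℂ)).cexp).const_mul ((Complex.I * (t : ℂ)) ^ k)
    convert! h2 using 1
    ring

theorem abs_dens_le (α : ℝ) (k : ℕ) :
    ∃ C : ℝ, 0 ≤ C ∧ ∀ v, |dens α k v| ≤ C := by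
  refine ⟨1 / Real.pi * ∫ t in Ioi (0 : ℝ), t ^ k * Real.exp (-(1 / α) * t ^ α), ?_, fun v => ?_⟩
  · refine mul_nonneg (by positivity) (setIntegral_nonneg measurableSet_Ioi fun t ht => ?_)
    have : (0 : ℝ) < t := ht
    positivity
  · rw [dens, abs_mul, abs_of_pos (by positivity)]
    refine mul_le_mul_of_nonneg_left ?_ (by positivity)
    refine (Complex.abs_re_le_norm _).trans ((norm_integral_le_integral_norm _).trans_eq ?_)
    exact setIntegral_congr_fun measurableSet_Ioi fun t ht => norm_dens_integrand k v ht

theorem dens_neg {α : ℝ} (k : ℕ) (v : ℝ) : dens α k (-v) = (-1) ^ k * dens α k v := by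
  have h : ∀ t : ℝ, (Complex.I * t) ^ k *
      Complex.exp (Complex.I * ((-v : ℝ) : ℂ) * t - ((t ^ α / α : ℝ) : ℂ)) =
      (((-1) ^ k : ℝ) : ℂ) * (starRingEnd ℂ) ((Complex.I * t) ^ k *
      Complex.exp (Complex.I * v * t - ((t ^ α / α : ℝ) : ℂ))) := by
    intro t
    rw [map_mul, map_pow, map_mul, Complex.conj_I, Complex.conj_ofReal, ← Complex.exp_conj, map_sub,
      map_mul, map_mul, Complex.conj_I, Complex.conj_ofReal, Complex.conj_ofReal,
      Complex.conj_ofReal]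
    push_cast
    rw [← mul_assoc, ← mul_pow]
    congr 2 <;> ring
  unfold dens
  simp_rw [h]
  rw [integral_const_mul, integral_conj, Complex.re_ofReal_mul, Complex.conj_re]
  ring

theorem integrable_of_even_of_integrableOn_Ioi {f : ℝ → ℝ} (hf : ∀ t, f (-t) = f t)
    (h : IntegrableOn f (Ioi 0)) : Integrable f := by
  have h2 : IntegrableOn f (Iic 0) := by
    rw [← Measure.map_neg_eq_self (volume : Measure ℝ)]
    let m : MeasurableEmbedding fun x : ℝ => -x := (Homeomorph.neg ℝ).measurableEmbedding
    rw [m.integrableOn_map_iff]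
    simp only [Function.comp_def, hf, neg_preimage, neg_Iic, neg_zero]
    exact Iff.mpr integrableOn_Ici_iff_integrableOn_Ioi h
  rw [← integrableOn_univ, ← Iic_union_Ioi (a := (0 : ℝ))]
  exact h2.union h

/-- The real part of the integrand is even, so the integral over the line is twice the one over the
half-line, where the contour can be rotated. -/
theorem mu_eq_dens {α : ℝ} (hα : 0 < α) (v : ℝ) : mu α v = dens α 0 v := by
  have hre : ∀ t : ℝ, (Complex.exp (Complex.I * v * t - ((|t| ^ α / α : ℝ) : ℂ))).re =
      Real.exp (-(|t| ^ α / α)) * Real.cos (v * |t|) := by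
    intro t
    rw [Complex.exp_re]
    congr 1
    · simp
    · have h1 : (Complex.I * v * t - ((|t| ^ α / α : ℝ) : ℂ)).im = v * t := by simp
      rw [h1]
      rcases abs_cases t with ⟨h, _⟩ | ⟨h, _⟩ <;> simp [h]
  have habs : ∀ t ∈ Ioi (0 : ℝ), (Complex.I * t) ^ 0 *
      Complex.exp (Complex.I * v * t - ((t ^ α / α : ℝ) : ℂ)) =
      Complex.exp (Complex.I * v * t - ((|t| ^ α / α : ℝ) : ℂ)) := by
    intro t ht
    rw [abs_of_pos ht, pow_zero, one_mul]
  have hcont : Continuous fun t : ℝ => t ^ α := Real.continuous_rpow_const hα.le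
  have hint0 : IntegrableOn (fun t : ℝ =>
      Complex.exp (Complex.I * v * t - ((|t| ^ α / α : ℝ) : ℂ))) (Ioi 0) :=
    (integrable_dens_integrand hα 0 v).congr_fun habs measurableSet_Ioi
  have hnorm : ∀ t : ℝ, ‖Complex.exp (Complex.I * v * t - ((|t| ^ α / α : ℝ) : ℂ))‖ =
      Real.exp (-(|t| ^ α / α)) := by
    intro t
    rw [Complex.norm_exp]
    simp
  have hint : Integrable fun t : ℝ =>
      Complex.exp (Complex.I * v * t - ((|t| ^ α / α : ℝ) : ℂ)) := by
    have h1 : IntegrableOn (fun t : ℝ => Real.exp (-(|t| ^ α / α))) (Ioi 0) := by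
      refine Integrable.congr hint0.norm (ae_of_all _ hnorm)
    have h2 : Integrable (fun t : ℝ => Real.exp (-(|t| ^ α / α))) :=
      integrable_of_even_of_integrableOn_Ioi (fun t => by simp only [abs_neg]) h1
    refine h2.mono' (Continuous.aestronglyMeasurable ?_) (ae_of_all _ fun t => (hnorm t).le)
    have := hcont.comp continuous_abs
    simp only [Function.comp_def] at this
    fun_prop
  have e1 : (∫ t : ℝ, Complex.exp (Complex.I * v * t - ((|t| ^ α / α : ℝ) : ℂ))).re =
      ∫ t : ℝ, Real.exp (-(|t| ^ α / α)) * Real.cos (v * |t|) := by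
    rw [← Complex.reCLM_apply, ← Complex.reCLM.integral_comp_comm hint]
    exact integral_congr_ae (ae_of_all _ hre)
  have e2 : (∫ t in Ioi (0 : ℝ), (Complex.I * t) ^ 0 *
      Complex.exp (Complex.I * v * t - ((t ^ α / α : ℝ) : ℂ))).re =
      ∫ t in Ioi (0 : ℝ), Real.exp (-(t ^ α / α)) * Real.cos (v * t) := by
    rw [setIntegral_congr_fun measurableSet_Ioi habs, ← Complex.reCLM_apply,
      ← Complex.reCLM.integral_comp_comm hint0]
    refine setIntegral_congr_fun measurableSet_Ioi fun t ht => ?_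
    simp only [Complex.reCLM_apply]
    rw [hre, abs_of_pos ht]
  rw [mu, dens, e1, e2,
    integral_comp_abs (f := fun t : ℝ => Real.exp (-(t ^ α / α)) * Real.cos (v * t))]
  field_simp

/-! ### Contour rotation and decay of the density -/

/-- The integrand `(i z)^k e^{i v z - c z^α} dz` on the ray `z = t e^{iθ}`. -/
def rayIntegrand (α c v : ℝ) (k : ℕ) (θ t : ℝ) : ℂ :=
  Complex.exp (θ * Complex.I) * (Complex.I * t * Complex.exp (θ * Complex.I)) ^ k *
    Complex.exp (Complex.I * v * (t * Complex.exp (θ * Complex.I)) -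
      ((c * t ^ α : ℝ) : ℂ) * Complex.exp (α * θ * Complex.I))

/-- The logarithmic derivative in `θ` of `rayIntegrand`, divided by `i`. -/
def rayFactor (α c v : ℝ) (k : ℕ) (θ t : ℝ) : ℂ :=
  (k + 1) + Complex.I * v * (t * Complex.exp (θ * Complex.I)) -
    ((α * c * t ^ α : ℝ) : ℂ) * Complex.exp (α * θ * Complex.I)

theorem norm_exp_mul_I (x : ℝ) : ‖Complex.exp (x * Complex.I)‖ = 1 :=
  Complex.norm_exp_ofReal_mul_I x

theorem norm_rayIntegrand (α c v : ℝ) (k : ℕ) (θ : ℝ) {t : ℝ} (ht : 0 < t) :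
    ‖rayIntegrand α c v k θ t‖ =
      t ^ k * Real.exp (-(v * Real.sin θ * t + c * Real.cos (α * θ) * t ^ α)) := by
  rw [rayIntegrand, norm_mul, norm_mul, norm_pow, norm_mul, norm_mul, Complex.norm_I,
    norm_exp_mul_I, one_mul, one_mul, mul_one, Complex.norm_real, Real.norm_of_nonneg ht.le,
    Complex.norm_exp]
  congr 2
  have h1 := Complex.exp_ofReal_mul_I_im θ
  have h2 : (Complex.exp (α * θ * Complex.I)).re = Real.cos (α * θ) := by
    rw [← Complex.ofReal_mul, Complex.exp_ofReal_mul_I_re]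
  rw [Complex.sub_re, Complex.re_ofReal_mul, h2, ← mul_assoc, mul_assoc Complex.I,
    ← Complex.ofReal_mul, mul_assoc, Complex.I_mul_re, Complex.im_ofReal_mul, h1]
  ring

theorem norm_rayFactor_le {α c v : ℝ} (hα : 0 ≤ α) (hc : 0 ≤ c) (hv : 0 ≤ v) (k : ℕ) (θ : ℝ)
    {t : ℝ} (ht : 0 < t) :
    ‖rayFactor α c v k θ t‖ ≤ (k + 1) + v * t + α * c * t ^ α := by
  have h1 : ‖Complex.I * v * (t * Complex.exp (θ * Complex.I))‖ = v * t := by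
    rw [norm_mul, norm_mul, norm_mul, Complex.norm_I, norm_exp_mul_I, Complex.norm_real,
      Complex.norm_real, Real.norm_of_nonneg hv, Real.norm_of_nonneg ht.le]
    ring
  have h2 : ‖((α * c * t ^ α : ℝ) : ℂ) * Complex.exp (α * θ * Complex.I)‖ = α * c * t ^ α := by
    rw [norm_mul, ← Complex.ofReal_mul, norm_exp_mul_I, Complex.norm_real,
      Real.norm_of_nonneg (by positivity), mul_one]
  have h3 : ‖((k : ℂ) + 1)‖ = k + 1 := by
    rw [← Nat.cast_succ, Complex.norm_natCast]
    push_cast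
    ring
  rw [rayFactor]
  refine (norm_sub_le _ _).trans ?_
  rw [h2]
  gcongr
  refine (norm_add_le _ _).trans ?_
  rw [h1, h3]

theorem hasDerivAt_rayIntegrand_angle (α c v : ℝ) (k : ℕ) (θ t : ℝ) :
    HasDerivAt (fun θ => rayIntegrand α c v k θ t)
      (Complex.I * rayFactor α c v k θ t * rayIntegrand α c v k θ t) θ := by
  have h0 : HasDerivAt (fun θ : ℝ => (θ : ℂ)) 1 θ := Complex.ofRealCLM.hasDerivAt
  have h1 := (h0.mul_const Complex.I).cexp
  have h2 := (h1.const_mul (Complex.I * (t : ℂ))).pow k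
  have h3 := ((h0.const_mul (α : ℂ)).mul_const Complex.I).cexp
  have h4 := (((h1.const_mul (t : ℂ)).const_mul (Complex.I * (v : ℂ))).sub
    (h3.const_mul ((c * t ^ α : ℝ) : ℂ))).cexp
  have h5 := (h1.mul h2).mul h4
  refine h5.congr_deriv ?_
  simp only [rayFactor, rayIntegrand, Pi.mul_apply, Pi.pow_apply, Pi.sub_apply]
  push_cast
  rcases k with _ | k
  · simp
    ring
  · simp only [Nat.add_sub_cancel, pow_succ]
    push_cast
    ring

/-- Compared with `hasDerivAt_rayIntegrand_angle`, this shows that the angular derivative of the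
integrand is i times the exact radial derivative of t times the integrand. Its integral over the ray
therefore vanishes, which is Cauchy's theorem for the sector. -/
theorem hasDerivAt_mul_rayIntegrand (α c v : ℝ) (k : ℕ) (θ : ℝ) {t : ℝ} (ht : 0 < t) :
    HasDerivAt (fun t : ℝ => (t : ℂ) * rayIntegrand α c v k θ t)
      (rayFactor α c v k θ t * rayIntegrand α c v k θ t) t := by
  have h0 : HasDerivAt (fun t : ℝ => (t : ℂ)) 1 t := Complex.ofRealCLM.hasDerivAt
  have hp : HasDerivAt (fun t : ℝ => ((c * t ^ α : ℝ) : ℂ)) ((c * (α * t ^ (α - 1)) : ℝ) : ℂ) t :=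
    ((Real.hasDerivAt_rpow_const (Or.inl ht.ne')).const_mul c).ofReal_comp
  have h2 := (((h0.const_mul Complex.I).mul_const (Complex.exp (θ * Complex.I))).pow k).const_mul
    (Complex.exp (θ * Complex.I))
  have h4 := (((h0.mul_const (Complex.exp (θ * Complex.I))).const_mul (Complex.I * (v : ℂ))).sub
    (hp.mul_const (Complex.exp (α * θ * Complex.I)))).cexp
  have h5 := h0.mul (h2.mul h4)
  refine h5.congr_deriv ?_
  have hpow : (t : ℂ) * ((t ^ (α - 1) : ℝ) : ℂ) = ((t ^ α : ℝ) : ℂ) := by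
    rw [← Complex.ofReal_mul, Real.rpow_sub_one ht.ne', mul_div_cancel₀ _ ht.ne']
  simp only [rayFactor, rayIntegrand, Pi.mul_apply, Pi.pow_apply, Pi.sub_apply]
  push_cast
  rw [← hpow]
  rcases k with _ | k
  · simp
    ring
  · simp only [Nat.add_sub_cancel, pow_succ]
    push_cast
    ring

theorem continuous_rayIntegrand {α : ℝ} (hα : 0 ≤ α) (c v : ℝ) (k : ℕ) (θ : ℝ) :
    Continuous (rayIntegrand α c v k θ) := by
  have : Continuous fun t : ℝ => t ^ α := Real.continuous_rpow_const hα
  unfold rayIntegrand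
  fun_prop

theorem continuous_rayFactor {α : ℝ} (hα : 0 ≤ α) (c v : ℝ) (k : ℕ) (θ : ℝ) :
    Continuous (rayFactor α c v k θ) := by
  have : Continuous fun t : ℝ => t ^ α := Real.continuous_rpow_const hα
  unfold rayFactor
  fun_prop

theorem tendsto_pow_mul_exp_neg_mul_rpow {γ b : ℝ} (hγ : 0 < γ) (hb : 0 < b) (k : ℕ) :
    Tendsto (fun t : ℝ => t ^ k * Real.exp (-b * t ^ γ)) atTop (𝓝 0) := by
  have h := (tendsto_rpow_mul_exp_neg_mul_atTop_nhds_zero (k / γ) b hb).comp (tendsto_rpow_atTop hγ)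
  refine h.congr' ?_
  filter_upwards [eventually_gt_atTop 0] with t ht
  simp only [Function.comp_apply]
  rw [← Real.rpow_mul ht.le, mul_div_cancel₀ _ hγ.ne', Real.rpow_natCast]

/-- Rotation of the contour: the integral of `rayIntegrand` does not depend on the angle as long as
the integrand decays uniformly. -/
theorem re_integral_rayIntegrand_eq {α c v : ℝ} (hα : 0 < α) (hc : 0 ≤ c) (hv : 0 ≤ v) (k : ℕ)
    {θ₁ θ₂ γ b : ℝ} (hθ : θ₁ < θ₂) (hγ : 0 < γ) (hb : 0 < b)
    (hdec : ∀ θ ∈ Icc θ₁ θ₂, ∀ t : ℝ, 0 < t →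
      b * t ^ γ ≤ v * Real.sin θ * t + c * Real.cos (α * θ) * t ^ α) :
    (∫ t in Ioi (0 : ℝ), rayIntegrand α c v k θ₁ t).re =
      (∫ t in Ioi (0 : ℝ), rayIntegrand α c v k θ₂ t).re := by
  have hnorm : ∀ θ ∈ Icc θ₁ θ₂, ∀ t : ℝ, 0 < t →
      ‖rayIntegrand α c v k θ t‖ ≤ t ^ k * Real.exp (-b * t ^ γ) := by
    intro θ hθ t ht
    rw [norm_rayIntegrand _ _ _ _ _ ht]
    gcongr
    linarith [hdec θ hθ t ht]
  have hcont : ContinuousOn (fun θ => ∫ t in Ioi (0 : ℝ), rayIntegrand α c v k θ t)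
      (Icc θ₁ θ₂) := by
    refine continuousOn_of_dominated (bound := fun t => t ^ k * Real.exp (-b * t ^ γ))
      (fun θ _ => (continuous_rayIntegrand hα.le c v k θ).aestronglyMeasurable) ?_
      (integrableOn_pow_mul_exp_neg_mul_rpow hγ hb k) ?_
    · intro θ hθ
      filter_upwards [ae_restrict_mem measurableSet_Ioi] with t ht
      exact hnorm θ hθ t ht
    · exact ae_of_all _ fun t θ _ =>
        (hasDerivAt_rayIntegrand_angle α c v k θ t).continuousAt.continuousWithinAt
  have hbound : ∀ θ ∈ Icc θ₁ θ₂, ∀ t : ℝ, 0 < t →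
      ‖rayFactor α c v k θ t * rayIntegrand α c v k θ t‖ ≤
        ((k + 1) + v * t + α * c * t ^ α) * (t ^ k * Real.exp (-b * t ^ γ)) := by
    intro θ hθ t ht
    rw [norm_mul]
    gcongr
    · exact norm_rayFactor_le hα.le hc hv k θ ht
    · exact hnorm θ hθ t ht
  have hbint : IntegrableOn (fun t : ℝ =>
      ((k + 1) + v * t + α * c * t ^ α) * (t ^ k * Real.exp (-b * t ^ γ))) (Ioi 0) := by
    have i1 := (integrableOn_pow_mul_exp_neg_mul_rpow hγ hb k).const_mul ((k : ℝ) + 1)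
    have i2 := (integrableOn_pow_mul_exp_neg_mul_rpow hγ hb (k + 1)).const_mul v
    have i3 := (integrableOn_rpow_mul_exp_neg_mul_rpow (p := γ) (s := α + k) (b := b)
      (by have : (0 : ℝ) ≤ k := k.cast_nonneg
          linarith) hγ hb).const_mul (α * c)
    refine IntegrableOn.congr_fun ((i1.add i2).add i3) (fun t ht => ?_) measurableSet_Ioi
    simp only [Pi.add_apply]
    rw [Real.rpow_add ht, Real.rpow_natCast]
    ring
  have hzero : ∀ θ ∈ Icc θ₁ θ₂,
      ∫ t in Ioi (0 : ℝ), rayFactor α c v k θ t * rayIntegrand α c v k θ t = 0 := by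
    intro θ hθ
    have hc1 := continuous_rayIntegrand hα.le c v k θ
    have := integral_Ioi_of_hasDerivAt_of_tendsto (a := (0 : ℝ)) (m := (0 : ℂ))
      (f := fun t : ℝ => (t : ℂ) * rayIntegrand α c v k θ t)
      (f' := fun t => rayFactor α c v k θ t * rayIntegrand α c v k θ t)
      (Continuous.continuousWithinAt (by fun_prop))
      (fun t ht => hasDerivAt_mul_rayIntegrand α c v k θ ht) ?_ ?_
    · simpa using this
    · refine Integrable.mono' hbint
        ((continuous_rayFactor hα.le c v k θ).mul hc1).aestronglyMeasurable ?_
      filter_upwards [ae_restrict_mem measurableSet_Ioi] with t ht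
      exact hbound θ hθ t ht
    · refine squeeze_zero_norm' ?_ (tendsto_pow_mul_exp_neg_mul_rpow hγ hb (k + 1))
      filter_upwards [eventually_gt_atTop 0] with t ht
      rw [norm_mul, Complex.norm_real, Real.norm_of_nonneg ht.le, pow_succ', mul_assoc]
      exact mul_le_mul_of_nonneg_left (hnorm θ hθ t ht) ht.le
  have hderiv : ∀ θ ∈ Ioo θ₁ θ₂,
      HasDerivAt (fun θ => ∫ t in Ioi (0 : ℝ), rayIntegrand α c v k θ t) 0 θ := by
    intro θ hθ
    have key := (hasDerivAt_integral_of_dominated_loc_of_deriv_le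
      (μ := volume.restrict (Ioi (0 : ℝ))) (x₀ := θ) (s := Icc θ₁ θ₂)
      (F := fun θ t => rayIntegrand α c v k θ t)
      (F' := fun θ t => Complex.I * rayFactor α c v k θ t * rayIntegrand α c v k θ t)
      (bound := fun t => ((k + 1) + v * t + α * c * t ^ α) * (t ^ k * Real.exp (-b * t ^ γ)))
      (Icc_mem_nhds hθ.1 hθ.2)
      (Eventually.of_forall fun θ => (continuous_rayIntegrand hα.le c v k θ).aestronglyMeasurable)
      ?_ (((continuous_const.mul (continuous_rayFactor hα.le c v k θ)).mul
        (continuous_rayIntegrand hα.le c v k θ)).aestronglyMeasurable) ?_ hbint ?_).2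
    · refine key.congr_deriv ?_
      simp_rw [mul_assoc]
      rw [integral_const_mul, hzero θ (Ioo_subset_Icc_self hθ), mul_zero]
    · refine Integrable.mono' (integrableOn_pow_mul_exp_neg_mul_rpow hγ hb k)
        (continuous_rayIntegrand hα.le c v k θ).aestronglyMeasurable ?_
      filter_upwards [ae_restrict_mem measurableSet_Ioi] with t ht
      exact hnorm θ (Ioo_subset_Icc_self hθ) t ht
    · filter_upwards [ae_restrict_mem measurableSet_Ioi] with t ht θ hθ
      rw [mul_assoc, norm_mul, Complex.norm_I, one_mul]
      exact hbound θ hθ t ht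
    · exact ae_of_all _ fun t θ _ => hasDerivAt_rayIntegrand_angle α c v k θ t
  -- The mean value theorem in this form needs a real-valued function; the real part is all that is
  -- used later.
  obtain ⟨x, _, hx⟩ := exists_hasDerivAt_eq_slope
    (fun θ => (∫ t in Ioi (0 : ℝ), rayIntegrand α c v k θ t).re) (fun _ => 0) hθ
    (Complex.continuous_re.comp_continuousOn hcont)
    (fun θ hθ => (Complex.reCLM.hasFDerivAt.comp_hasDerivAt θ (hderiv θ hθ)).congr_deriv
      (map_zero _))
  have h1 : θ₂ - θ₁ ≠ 0 := by linarith
  have := (div_eq_zero_iff.1 hx.symm).resolve_right h1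
  linarith

theorem norm_exp_neg_sub_one_le {z : ℂ} (hz : 0 ≤ z.re) : ‖Complex.exp (-z) - 1‖ ≤ 2 * ‖z‖ := by
  rcases le_or_gt ‖z‖ 1 with h | h
  · have := Complex.norm_exp_sub_one_le (x := -z) (by rwa [norm_neg])
    rwa [norm_neg] at this
  · have h1 : ‖Complex.exp (-z)‖ ≤ 1 := by
      rw [Complex.norm_exp, Real.exp_le_one_iff, Complex.neg_re]
      linarith
    calc ‖Complex.exp (-z) - 1‖ ≤ ‖Complex.exp (-z)‖ + ‖(1 : ℂ)‖ := norm_sub_le _ _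
      _ ≤ 2 * ‖z‖ := by
        rw [norm_one]
        linarith

/-- Without the stable factor the ray can be turned on to the imaginary axis, where the integrand is
i times a real function. This is the term to subtract in order to expose the decay of the density.
-/
theorem re_integral_rayIntegrand_zero {α v : ℝ} (hα : 0 < α) (hv : 0 < v) (k : ℕ) :
    (∫ t in Ioi (0 : ℝ), rayIntegrand α 0 v k (Real.pi / 4) t).re = 0 := by
  have hs : 0 < Real.sin (Real.pi / 4) :=
    Real.sin_pos_of_pos_of_lt_pi (by positivity) (by linarith [Real.pi_pos])
  rw [re_integral_rayIntegrand_eq (θ₂ := Real.pi / 2) (γ := 1) (b := v * Real.sin (Real.pi / 4))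
    hα le_rfl hv.le k (by linarith [Real.pi_pos]) one_pos (by positivity)]
  · have h : ∀ t : ℝ, rayIntegrand α 0 v k (Real.pi / 2) t =
        Complex.I * (((-t) ^ k * Real.exp (-(v * t)) : ℝ) : ℂ) := by
      intro t
      have hI : Complex.exp (((Real.pi / 2 : ℝ) : ℂ) * Complex.I) = Complex.I := by
        push_cast
        exact Complex.exp_pi_div_two_mul_I
      rw [rayIntegrand, hI]
      push_cast
      have e1 : Complex.I * t * Complex.I = -t := by
        linear_combination (t : ℂ) * Complex.I_mul_I
      have e3 : Complex.I * v * (t * Complex.I) = -(v * t) := by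
        linear_combination ((v : ℂ) * t) * Complex.I_mul_I
      rw [e1, e3]
      simp
      ring
    simp_rw [h]
    rw [integral_const_mul, integral_complex_ofReal, Complex.I_mul_re, Complex.ofReal_im, neg_zero]
  · intro θ hθ t ht
    rw [Real.rpow_one, zero_mul, zero_mul, add_zero]
    gcongr
    exact Real.sin_le_sin_of_le_of_le_pi_div_two (by linarith [Real.pi_pos]) hθ.2 hθ.1

/-- Decay of the stable density and of its derivatives. -/
theorem abs_dens_le_rpow {α : ℝ} (hα : 0 < α) (hα₂ : α < 2) (k : ℕ) :
    ∃ C : ℝ, 0 ≤ C ∧ ∀ v, 0 < v → |dens α k v| ≤ C * v ^ (-(1 + α + k)) := by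
  set s := Real.sin (Real.pi / 4) with hsdef
  have hs : 0 < s := Real.sin_pos_of_pos_of_lt_pi (by positivity) (by linarith [Real.pi_pos])
  have hpi := Real.pi_pos
  -- Here α < 2 matters: απ/4 stays below π/2, so the stable factor decays in the whole sector up to
  -- angle π/4.
  have hcos : 0 < Real.cos (α * (Real.pi / 4)) :=
    Real.cos_pos_of_mem_Ioo ⟨by nlinarith, by nlinarith⟩
  have hk : (0 : ℝ) ≤ k := k.cast_nonneg
  refine ⟨1 / Real.pi * (2 / α * ((1 / s) ^ (1 + α + k) * Real.Gamma (1 + α + k))), ?_,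
    fun v hv => ?_⟩
  · have := Real.Gamma_pos_of_pos (show 0 < 1 + α + k by linarith)
    positivity
  have e0 : (∫ t in Ioi (0 : ℝ), (Complex.I * t) ^ k *
      Complex.exp (Complex.I * v * t - ((t ^ α / α : ℝ) : ℂ))) =
      ∫ t in Ioi (0 : ℝ), rayIntegrand α (1 / α) v k 0 t := by
    refine integral_congr_ae (ae_of_all _ fun t => ?_)
    simp [rayIntegrand]
    left
    ring_nf
  have hdec : ∀ θ ∈ Icc (0 : ℝ) (Real.pi / 4), ∀ t : ℝ, 0 < t →
      1 / α * Real.cos (α * (Real.pi / 4)) * t ^ α ≤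
        v * Real.sin θ * t + 1 / α * Real.cos (α * θ) * t ^ α := by
    intro θ hθ t ht
    have h1 : 0 ≤ Real.sin θ := Real.sin_nonneg_of_nonneg_of_le_pi hθ.1 (by linarith [hθ.2])
    have h2 : Real.cos (α * (Real.pi / 4)) ≤ Real.cos (α * θ) :=
      Real.cos_le_cos_of_nonneg_of_le_pi (mul_nonneg hα.le hθ.1) (by nlinarith)
        (mul_le_mul_of_nonneg_left hθ.2 hα.le)
    have h3 : 0 ≤ v * Real.sin θ * t := by positivity
    have h4 : 1 / α * Real.cos (α * (Real.pi / 4)) * t ^ α ≤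
        1 / α * Real.cos (α * θ) * t ^ α := by gcongr
    linarith
  have hrot := re_integral_rayIntegrand_eq (θ₁ := 0) (θ₂ := Real.pi / 4) (γ := α)
    (b := 1 / α * Real.cos (α * (Real.pi / 4))) hα (one_div_pos.2 hα).le hv.le k (by positivity)
    hα (by positivity) hdec
  have hint : ∀ c : ℝ, 0 ≤ c →
      IntegrableOn (rayIntegrand α c v k (Real.pi / 4)) (Ioi 0) := by
    intro c hc
    refine Integrable.mono' (integrableOn_pow_mul_exp_neg_mul_rpow (α := 1) (b := v * s) one_pos
      (by positivity) k) (continuous_rayIntegrand hα.le c v k _).aestronglyMeasurable ?_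
    filter_upwards [ae_restrict_mem measurableSet_Ioi] with t ht
    rw [norm_rayIntegrand _ _ _ _ _ ht, Real.rpow_one]
    have ht' : (0 : ℝ) < t := ht
    gcongr
    have : 0 ≤ c * Real.cos (α * (Real.pi / 4)) * t ^ α := by positivity
    linarith
  have hdiff : ∀ t : ℝ, 0 < t → ‖rayIntegrand α (1 / α) v k (Real.pi / 4) t -
      rayIntegrand α 0 v k (Real.pi / 4) t‖ ≤
      2 / α * (t ^ (1 + α + k - 1) * Real.exp (-(v * s * t))) := by
    intro t ht
    set z : ℂ := ((1 / α * t ^ α : ℝ) : ℂ) * Complex.exp (α * (Real.pi / 4 : ℝ) * Complex.I)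
      with hz
    have hzn : ‖z‖ = 1 / α * t ^ α := by
      rw [hz, norm_mul, ← Complex.ofReal_mul, norm_exp_mul_I, Complex.norm_real,
        Real.norm_of_nonneg (by positivity), mul_one]
    have hzr : 0 ≤ z.re := by
      rw [hz, Complex.re_ofReal_mul, ← Complex.ofReal_mul, Complex.exp_ofReal_mul_I_re]
      positivity
    have hfac : rayIntegrand α (1 / α) v k (Real.pi / 4) t -
        rayIntegrand α 0 v k (Real.pi / 4) t =
        rayIntegrand α 0 v k (Real.pi / 4) t * (Complex.exp (-z) - 1) := by
      rw [mul_sub, mul_one]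
      congr 1
      rw [rayIntegrand, rayIntegrand, mul_assoc (_ * _ ^ k), ← Complex.exp_add]
      congr 2
      rw [hz]
      push_cast
      ring
    rw [hfac, norm_mul, norm_rayIntegrand _ _ _ _ _ ht]
    calc _ ≤ t ^ k * Real.exp (-(v * s * t + 0 * Real.cos (α * (Real.pi / 4)) * t ^ α)) *
          (2 * ‖z‖) := by
          gcongr
          exact norm_exp_neg_sub_one_le hzr
      _ = _ := by
        rw [hzn, show 1 + α + (k : ℝ) - 1 = α + k by ring, Real.rpow_add ht, Real.rpow_natCast,
          zero_mul, zero_mul, add_zero]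
        ring
  -- Subtracting the integral with zero real part replaces exp(-z) by exp(-z) - 1 = O(t^α). The
  -- extra t^α yields, through the Gamma integral, the extra factor v^{-α}.
  have hre : (∫ t in Ioi (0 : ℝ), rayIntegrand α (1 / α) v k (Real.pi / 4) t).re =
      (∫ t in Ioi (0 : ℝ), (rayIntegrand α (1 / α) v k (Real.pi / 4) t -
        rayIntegrand α 0 v k (Real.pi / 4) t)).re := by
    rw [integral_sub (hint _ (one_div_pos.2 hα).le) (hint 0 le_rfl), Complex.sub_re,
      re_integral_rayIntegrand_zero hα hv, sub_zero]
  have hvs : 0 < v * s := by positivity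
  have hG := Real.integral_rpow_mul_exp_neg_mul_Ioi (a := 1 + α + k) (r := v * s)
    (by linarith) hvs
  have hbi : IntegrableOn (fun t : ℝ => 2 / α * (t ^ (1 + α + k - 1) * Real.exp (-(v * s * t))))
      (Ioi 0) := by
    have := (integrableOn_rpow_mul_exp_neg_mul_rpow (p := 1) (s := 1 + α + k - 1) (b := v * s)
      (by linarith) one_pos hvs).const_mul (2 / α)
    simp only [Real.rpow_one, neg_mul] at this
    exact this
  rw [dens, abs_mul, abs_of_pos (by positivity), e0, hrot, hre, mul_assoc]
  refine mul_le_mul_of_nonneg_left ?_ (by positivity)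
  refine (Complex.abs_re_le_norm _).trans ?_
  have hle := norm_integral_le_of_norm_le hbi
    (f := fun t => rayIntegrand α (1 / α) v k (Real.pi / 4) t -
        rayIntegrand α 0 v k (Real.pi / 4) t)
    (by filter_upwards [ae_restrict_mem measurableSet_Ioi] with t ht using hdiff t ht)
  refine hle.trans_eq ?_
  rw [integral_const_mul, hG, Real.rpow_neg hv.le, one_div, one_div, Real.inv_rpow hvs.le,
    Real.mul_rpow hv.le hs.le, Real.inv_rpow hs.le, mul_inv]
  ring

/-- Decay of the stable density and its derivatives. -/
theorem abs_dens_le_weight {α : ℝ} (hα : 0 < α) (hα₂ : α < 2) (k : ℕ) :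
    ∃ C : ℝ, 0 < C ∧ ∀ v, |dens α k v| ≤ C * (1 + |v|) ^ (-(1 + α + k)) := by
  obtain ⟨A, hA, hA'⟩ := abs_dens_le α k
  obtain ⟨B, hB, hB'⟩ := abs_dens_le_rpow hα hα₂ k
  have hk : (0 : ℝ) ≤ k := k.cast_nonneg
  have habs : ∀ v, |dens α k v| = |dens α k (|v|)| := by
    intro v
    rcases abs_cases v with ⟨h, _⟩ | ⟨h, _⟩
    · rw [h]
    · rw [h, dens_neg, abs_mul, abs_pow, abs_neg, abs_one, one_pow, one_mul]
  refine ⟨(A + B + 1) * 2 ^ (1 + α + k), by positivity, fun v => ?_⟩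
  rw [habs]
  have h0 := abs_nonneg v
  have h2 : ∀ x : ℝ, 0 < x → 1 + |v| ≤ 2 * x →
      x ^ (-(1 + α + k)) ≤ 2 ^ (1 + α + k) * (1 + |v|) ^ (-(1 + α + k)) := by
    intro x hx hvx
    have h3 : (2 * x) ^ (-(1 + α + k)) ≤ (1 + |v|) ^ (-(1 + α + k)) :=
      Real.rpow_le_rpow_of_nonpos (by positivity) hvx (by linarith)
    rw [Real.mul_rpow (by norm_num) hx.le, Real.rpow_neg (by norm_num)] at h3
    have h4 : (0 : ℝ) < 2 ^ (1 + α + k) := by positivity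
    calc x ^ (-(1 + α + k)) =
        2 ^ (1 + α + k) * ((2 ^ (1 + α + k))⁻¹ * x ^ (-(1 + α + k))) := by field_simp
      _ ≤ _ := by gcongr
  have hpos : 0 ≤ 2 ^ (1 + α + k) * (1 + |v|) ^ (-(1 + α + k)) := by positivity
  rw [mul_assoc]
  rcases le_or_gt 1 |v| with h | h
  · calc |dens α k (|v|)| ≤ B * |v| ^ (-(1 + α + k)) := hB' _ (by linarith)
      _ ≤ B * (2 ^ (1 + α + k) * (1 + |v|) ^ (-(1 + α + k))) := by
        gcongr
        exact h2 _ (by linarith) (by linarith)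
      _ ≤ _ := mul_le_mul_of_nonneg_right (by linarith) hpos
  · calc |dens α k (|v|)| ≤ A * (1 : ℝ) ^ (-(1 + α + k)) := by
          rw [Real.one_rpow, mul_one]
          exact hA' _
      _ ≤ A * (2 ^ (1 + α + k) * (1 + |v|) ^ (-(1 + α + k))) := by
        gcongr
        exact h2 _ one_pos (by linarith)
      _ ≤ _ := mul_le_mul_of_nonneg_right (by linarith) hpos

/-! ### Functions with nonnegative cosine transform -/

/-- The cosine transform on the half-line. -/
def cosT (H : ℝ → ℝ) (v : ℝ) : ℝ := ∫ ξ in Ioi (0 : ℝ), H ξ * Real.cos (v * ξ)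

/-- Integrable functions on the half-line whose cosine transform is nonnegative. -/
def CosPos (H : ℝ → ℝ) : Prop := IntegrableOn H (Ioi 0) ∧ ∀ v, 0 ≤ cosT H v

theorem integrableOn_mul_cos {H : ℝ → ℝ} (hH : IntegrableOn H (Ioi 0)) (v : ℝ) :
    IntegrableOn (fun ξ => H ξ * Real.cos (v * ξ)) (Ioi 0) :=
  Integrable.mul_bdd (c := 1) hH (Continuous.aestronglyMeasurable (by fun_prop))
    (ae_of_all _ fun ξ => Real.abs_cos_le_one _)

theorem continuous_cosT {H : ℝ → ℝ} (hH : IntegrableOn H (Ioi 0)) : Continuous (cosT H) := by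
  refine continuous_of_dominated (bound := fun ξ => ‖H ξ‖)
    (fun v => (integrableOn_mul_cos hH v).aestronglyMeasurable) (fun v => ?_) hH.norm
    (ae_of_all _ fun ξ => by fun_prop)
  refine ae_of_all _ fun ξ => ?_
  rw [norm_mul]
  exact mul_le_of_le_one_right (norm_nonneg _) (Real.abs_cos_le_one _)

theorem abs_cosT_le {H : ℝ → ℝ} (hH : IntegrableOn H (Ioi 0)) (v : ℝ) :
    |cosT H v| ≤ ∫ ξ in Ioi (0 : ℝ), |H ξ| := by
  rw [← Real.norm_eq_abs, cosT]
  refine norm_integral_le_of_norm_le hH.norm (ae_of_all _ fun ξ => ?_)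
  rw [norm_mul]
  exact mul_le_of_le_one_right (norm_nonneg _) (Real.abs_cos_le_one _)

/-- The transform is the Cauchy kernel σ/(σ² + v²). -/
theorem cosPos_exp {σ : ℝ} (hσ : 0 < σ) : CosPos fun ξ => Real.exp (-σ * ξ) := by
  refine ⟨integrableOn_exp_mul_Ioi (by linarith) 0, fun v => ?_⟩
  set a : ℂ := -σ + v * Complex.I with ha
  have hre : a.re = -σ := by simp [ha]
  have him : a.im = v := by simp [ha]
  have hint := integrableOn_exp_mul_complex_Ioi (a := a) (by rw [hre]; linarith) 0
  have h1 := integral_exp_mul_complex_Ioi (a := a) (by rw [hre]; linarith) 0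
  have h2 : cosT (fun ξ => Real.exp (-σ * ξ)) v =
      (∫ x : ℝ in Ioi 0, Complex.exp (a * x)).re := by
    rw [← Complex.reCLM_apply, ← Complex.reCLM.integral_comp_comm hint]
    refine integral_congr_ae (ae_of_all _ fun ξ => ?_)
    simp only [Complex.reCLM_apply, Complex.exp_re]
    congr 2 <;> simp [ha]
  rw [h2, h1, Complex.ofReal_zero, mul_zero, Complex.exp_zero, Complex.div_re, Complex.neg_re,
    Complex.neg_im, Complex.one_re, Complex.one_im, hre, him]
  have := Complex.normSq_nonneg a
  rw [neg_zero, zero_mul, zero_div, add_zero]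
  exact div_nonneg (by nlinarith) this

theorem CosPos.congr {H H' : ℝ → ℝ} (h : CosPos H) (he : ∀ ξ, 0 < ξ → H ξ = H' ξ) :
    CosPos H' := by
  refine ⟨h.1.congr_fun he measurableSet_Ioi, fun v => (h.2 v).trans_eq ?_⟩
  exact setIntegral_congr_fun measurableSet_Ioi fun ξ hξ => by simp only [he ξ hξ]

theorem CosPos.const_mul {H : ℝ → ℝ} (h : CosPos H) {c : ℝ} (hc : 0 ≤ c) :
    CosPos fun ξ => c * H ξ := by
  refine ⟨Integrable.const_mul h.1 c, fun v => ?_⟩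
  simp only [cosT, mul_assoc]
  rw [integral_const_mul]
  exact mul_nonneg hc (h.2 v)

theorem tendsto_cosT_of_dominated {F : ℕ → ℝ → ℝ} {H G : ℝ → ℝ}
    (hF : ∀ n, IntegrableOn (F n) (Ioi 0)) (hG : IntegrableOn G (Ioi 0))
    (hb : ∀ n, ∀ ξ, 0 < ξ → |F n ξ| ≤ G ξ)
    (hl : ∀ ξ, 0 < ξ → Tendsto (fun n => F n ξ) atTop (𝓝 (H ξ))) (v : ℝ) :
    Tendsto (fun n => cosT (F n) v) atTop (𝓝 (cosT H v)) := by
  refine tendsto_integral_of_dominated_convergence G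
    (fun n => (integrableOn_mul_cos (hF n) v).aestronglyMeasurable) hG (fun n => ?_) ?_
  · filter_upwards [ae_restrict_mem measurableSet_Ioi] with ξ hξ
    rw [norm_mul]
    exact (mul_le_of_le_one_right (norm_nonneg _) (Real.abs_cos_le_one _)).trans (hb n ξ hξ)
  · filter_upwards [ae_restrict_mem measurableSet_Ioi] with ξ hξ
    exact (hl ξ hξ).mul_const _

theorem cosPos_of_dominated {F : ℕ → ℝ → ℝ} {H G : ℝ → ℝ}
    (hF : ∀ n, CosPos (F n)) (hG : IntegrableOn G (Ioi 0))
    (hb : ∀ n, ∀ ξ, 0 < ξ → |F n ξ| ≤ G ξ)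
    (hl : ∀ ξ, 0 < ξ → Tendsto (fun n => F n ξ) atTop (𝓝 (H ξ))) : CosPos H := by
  refine ⟨Integrable.mono' hG (aestronglyMeasurable_of_tendsto_ae atTop
    (fun n => (hF n).1.aestronglyMeasurable) ?_) ?_, fun v => ?_⟩
  · filter_upwards [ae_restrict_mem measurableSet_Ioi] with ξ hξ using hl ξ hξ
  · filter_upwards [ae_restrict_mem measurableSet_Ioi] with ξ hξ
    exact le_of_tendsto (hl ξ hξ).abs (Eventually.of_forall fun n => hb n ξ hξ)
  · exact ge_of_tendsto' (tendsto_cosT_of_dominated (fun n => (hF n).1) hG hb hl v)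
      fun n => (hF n).2 v

theorem integrableOn_mul_cosT {H ρ : ℝ → ℝ} (hH : IntegrableOn H (Ioi 0))
    (hρ : IntegrableOn ρ (Ioi 0)) : IntegrableOn (fun ξ => H ξ * cosT ρ ξ) (Ioi 0) :=
  Integrable.mul_bdd hH (continuous_cosT hρ).aestronglyMeasurable
    (ae_of_all _ fun ξ => abs_cosT_le hρ ξ)

/-- Fubini and the product formula for cosines: multiplication by the transform of ρ becomes
convolution with the even extension of ρ. -/
theorem cosT_mul_cosT {H ρ : ℝ → ℝ} (hH : IntegrableOn H (Ioi 0))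
    (hρ : IntegrableOn ρ (Ioi 0)) (v : ℝ) :
    cosT (fun ξ => H ξ * cosT ρ ξ) v =
      ∫ x in Ioi (0 : ℝ), ρ x * ((cosT H (v + x) + cosT H (v - x)) / 2) := by
  have hprod : Integrable (Function.uncurry fun ξ x : ℝ =>
      H ξ * ρ x * (Real.cos (ξ * x) * Real.cos (v * ξ)))
      ((volume.restrict (Ioi 0)).prod (volume.restrict (Ioi 0))) := by
    have h1 := Integrable.mul_prod hH hρ
    refine Integrable.mul_bdd (c := 1) h1 (Continuous.aestronglyMeasurable (by fun_prop))
      (ae_of_all _ fun z => ?_)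
    rw [norm_mul]
    exact mul_le_one₀ (Real.abs_cos_le_one _) (norm_nonneg _) (Real.abs_cos_le_one _)
  have h2 := integral_integral_swap hprod
  have h3 : cosT (fun ξ => H ξ * cosT ρ ξ) v = ∫ ξ in Ioi (0 : ℝ), ∫ x in Ioi (0 : ℝ),
      H ξ * ρ x * (Real.cos (ξ * x) * Real.cos (v * ξ)) := by
    refine integral_congr_ae (ae_of_all _ fun ξ => ?_)
    simp only [cosT]
    rw [← integral_const_mul, ← integral_mul_const]
    refine integral_congr_ae (ae_of_all _ fun x => ?_)
    simp only
    ring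
  rw [h3, h2]
  refine integral_congr_ae (ae_of_all _ fun x => ?_)
  simp only
  rw [cosT, cosT, ← integral_add (integrableOn_mul_cos hH _) (integrableOn_mul_cos hH _),
    ← integral_div, ← integral_const_mul]
  refine integral_congr_ae (ae_of_all _ fun ξ => ?_)
  simp only
  rw [add_mul, sub_mul, Real.cos_add, Real.cos_sub, mul_comm x ξ]
  ring

theorem CosPos.mul_cosT {H ρ : ℝ → ℝ} (h : CosPos H) (hρ : IntegrableOn ρ (Ioi 0))
    (hρ0 : ∀ x, 0 < x → 0 ≤ ρ x) : CosPos fun ξ => H ξ * cosT ρ ξ := by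
  refine ⟨integrableOn_mul_cosT h.1 hρ, fun v => ?_⟩
  rw [cosT_mul_cosT h.1 hρ]
  refine setIntegral_nonneg measurableSet_Ioi fun x hx => mul_nonneg (hρ0 x hx) ?_
  linarith [h.2 (v + x), h.2 (v - x)]

theorem CosPos.mul_cosT_pow {H ρ : ℝ → ℝ} (h : CosPos H) (hρ : IntegrableOn ρ (Ioi 0))
    (hρ0 : ∀ x, 0 < x → 0 ≤ ρ x) (n : ℕ) : CosPos fun ξ => H ξ * cosT ρ ξ ^ n := by
  induction n with
  | zero => simpa using h
  | succ n ih => simpa only [pow_succ, mul_assoc] using ih.mul_cosT hρ hρ0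

theorem integrableOn_mul_exp_cosT {H ρ : ℝ → ℝ} (hH : IntegrableOn H (Ioi 0))
    (hρ : IntegrableOn ρ (Ioi 0)) : IntegrableOn (fun ξ => H ξ * Real.exp (cosT ρ ξ)) (Ioi 0) :=
  Integrable.mul_bdd (c := Real.exp (∫ ξ in Ioi (0 : ℝ), |ρ ξ|)) hH
    (Real.continuous_exp.comp (continuous_cosT hρ)).aestronglyMeasurable
    (ae_of_all _ fun ξ => by
      rw [Real.norm_of_nonneg (Real.exp_nonneg _), Real.exp_le_exp]
      exact (le_abs_self _).trans (abs_cosT_le hρ ξ))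

/-- In the power series of the exponential every term contributes a nonnegative transform, so the
term n = 1 alone is a lower bound. Probabilistically, exactly one jump of a compound Poisson process
is kept. -/
theorem CosPos.cosT_mul_le_exp {H ρ : ℝ → ℝ} (h : CosPos H) (hρ : IntegrableOn ρ (Ioi 0))
    (hρ0 : ∀ x, 0 < x → 0 ≤ ρ x) (v : ℝ) :
    cosT (fun ξ => H ξ * cosT ρ ξ) v ≤ cosT (fun ξ => H ξ * Real.exp (cosT ρ ξ)) v := by
  have hterm : ∀ n : ℕ, IntegrableOn (fun ξ => H ξ * (cosT ρ ξ ^ n / n.factorial)) (Ioi 0) := by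
    intro n
    have := Integrable.div_const (h.mul_cosT_pow hρ hρ0 n).1 (n.factorial : ℝ)
    simp only [mul_div_assoc] at this
    exact this
  have hlim := tendsto_cosT_of_dominated
    (F := fun N ξ => ∑ n ∈ Finset.range N, H ξ * (cosT ρ ξ ^ n / n.factorial))
    (H := fun ξ => H ξ * Real.exp (cosT ρ ξ))
    (G := fun ξ => |H ξ| * Real.exp (∫ ξ in Ioi (0 : ℝ), |ρ ξ|))
    (fun N => integrable_finsetSum _ fun n _ => hterm n) (Integrable.mul_const h.1.abs _)
    (fun N ξ _ => ?_) (fun ξ _ => ?_) v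
  · refine ge_of_tendsto hlim ?_
    filter_upwards [eventually_ge_atTop 2] with N hN
    have hsum : cosT (fun ξ => ∑ n ∈ Finset.range N, H ξ * (cosT ρ ξ ^ n / n.factorial)) v =
        ∑ n ∈ Finset.range N, cosT (fun ξ => H ξ * (cosT ρ ξ ^ n / n.factorial)) v := by
      simp only [cosT, Finset.sum_mul]
      exact integral_finsetSum _ fun n _ => integrableOn_mul_cos (hterm n) v
    have hnn : ∀ n : ℕ, 0 ≤ cosT (fun ξ => H ξ * (cosT ρ ξ ^ n / n.factorial)) v := by
      intro n
      have := ((h.mul_cosT_pow hρ hρ0 n).const_mul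
        (c := 1 / (n.factorial : ℝ)) (by positivity)).2 v
      refine this.trans_eq ?_
      congr 1
      ext ξ
      ring
    rw [hsum]
    have := Finset.single_le_sum (f := fun n : ℕ =>
      cosT (fun ξ => H ξ * (cosT ρ ξ ^ n / n.factorial)) v) (fun n _ => hnn n)
      (Finset.mem_range.2 hN)
    simpa using this
  · rw [← Finset.mul_sum, abs_mul]
    gcongr
    refine (Finset.abs_sum_le_sum_abs _ _).trans ?_
    have h1 := Real.sum_le_exp_of_nonneg (abs_nonneg (cosT ρ ξ)) N
    have h2 := Real.exp_le_exp.2 (abs_cosT_le hρ ξ)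
    refine le_trans (le_of_eq ?_) (h1.trans h2)
    refine Finset.sum_congr rfl fun n _ => ?_
    rw [abs_div, abs_pow, Nat.abs_cast]
  · simp only [← Finset.mul_sum]
    refine Tendsto.const_mul _ ?_
    have := NormedSpace.expSeries_div_hasSum_exp (cosT ρ ξ)
    rw [← Real.exp_eq_exp_ℝ] at this
    exact this.tendsto_sum_nat

theorem CosPos.mul_exp_cosT {H ρ : ℝ → ℝ} (h : CosPos H) (hρ : IntegrableOn ρ (Ioi 0))
    (hρ0 : ∀ x, 0 < x → 0 ≤ ρ x) : CosPos fun ξ => H ξ * Real.exp (cosT ρ ξ) :=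
  ⟨integrableOn_mul_exp_cosT h.1 hρ,
    fun v => ((h.mul_cosT hρ hρ0).2 v).trans (h.cosT_mul_le_exp hρ hρ0 v)⟩

/-! ### Lower bound for the stable density -/

theorem integrableOn_one_add_rpow {α : ℝ} (hα : 0 < α) :
    IntegrableOn (fun x : ℝ => (1 + x) ^ (-1 - α)) (Ioi 0) := by
  have := integrableOn_add_rpow_Ioi_of_lt (a := -1 - α) (m := 1) (c := 0) (by linarith)
    (by norm_num)
  simpa only [add_comm] using this

/-- Near 0 the factor 1 - cos is quadratic and leaves x^{1-α}, integrable because α < 2; at infinity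
it is bounded by 2. -/
theorem integrableOn_one_sub_cos_mul_rpow {α : ℝ} (hα : 0 < α) (hα₂ : α < 2) (ξ : ℝ) :
    IntegrableOn (fun x : ℝ => (1 - Real.cos (ξ * x)) * x ^ (-1 - α)) (Ioi 0) := by
  have hm : AEStronglyMeasurable (fun x : ℝ => (1 - Real.cos (ξ * x)) * x ^ (-1 - α)) volume := by
    have : Measurable fun x : ℝ => x ^ (-1 - α) := measurable_id.pow_const _
    have h2 : Measurable fun x : ℝ => 1 - Real.cos (ξ * x) :=
      Continuous.measurable (by fun_prop)
    exact (h2.mul this).aestronglyMeasurable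
  rw [← Ioc_union_Ioi_eq_Ioi (zero_le_one' ℝ)]
  refine IntegrableOn.union ?_ ?_
  · have h1 : IntegrableOn (fun x : ℝ => ξ ^ 2 / 2 * x ^ (1 - α)) (Ioc 0 1) := by
      have := intervalIntegral.intervalIntegrable_rpow' (a := 0) (b := 1) (r := 1 - α)
        (by linarith)
      rw [intervalIntegrable_iff_integrableOn_Ioc_of_le zero_le_one] at this
      exact Integrable.const_mul this _
    refine Integrable.mono' h1 hm.restrict ?_
    filter_upwards [ae_restrict_mem measurableSet_Ioc] with x hx
    have hx0 : 0 < x := hx.1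
    have hc := Real.cos_le_one (ξ * x)
    have hc2 := Real.one_sub_sq_div_two_le_cos (x := ξ * x)
    rw [Real.norm_of_nonneg (mul_nonneg (by linarith) (by positivity))]
    have e : x ^ (1 - α) = x ^ 2 * x ^ (-1 - α) := by
      rw [← Real.rpow_natCast, ← Real.rpow_add hx0]
      congr 1
      push_cast
      ring
    rw [e, ← mul_assoc]
    gcongr
    nlinarith
  · have h1 : IntegrableOn (fun x : ℝ => 2 * x ^ (-1 - α)) (Ioi 1) :=
      Integrable.const_mul (integrableOn_Ioi_rpow_of_lt (by linarith) one_pos) 2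
    refine Integrable.mono' h1 hm.restrict ?_
    filter_upwards [ae_restrict_mem measurableSet_Ioi] with x hx
    have hx0 : 0 < x := lt_trans one_pos hx
    have hc := Real.cos_le_one (ξ * x)
    have hc2 := Real.neg_one_le_cos (ξ * x)
    rw [Real.norm_of_nonneg (mul_nonneg (by linarith) (by positivity))]
    gcongr
    linarith

/-- The Lévy–Khintchine representation of `ξ^α / α`. -/
theorem exists_levy_khintchine {α : ℝ} (hα : 0 < α) (hα₂ : α < 2) :
    ∃ κ : ℝ, 0 < κ ∧ ∀ ξ, 0 < ξ →
      ∫ x in Ioi (0 : ℝ), (1 - Real.cos (ξ * x)) * (κ * x ^ (-1 - α)) = ξ ^ α / α := by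
  set J := ∫ x in Ioi (0 : ℝ), (1 - Real.cos (1 * x)) * x ^ (-1 - α) with hJ
  have hJ0 : 0 < J := by
    have hnn : ∀ x ∈ Ioi (0 : ℝ), 0 ≤ (1 - Real.cos (1 * x)) * x ^ (-1 - α) := fun x hx =>
      mul_nonneg (by linarith [Real.cos_le_one (1 * x)]) (Real.rpow_nonneg (le_of_lt hx) _)
    rw [hJ, setIntegral_pos_iff_support_of_nonneg_ae
      ((ae_restrict_mem measurableSet_Ioi).mono hnn) (integrableOn_one_sub_cos_mul_rpow hα hα₂ 1)]
    refine lt_of_lt_of_le (b := volume (Ioo (0 : ℝ) 1)) ?_ (measure_mono fun x hx => ⟨?_, hx.1⟩)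
    · simp
    · have h1 : Real.cos (1 * x) < 1 := by
        rw [one_mul, ← Real.cos_zero]
        exact Real.cos_lt_cos_of_nonneg_of_le_pi le_rfl
          (by linarith [hx.2, Real.pi_gt_three]) hx.1
      exact (mul_pos (sub_pos.2 h1) (Real.rpow_pos_of_pos hx.1 _)).ne'
  clear_value J
  -- The substitution x ↦ ξx extracts ξ^α times J from the integral, so κ is chosen to turn J into
  -- 1/α.
  refine ⟨1 / (α * J), by positivity, fun ξ hξ => ?_⟩
  have h1 := integral_comp_mul_left_Ioi
    (fun x : ℝ => (1 - Real.cos (1 * x)) * x ^ (-1 - α)) 0 hξ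
  rw [mul_zero, ← hJ, smul_eq_mul] at h1
  have h2 : ∫ x in Ioi (0 : ℝ), (1 - Real.cos (ξ * x)) * (1 / (α * J) * x ^ (-1 - α)) =
      1 / (α * J) * ξ ^ (1 + α) *
        ∫ x in Ioi (0 : ℝ), (1 - Real.cos (1 * (ξ * x))) * (ξ * x) ^ (-1 - α) := by
    rw [← integral_const_mul]
    refine setIntegral_congr_fun measurableSet_Ioi fun x hx => ?_
    have hxi : ξ ^ (1 + α) * ξ ^ (-1 - α) = 1 := by
      rw [← Real.rpow_add hξ, show 1 + α + (-1 - α) = 0 by ring, Real.rpow_zero]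
    rw [one_mul, Real.mul_rpow hξ.le (le_of_lt hx)]
    linear_combination (-(1 / (α * J) * (1 - Real.cos (ξ * x)) * x ^ (-1 - α))) * hxi
  rw [h2, h1, Real.rpow_add hξ, Real.rpow_one]
  field_simp

theorem dens_zero_eq_cosT {α : ℝ} (hα : 0 < α) (v : ℝ) :
    dens α 0 v = 1 / Real.pi * cosT (fun ξ => Real.exp (-(ξ ^ α / α))) v := by
  rw [dens, ← Complex.reCLM_apply,
    ← Complex.reCLM.integral_comp_comm (integrable_dens_integrand hα 0 v)]
  congr 1
  refine integral_congr_ae (ae_of_all _ fun ξ => ?_)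
  simp only [Complex.reCLM_apply, pow_zero, one_mul, Complex.exp_re]
  congr 2 <;> simp

theorem integrableOn_exp_neg_rpow_div {α : ℝ} (hα : 0 < α) :
    IntegrableOn (fun ξ : ℝ => Real.exp (-(ξ ^ α / α))) (Ioi 0) := by
  have := integrableOn_pow_mul_exp_neg_mul_rpow hα (one_div_pos.2 hα) 0
  refine IntegrableOn.congr_fun this (fun ξ _ => ?_) measurableSet_Ioi
  simp only [pow_zero, one_mul]
  congr 1
  ring

theorem integral_one_sub_cos_mul {ρ : ℝ → ℝ} (hρ : IntegrableOn ρ (Ioi 0)) (ξ : ℝ) :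
    ∫ x in Ioi (0 : ℝ), (1 - Real.cos (ξ * x)) * ρ x =
      (∫ x in Ioi (0 : ℝ), ρ x) - cosT ρ ξ := by
  rw [cosT, ← integral_sub hρ (integrableOn_mul_cos hρ ξ)]
  refine integral_congr_ae (ae_of_all _ fun x => ?_)
  simp only
  ring

/-- The function `exp (-∫ (1 - cos (ξ x)) ρ(x) dx)` has nonnegative cosine transform if it is
integrable, even when `ρ` is singular at the origin. -/
theorem cosPos_exp_neg_integral {ρ : ℝ → ℝ} (hρ0 : ∀ x, 0 < x → 0 ≤ ρ x)
    (hρ : ∀ ε, 0 < ε → IntegrableOn ρ (Ioi ε))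
    (hint : ∀ ξ, 0 < ξ → IntegrableOn (fun x => (1 - Real.cos (ξ * x)) * ρ x) (Ioi 0))
    {H : ℝ → ℝ} (hH : IntegrableOn H (Ioi 0))
    (hHeq : ∀ ξ, 0 < ξ → H ξ = Real.exp (-∫ x in Ioi (0 : ℝ), (1 - Real.cos (ξ * x)) * ρ x)) :
    CosPos H := by
  set δ : ℕ → ℝ := fun n => 1 / ((n : ℝ) + 1) with hδ
  have hδ0 : ∀ n, 0 < δ n := fun n => by positivity
  have hδlim : Tendsto δ atTop (𝓝 0) := tendsto_one_div_add_atTop_nhds_zero_nat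
  set r : ℕ → ℝ → ℝ := fun n => (Ioi (δ n)).indicator ρ with hr
  have hri : ∀ n, IntegrableOn (r n) (Ioi 0) := fun n =>
    ((integrable_indicator_iff measurableSet_Ioi).2 (hρ _ (hδ0 n))).integrableOn
  have hr0 : ∀ n x, 0 < x → 0 ≤ r n x := fun n x hx =>
    indicator_nonneg (fun x hx => hρ0 x ((hδ0 n).trans hx)) x
  have hrle : ∀ n x, 0 < x → r n x ≤ ρ x := by
    intro n x hx
    by_cases h : x ∈ Ioi (δ n)
    · simp [hr, h]
    · simp [hr, h, hρ0 x hx]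
  -- With ρ truncated near 0 the exponent is a constant plus a cosine transform, so
  -- `CosPos.mul_exp_cosT` applies, but the exponential need not be integrable any more. The factor
  -- exp(-σξ) restores integrability while the truncation is removed; afterwards σ tends to 0.
  have hreg : ∀ σ, 0 < σ → CosPos fun ξ => Real.exp (-σ * ξ) * H ξ := by
    intro σ hσ
    refine cosPos_of_dominated
      (F := fun n ξ => Real.exp (-σ * ξ) *
        Real.exp (-∫ x in Ioi (0 : ℝ), (1 - Real.cos (ξ * x)) * r n x))
      (G := fun ξ => Real.exp (-σ * ξ)) (fun n => ?_) (cosPos_exp hσ).1 (fun n ξ hξ => ?_)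
      (fun ξ hξ => ?_)
    · refine (((cosPos_exp hσ).mul_exp_cosT (hri n) (hr0 n)).const_mul
        (c := Real.exp (-∫ x in Ioi (0 : ℝ), r n x)) (Real.exp_nonneg _)).congr fun ξ _ => ?_
      rw [integral_one_sub_cos_mul (hri n), neg_sub, sub_eq_add_neg, Real.exp_add]
      ring
    · rw [abs_of_nonneg (by positivity)]
      refine mul_le_of_le_one_right (Real.exp_nonneg _) ?_
      rw [Real.exp_le_one_iff, neg_nonpos]
      exact setIntegral_nonneg measurableSet_Ioi fun x hx =>
        mul_nonneg (by linarith [Real.cos_le_one (ξ * x)]) (hr0 n x hx)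
    · refine Tendsto.const_mul _ ?_
      rw [hHeq ξ hξ]
      refine (Real.continuous_exp.tendsto _).comp (Tendsto.neg ?_)
      refine tendsto_integral_of_dominated_convergence _ (fun n => ?_) (hint ξ hξ) (fun n => ?_) ?_
      · exact (Continuous.aestronglyMeasurable (by fun_prop)).mul (hri n).aestronglyMeasurable
      · filter_upwards [ae_restrict_mem measurableSet_Ioi] with x hx
        have h1 : 0 ≤ 1 - Real.cos (ξ * x) := by linarith [Real.cos_le_one (ξ * x)]
        rw [Real.norm_of_nonneg (mul_nonneg h1 (hr0 n x hx))]
        exact mul_le_mul_of_nonneg_left (hrle n x hx) h1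
      · filter_upwards [ae_restrict_mem measurableSet_Ioi] with x hx
        refine Tendsto.const_mul _ (tendsto_const_nhds.congr' ?_)
        filter_upwards [hδlim.eventually_lt_const (show (0 : ℝ) < x from hx)] with n hn
        simp [hr, hn]
  refine cosPos_of_dominated (F := fun n ξ => Real.exp (-δ n * ξ) * H ξ) (G := fun ξ => |H ξ|)
    (fun n => hreg _ (hδ0 n)) hH.abs (fun n ξ hξ => ?_) (fun ξ hξ => ?_)
  · rw [abs_mul, abs_of_nonneg (Real.exp_nonneg _)]
    refine mul_le_of_le_one_left (abs_nonneg _) ?_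
    rw [Real.exp_le_one_iff]
    nlinarith [hδ0 n]
  · have h1 : Tendsto (fun n => Real.exp (-δ n * ξ)) atTop (𝓝 (Real.exp (-0 * ξ))) :=
      (Real.continuous_exp.tendsto _).comp ((hδlim.neg).mul_const ξ)
    simpa using h1.mul_const (H ξ)

theorem exists_le_dens_zero {α : ℝ} (hα : 0 < α) (hα₂ : α < 2) :
    ∃ c : ℝ, 0 < c ∧ ∀ v, 0 ≤ v → c * (2 + v) ^ (-1 - α) ≤ dens α 0 v := by
  obtain ⟨κ, hκ, hLK⟩ := exists_levy_khintchine hα hα₂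
  -- ρ₂ is an integrable part of the Lévy density with the same tail; the rest ρ₁ stays nonnegative.
  -- Then exp(-ξ^α/α) equals e^{-lam} H(ξ) exp(`cosT` ρ₂ ξ), where H comes from ρ₁ and has
  -- nonnegative transform.
  set ρ₂ : ℝ → ℝ := fun x => κ * (1 + x) ^ (-1 - α) with hρ₂
  have hρ₂i : IntegrableOn ρ₂ (Ioi 0) := Integrable.const_mul (integrableOn_one_add_rpow hα) κ
  have hρ₂0 : ∀ x, 0 < x → 0 ≤ ρ₂ x := fun x hx => by positivity
  set ρ₁ : ℝ → ℝ := fun x => κ * x ^ (-1 - α) - ρ₂ x with hρ₁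
  have hρ₁0 : ∀ x, 0 < x → 0 ≤ ρ₁ x := by
    intro x hx
    have : (1 + x) ^ (-1 - α) ≤ x ^ (-1 - α) :=
      Real.rpow_le_rpow_of_nonpos hx (by linarith) (by linarith)
    simp only [hρ₁, hρ₂, ← mul_sub]
    exact mul_nonneg hκ.le (by linarith)
  set lam := ∫ x in Ioi (0 : ℝ), ρ₂ x with hlam
  set H : ℝ → ℝ := fun ξ => Real.exp (-(ξ ^ α / α)) * Real.exp (lam - cosT ρ₂ ξ) with hHdef
  have hHi : IntegrableOn H (Ioi 0) := by
    refine Integrable.mul_bdd (c := Real.exp (lam + ∫ x in Ioi (0 : ℝ), |ρ₂ x|))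
      (integrableOn_exp_neg_rpow_div hα) ?_ (ae_of_all _ fun ξ => ?_)
    · have := continuous_cosT hρ₂i
      exact Continuous.aestronglyMeasurable (by fun_prop)
    · rw [Real.norm_of_nonneg (Real.exp_nonneg _), Real.exp_le_exp]
      linarith [neg_abs_le (cosT ρ₂ ξ), abs_cosT_le hρ₂i ξ]
  have hint0 : ∀ ξ, IntegrableOn (fun x => (1 - Real.cos (ξ * x)) * (κ * x ^ (-1 - α)))
      (Ioi 0) := by
    intro ξ
    refine Integrable.congr (Integrable.const_mul (integrableOn_one_sub_cos_mul_rpow hα hα₂ ξ) κ)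
      (ae_of_all _ fun x => ?_)
    simp only
    ring
  have hint2 : ∀ ξ, IntegrableOn (fun x => (1 - Real.cos (ξ * x)) * ρ₂ x) (Ioi 0) := by
    intro ξ
    refine Integrable.congr (Integrable.sub hρ₂i (integrableOn_mul_cos hρ₂i ξ))
      (ae_of_all _ fun x => ?_)
    simp only [Pi.sub_apply]
    ring
  have hpos : CosPos H := by
    refine cosPos_exp_neg_integral hρ₁0 (fun ε hε => ?_) (fun ξ _ => ?_) hHi (fun ξ hξ => ?_)
    · exact Integrable.sub (Integrable.const_mul (integrableOn_Ioi_rpow_of_lt (by linarith) hε) κ)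
        (hρ₂i.mono_set (Ioi_subset_Ioi hε.le))
    · refine Integrable.congr (Integrable.sub (hint0 ξ) (hint2 ξ)) (ae_of_all _ fun x => ?_)
      simp only [Pi.sub_apply, hρ₁]
      ring
    · have e : ∫ x in Ioi (0 : ℝ), (1 - Real.cos (ξ * x)) * ρ₁ x =
          ξ ^ α / α - (lam - cosT ρ₂ ξ) := by
        rw [← hLK ξ hξ, ← integral_one_sub_cos_mul hρ₂i, ← integral_sub (hint0 ξ) (hint2 ξ)]
        refine integral_congr_ae (ae_of_all _ fun x => ?_)
        simp only [hρ₁]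
        ring
      rw [e, neg_sub, sub_eq_neg_add, Real.exp_add]
  have hcont := continuous_cosT hHi
  have hp0 : 0 < cosT H 0 := by
    have h1 : cosT H 0 = ∫ ξ in Ioi (0 : ℝ), H ξ := by simp [cosT]
    rw [h1, setIntegral_pos_iff_support_of_nonneg_ae
      (ae_of_all _ fun ξ => by simp only [hHdef, Pi.zero_apply]; positivity) hHi]
    have : Function.support H = univ := by
      ext ξ
      simp [hHdef, Real.exp_ne_zero]
    rw [this, univ_inter]
    simp
  obtain ⟨δ, hδ0, hδ1, hδ⟩ : ∃ δ : ℝ, 0 < δ ∧ δ ≤ 1 ∧ ∀ y, |y| ≤ δ → cosT H 0 / 2 ≤ cosT H y := by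
    obtain ⟨δ, hδ0, hδ⟩ := Metric.eventually_nhds_iff.1
      (hcont.continuousAt.eventually_const_le (show cosT H 0 / 2 < cosT H 0 by linarith))
    refine ⟨min (δ / 2) 1, by positivity, min_le_right _ _, fun y hy => hδ ?_⟩
    rw [Real.dist_eq, sub_zero]
    linarith [min_le_left (δ / 2) 1]
  refine ⟨1 / Real.pi * Real.exp (-lam) * (δ * (κ * (cosT H 0 / 4))), by positivity,
    fun v hv => ?_⟩
  have h1 : cosT (fun ξ => Real.exp (-(ξ ^ α / α))) v =
      Real.exp (-lam) * cosT (fun ξ => H ξ * Real.exp (cosT ρ₂ ξ)) v := by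
    rw [cosT, cosT, ← integral_const_mul]
    refine integral_congr_ae (ae_of_all _ fun ξ => ?_)
    simp only [hHdef]
    have : Real.exp (-lam) * (Real.exp (lam - cosT ρ₂ ξ) * Real.exp (cosT ρ₂ ξ)) = 1 := by
      rw [← Real.exp_add, ← Real.exp_add, ← Real.exp_zero]
      congr 1
      ring
    linear_combination (-(Real.exp (-(ξ ^ α / α)) * Real.cos (v * ξ))) * this
  have h2 := hpos.cosT_mul_le_exp hρ₂i hρ₂0 v
  rw [cosT_mul_cosT hHi hρ₂i] at h2
  have hbd : IntegrableOn (fun x => ρ₂ x * ((cosT H (v + x) + cosT H (v - x)) / 2)) (Ioi 0) := by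
    refine Integrable.mul_bdd (c := ∫ ξ in Ioi (0 : ℝ), |H ξ|) hρ₂i
      (Continuous.aestronglyMeasurable (by fun_prop)) (ae_of_all _ fun x => ?_)
    rw [Real.norm_eq_abs, abs_le]
    have a1 := abs_le.1 (abs_cosT_le hHi (v + x))
    have a2 := abs_le.1 (abs_cosT_le hHi (v - x))
    constructor <;> linarith [a1.1, a1.2, a2.1, a2.2]
  -- Of the convolution of ρ₂ with the transform of H only x in (v, v+δ] is kept. There v - x is so
  -- close to 0 that the average of the two values is at least a quarter of the value at 0, and 1 +
  -- x ≤ 2 + v.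
  have h3 : ∫ x in Ioc v (v + δ), κ * (2 + v) ^ (-1 - α) * (cosT H 0 / 4) ≤
      ∫ x in Ioi (0 : ℝ), ρ₂ x * ((cosT H (v + x) + cosT H (v - x)) / 2) := by
    have hsub : Ioc v (v + δ) ⊆ Ioi (0 : ℝ) := fun x hx => lt_of_le_of_lt hv hx.1
    refine le_trans (setIntegral_mono_on (integrableOn_const (by simp)) (hbd.mono_set hsub) measurableSet_Ioc
      fun x hx => ?_) (setIntegral_mono_set hbd ?_ hsub.eventuallyLE)
    · have hx0 : 0 < x := hsub hx
      have b1 := hpos.2 (v + x)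
      have b2 := hδ (v - x) (by rw [abs_le]; constructor <;> linarith [hx.1, hx.2])
      have b3 : (2 + v) ^ (-1 - α) ≤ (1 + x) ^ (-1 - α) :=
        Real.rpow_le_rpow_of_nonpos (by linarith) (by linarith [hx.2]) (by linarith)
      simp only [hρ₂]
      refine mul_le_mul (mul_le_mul_of_nonneg_left b3 hκ.le) (by linarith) (by linarith)
        (by positivity)
    · filter_upwards [ae_restrict_mem measurableSet_Ioi] with x hx
      exact mul_nonneg (hρ₂0 x hx) (by linarith [hpos.2 (v + x), hpos.2 (v - x)])
  have h4 : ∫ x in Ioc v (v + δ), κ * (2 + v) ^ (-1 - α) * (cosT H 0 / 4) =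
      δ * (κ * (2 + v) ^ (-1 - α) * (cosT H 0 / 4)) := by
    rw [setIntegral_const, smul_eq_mul]
    congr 1
    simp [Measure.real, hδ0.le]
  rw [h4] at h3
  rw [dens_zero_eq_cosT hα, h1]
  calc _ = 1 / Real.pi * (Real.exp (-lam) *
        (δ * (κ * (2 + v) ^ (-1 - α) * (cosT H 0 / 4)))) := by ring
    _ ≤ _ := by
      gcongr
      exact h3.trans h2

theorem exists_weight_le_dens_zero {α : ℝ} (hα : 0 < α) (hα₂ : α < 2) :
    ∃ c : ℝ, 0 < c ∧ ∀ v, c * (1 + |v|) ^ (-(1 + α)) ≤ dens α 0 v := by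
  obtain ⟨c, hc, h⟩ := exists_le_dens_zero hα hα₂
  refine ⟨c * 2 ^ (-(1 + α)), by positivity, fun v => ?_⟩
  have h0 := abs_nonneg v
  have hv : dens α 0 v = dens α 0 (|v|) := by
    rcases abs_cases v with ⟨h, _⟩ | ⟨h, _⟩
    · rw [h]
    · rw [h, dens_neg, pow_zero, one_mul]
  rw [hv]
  refine le_trans ?_ (h _ h0)
  rw [mul_assoc, ← Real.mul_rpow (by norm_num) (by positivity),
    show -1 - α = -(1 + α) by ring]
  refine mul_le_mul_of_nonneg_left ?_ hc.le
  exact Real.rpow_le_rpow_of_nonpos (by positivity) (by linarith) (by linarith)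

/-! ### The Huang–Oberman weights -/

/-- The derivative of `phi α` on the positive half-line. -/
def phiDeriv (α t : ℝ) : ℝ :=
  if α = 1 then -Real.log t else t ^ (1 - α) / ((α - 1) * α)

theorem hasDerivAt_phi {α : ℝ} (hα : 0 < α) (hα₂ : α < 2) {t : ℝ} (ht : 0 < t) :
    HasDerivAt (phi α) (phiDeriv α t) t := by
  by_cases h : α = 1
  · have h1 : phi α = fun t => t - t * Real.log t := by
      ext t
      simp [phi, h]
    rw [h1, phiDeriv, if_pos h]
    refine ((hasDerivAt_id t).sub ((hasDerivAt_id t).mul (Real.hasDerivAt_log ht.ne'))).congr_deriv ?_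
    simp [ht.ne']
  · have h1 : phi α = fun t => t ^ (2 - α) / ((2 - α) * (α - 1) * α) := by
      ext t
      simp [phi, h]
    rw [h1, phiDeriv, if_neg h]
    refine ((Real.hasDerivAt_rpow_const (p := 2 - α) (Or.inl ht.ne')).div_const _).congr_deriv ?_
    have h2 : α - 1 ≠ 0 := sub_ne_zero.2 h
    have h3 : 2 - α ≠ 0 := by linarith
    rw [show 2 - α - 1 = 1 - α by ring]
    field_simp

theorem hasDerivAt_phiDeriv {α : ℝ} (hα : 0 < α) {t : ℝ} (ht : 0 < t) :
    HasDerivAt (phiDeriv α) (-(t ^ (-α) / α)) t := by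
  by_cases h : α = 1
  · have h1 : phiDeriv α = fun t => -Real.log t := by
      ext t
      simp [phiDeriv, h]
    rw [h1, h, Real.rpow_neg_one, div_one]
    exact (Real.hasDerivAt_log ht.ne').neg
  · have h1 : phiDeriv α = fun t => t ^ (1 - α) / ((α - 1) * α) := by
      ext t
      simp [phiDeriv, h]
    rw [h1]
    refine ((Real.hasDerivAt_rpow_const (p := 1 - α) (Or.inl ht.ne')).div_const _).congr_deriv ?_
    have h2 : α - 1 ≠ 0 := sub_ne_zero.2 h
    rw [show 1 - α - 1 = -α by ring]
    field_simp
    ring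

theorem hasDerivAt_neg_rpow_div {α : ℝ} (hα : 0 < α) {t : ℝ} (ht : 0 < t) :
    HasDerivAt (fun t : ℝ => -(t ^ (-α) / α)) (t ^ (-(1 + α))) t := by
  refine ((Real.hasDerivAt_rpow_const (p := -α) (Or.inl ht.ne')).div_const _).neg.congr_deriv ?_
  rw [show -α - 1 = -(1 + α) by ring]
  field_simp

/-! ### Symmetric differences and the trapezoid rule. -/

theorem abs_le_of_deriv_le {g g' : ℝ → ℝ} {r K : ℝ} (hr : 0 ≤ r) (h0 : g 0 = 0)
    (hd : ∀ s ∈ Icc 0 r, HasDerivAt g (g' s) s) (hb : ∀ s ∈ Icc 0 r, |g' s| ≤ K) :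
    |g r| ≤ K * r := by
  have := norm_image_sub_le_of_norm_deriv_le_segment' (f := g) (f' := g') (C := K)
    (fun s hs => (hd s hs).hasDerivWithinAt) (fun s hs => hb s (Ico_subset_Icc_self hs)) r
    ⟨hr, le_rfl⟩
  simpa [h0] using this

section Symmetric

variable {f f₁ f₂ f₃ : ℝ → ℝ} {x r B : ℝ}

theorem HasDerivAt.comp_const_add' {g : ℝ → ℝ} {g' x s : ℝ} (h : HasDerivAt g g' (x + s)) :
    HasDerivAt (fun s => g (x + s)) g' s := by
  simpa using h.comp_const_add x s

theorem HasDerivAt.comp_const_sub' {g : ℝ → ℝ} {g' x s : ℝ} (h : HasDerivAt g g' (x - s)) :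
    HasDerivAt (fun s => g (x - s)) (-g') s := by
  simpa using h.comp_const_sub x s

theorem abs_sub_symm_le (hr : 0 ≤ r) (h₂ : ∀ y ∈ Icc (x - r) (x + r), HasDerivAt f₂ (f₃ y) y)
    (hB : ∀ y ∈ Icc (x - r) (x + r), |f₃ y| ≤ B) : |f₂ (x + r) - f₂ (x - r)| ≤ 2 * B * r := by
  refine abs_le_of_deriv_le (g := fun s => f₂ (x + s) - f₂ (x - s))
    (g' := fun s => f₃ (x + s) - -f₃ (x - s)) hr (by simp) (fun s hs => ?_) (fun s hs => ?_)
  · exact (HasDerivAt.comp_const_add' (h₂ _ ⟨by linarith [hs.1], by linarith [hs.2]⟩)).sub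
      (HasDerivAt.comp_const_sub' (h₂ _ ⟨by linarith [hs.2], by linarith [hs.1]⟩))
  · rw [sub_neg_eq_add]
    refine (abs_add_le _ _).trans ?_
    linarith [hB (x + s) ⟨by linarith [hs.1], by linarith [hs.2]⟩,
      hB (x - s) ⟨by linarith [hs.2], by linarith [hs.1]⟩]

theorem abs_second_difference_le (hr : 0 ≤ r)
    (h₁ : ∀ y ∈ Icc (x - r) (x + r), HasDerivAt f₁ (f₂ y) y)
    (h₂ : ∀ y ∈ Icc (x - r) (x + r), HasDerivAt f₂ (f₃ y) y)
    (hB : ∀ y ∈ Icc (x - r) (x + r), |f₃ y| ≤ B) :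
    |f₁ (x + r) + f₁ (x - r) - 2 * f₁ x| ≤ 2 * B * r ^ 2 := by
  have hB0 : 0 ≤ B := (abs_nonneg _).trans (hB x ⟨by linarith, by linarith⟩)
  have key := abs_le_of_deriv_le (g := fun s => f₁ (x + s) + f₁ (x - s) - 2 * f₁ x)
    (g' := fun s => f₂ (x + s) + -f₂ (x - s)) (K := 2 * B * r) hr (by simp; ring)
    (fun s hs => ?_) (fun s hs => ?_)
  · exact key.trans_eq (by ring)
  · exact ((HasDerivAt.comp_const_add' (h₁ _ ⟨by linarith [hs.1], by linarith [hs.2]⟩)).add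
      (HasDerivAt.comp_const_sub' (h₁ _ ⟨by linarith [hs.2], by linarith [hs.1]⟩))).sub_const _
  · rw [← sub_eq_add_neg]
    refine (abs_sub_symm_le (f₂ := f₂) (f₃ := f₃) (B := B) hs.1
      (fun y hy => h₂ y ⟨by linarith [hy.1, hs.2], by linarith [hy.2, hs.2]⟩)
      (fun y hy => hB y ⟨by linarith [hy.1, hs.2], by linarith [hy.2, hs.2]⟩)).trans ?_
    gcongr
    exact hs.2

/-- Differentiated in the half-width s, the error of the trapezoid rule loses its f₁ terms, and
s(f₂(x+s) - f₂(x-s)) remains, which is O(s²). -/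
theorem abs_trapezoid_le (hr : 0 ≤ r)
    (h₀ : ∀ y ∈ Icc (x - r) (x + r), HasDerivAt f (f₁ y) y)
    (h₁ : ∀ y ∈ Icc (x - r) (x + r), HasDerivAt f₁ (f₂ y) y)
    (h₂ : ∀ y ∈ Icc (x - r) (x + r), HasDerivAt f₂ (f₃ y) y)
    (hB : ∀ y ∈ Icc (x - r) (x + r), |f₃ y| ≤ B) :
    |r * (f₁ (x + r) + f₁ (x - r)) - (f (x + r) - f (x - r))| ≤ 2 * B * r ^ 3 := by
  have hB0 : 0 ≤ B := (abs_nonneg _).trans (hB x ⟨by linarith, by linarith⟩)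
  have key := abs_le_of_deriv_le
    (g := fun s => s * (f₁ (x + s) + f₁ (x - s)) - (f (x + s) - f (x - s)))
    (g' := fun s => s * (f₂ (x + s) - f₂ (x - s))) (K := 2 * B * r ^ 2) hr (by simp)
    (fun s hs => ?_) (fun s hs => ?_)
  · exact key.trans_eq (by ring)
  · have hp : x + s ∈ Icc (x - r) (x + r) := ⟨by linarith [hs.1], by linarith [hs.2]⟩
    have hm : x - s ∈ Icc (x - r) (x + r) := ⟨by linarith [hs.2], by linarith [hs.1]⟩
    have d1 := (hasDerivAt_id s).mul ((HasDerivAt.comp_const_add' (h₁ _ hp)).add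
      (HasDerivAt.comp_const_sub' (h₁ _ hm)))
    have d2 := (HasDerivAt.comp_const_add' (h₀ _ hp)).sub (HasDerivAt.comp_const_sub' (h₀ _ hm))
    refine (d1.sub d2).congr_deriv ?_
    simp only [Pi.add_apply, id]
    ring
  · rw [abs_mul, abs_of_nonneg hs.1]
    have := abs_sub_symm_le (f₂ := f₂) (f₃ := f₃) (B := B) hs.1
      (fun y hy => h₂ y ⟨by linarith [hy.1, hs.2], by linarith [hy.2, hs.2]⟩)
      (fun y hy => hB y ⟨by linarith [hy.1, hs.2], by linarith [hy.2, hs.2]⟩)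
    calc s * |f₂ (x + s) - f₂ (x - s)| ≤ r * (2 * B * r) := by
          refine mul_le_mul hs.2 (this.trans ?_) (abs_nonneg _) hr
          gcongr
          exact hs.2
      _ = 2 * B * r ^ 2 := by ring

end Symmetric

/-- The third derivative of φ is t^{-(1+α)}, which decreases, so its supremum on the interval is its
value at the left end. -/
theorem abs_phi_trapezoid_le {α : ℝ} (hα : 0 < α) (hα₂ : α < 2) {x r : ℝ} (hr : 0 ≤ r)
    (hxr : r < x) :
    |r * (phiDeriv α (x + r) + phiDeriv α (x - r)) - (phi α (x + r) - phi α (x - r))| ≤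
      2 * (x - r) ^ (-(1 + α)) * r ^ 3 ∧
    |phiDeriv α (x + r) + phiDeriv α (x - r) - 2 * phiDeriv α x| ≤
      2 * (x - r) ^ (-(1 + α)) * r ^ 2 := by
  have hpos : ∀ y ∈ Icc (x - r) (x + r), 0 < y := fun y hy => by linarith [hy.1]
  have hB : ∀ y ∈ Icc (x - r) (x + r), |y ^ (-(1 + α))| ≤ (x - r) ^ (-(1 + α)) := by
    intro y hy
    have := hpos y hy
    rw [abs_of_nonneg (by positivity)]
    exact Real.rpow_le_rpow_of_nonpos (by linarith) hy.1 (by linarith)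
  exact ⟨abs_trapezoid_le hr (fun y hy => hasDerivAt_phi hα hα₂ (hpos y hy))
      (fun y hy => hasDerivAt_phiDeriv hα (hpos y hy))
      (fun y hy => hasDerivAt_neg_rpow_div hα (hpos y hy)) hB,
    abs_second_difference_le hr (fun y hy => hasDerivAt_phiDeriv hα (hpos y hy))
      (fun y hy => hasDerivAt_neg_rpow_div hα (hpos y hy)) hB⟩

/-! ### Size of the weights. -/

theorem fracLapConst_nonneg {α : ℝ} (hα : 0 < α) : 0 ≤ fracLapConst α := by
  have := Real.Gamma_pos_of_pos (show 0 < (1 + α) / 2 by linarith)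
  unfold fracLapConst
  positivity

/-- For even k, b_k is twice a trapezoid error on [k-1, k+1]; for odd k ≥ 3 it combines a trapezoid
error and a second difference of φ' on [k-2, k+2]. For k = 1 it is a fixed number, whose value plays
no role. -/
theorem abs_beta_le {α : ℝ} (hα : 0 < α) (hα₂ : α < 2) :
    ∃ C : ℝ, 0 < C ∧ ∀ h : ℝ, 0 < h → ∀ n : ℕ,
      |beta α h ((n : ℤ) + 1)| ≤ C * (((n : ℝ) + 1) * h) ^ (-(1 + α)) := by
  have hd : ∀ t, 0 < t → deriv (phi α) t = phiDeriv α t := fun t ht =>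
    (hasDerivAt_phi hα hα₂ ht).deriv
  set b₁ := 1 / (2 - α) - deriv (deriv (phi α)) 1 - (deriv (phi α) 3 + 3 * deriv (phi α) 1) / 2 +
    phi α 3 - phi α 1 with hb₁
  have hF := fracLapConst_nonneg hα
  -- The 28 is the odd case, 16 from the trapezoid error with r = 2 and 12 from the second
  -- difference. The power of 3 moves the estimate from k - r to k, since k ≤ 3(k - r), with
  -- equality at k = 3, r = 2.
  refine ⟨(fracLapConst α + 1) * (|b₁| + 28 * 3 ^ (1 + α)), by positivity, fun h hh n => ?_⟩
  have hx : (0 : ℝ) < (n : ℝ) + 1 := by positivity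
  have habs : |(((n : ℤ) + 1 : ℤ) : ℝ)| = (n : ℝ) + 1 := by
    push_cast
    exact abs_of_pos hx
  rw [Real.mul_rpow hx.le hh.le, Real.rpow_neg hh.le]
  have main : ∀ b : ℝ, |b| ≤ (|b₁| + 28 * 3 ^ (1 + α)) * ((n : ℝ) + 1) ^ (-(1 + α)) →
      |fracLapConst α / h ^ (1 + α) * b| ≤ (fracLapConst α + 1) * (|b₁| + 28 * 3 ^ (1 + α)) *
        (((n : ℝ) + 1) ^ (-(1 + α)) * (h ^ (1 + α))⁻¹) := by
    intro b hb
    rw [abs_mul, abs_of_nonneg (by positivity)]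
    calc fracLapConst α / h ^ (1 + α) * |b| ≤ (fracLapConst α + 1) / h ^ (1 + α) *
          ((|b₁| + 28 * 3 ^ (1 + α)) * ((n : ℝ) + 1) ^ (-(1 + α))) := by gcongr; linarith
      _ = _ := by rw [div_eq_mul_inv]; ring
  have hthird : ∀ r : ℝ, r < (n : ℝ) + 1 → (n : ℝ) + 1 ≤ 3 * ((n : ℝ) + 1 - r) →
      ((n : ℝ) + 1 - r) ^ (-(1 + α)) ≤ 3 ^ (1 + α) * ((n : ℝ) + 1) ^ (-(1 + α)) := by
    intro r hr h3
    have := Real.rpow_le_rpow_of_nonpos (z := -(1 + α)) hx h3 (by linarith)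
    rw [Real.mul_rpow (by norm_num) (by linarith), Real.rpow_neg (by norm_num)] at this
    have h4 : (0 : ℝ) < 3 ^ (1 + α) := by positivity
    calc ((n : ℝ) + 1 - r) ^ (-(1 + α)) =
        3 ^ (1 + α) * ((3 ^ (1 + α))⁻¹ * ((n : ℝ) + 1 - r) ^ (-(1 + α))) := by field_simp
      _ ≤ _ := by gcongr
  have hP : 0 ≤ 3 ^ (1 + α) * ((n : ℝ) + 1) ^ (-(1 + α)) := by positivity
  have hQ : 0 ≤ |b₁| * ((n : ℝ) + 1) ^ (-(1 + α)) := by positivity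
  unfold beta
  simp only [habs]
  rw [if_neg (by omega)]
  split_ifs with h1 h2
  · have hn : n = 0 := by
      rw [abs_of_pos (by omega)] at h1
      omega
    refine main _ ?_
    rw [← hb₁, hn]
    have : (0 : ℝ) < 3 ^ (1 + α) := by positivity
    simp
    positivity
  · have hn : 1 ≤ n := by
      by_contra hn
      have : n = 0 := by omega
      rw [this] at h1
      simp at h1
    have hn' : (1 : ℝ) ≤ n := by exact_mod_cast hn
    refine main _ ?_
    rw [hd _ (by linarith), hd _ (by linarith)]
    have ht := (abs_phi_trapezoid_le hα hα₂ (x := (n : ℝ) + 1) (r := 1) zero_le_one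
      (by linarith)).1
    have h3 := hthird 1 (by linarith) (by linarith)
    rw [one_mul] at ht
    rw [show 2 * (phiDeriv α ((n : ℝ) + 1 + 1) + phiDeriv α ((n : ℝ) + 1 - 1) -
      phi α ((n : ℝ) + 1 + 1) + phi α ((n : ℝ) + 1 - 1)) =
      2 * (phiDeriv α ((n : ℝ) + 1 + 1) + phiDeriv α ((n : ℝ) + 1 - 1) -
        (phi α ((n : ℝ) + 1 + 1) - phi α ((n : ℝ) + 1 - 1))) by ring, abs_mul, abs_two]
    linarith
  · have hn : 2 ≤ n := by
      by_contra hn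
      have : n = 0 ∨ n = 1 := by omega
      rcases this with rfl | rfl
      · simp at h1
      · exact h2 (by decide)
    have hn' : (2 : ℝ) ≤ n := by exact_mod_cast hn
    refine main _ ?_
    rw [hd _ (by linarith), hd _ (by linarith), hd _ (by linarith)]
    obtain ⟨ht, ht'⟩ := abs_phi_trapezoid_le hα hα₂ (x := (n : ℝ) + 1) (r := 2) zero_le_two
      (by linarith)
    have h3 := hthird 2 (by linarith) (by linarith)
    -- With T the trapezoid error and S the second difference of φ', b_k = -T + (3/2)S.
    rw [abs_le] at ht ht' ⊢
    constructor <;> linarith [ht.1, ht.2, ht'.1, ht'.2]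

/-! ### Weights on the grid and Riemann sums -/

/-- The weight `(1 + |v|)^r`. -/
def wt (r v : ℝ) : ℝ := (1 + |v|) ^ r

theorem wt_pos (r v : ℝ) : 0 < wt r v := Real.rpow_pos_of_pos (by positivity) _

theorem wt_neg (r v : ℝ) : wt r (-v) = wt r v := by rw [wt, wt, abs_neg]

theorem wt_add (r s v : ℝ) : wt (r + s) v = wt r v * wt s v :=
  Real.rpow_add (by positivity) _ _

theorem wt_mono {r s : ℝ} (h : r ≤ s) (v : ℝ) : wt r v ≤ wt s v :=
  Real.rpow_le_rpow_of_exponent_le (by linarith [abs_nonneg v]) h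

/-- Weights at points at distance at most `d` are comparable. -/
theorem wt_le_of_abs_sub_le (r : ℝ) {d u v : ℝ} (h : |u - v| ≤ d) :
    wt r u ≤ (1 + d) ^ |r| * wt r v := by
  have hd : 0 ≤ d := (abs_nonneg _).trans h
  have hu := abs_nonneg u
  have hv := abs_nonneg v
  have h1 : |u| ≤ |v| + d := by
    have := abs_sub_abs_le_abs_sub u v
    linarith
  have h2 : |v| ≤ |u| + d := by
    have := abs_sub_abs_le_abs_sub v u
    rw [abs_sub_comm] at this
    linarith
  unfold wt
  rcases le_total 0 r with hr | hr
  · rw [abs_of_nonneg hr, ← Real.mul_rpow (by positivity) (by positivity)]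
    exact Real.rpow_le_rpow (by positivity) (by nlinarith) hr
  · rw [abs_of_nonpos hr]
    have h3 : ((1 + d) * (1 + |u|)) ^ r ≤ (1 + |v|) ^ r :=
      Real.rpow_le_rpow_of_nonpos (by positivity) (by nlinarith) hr
    rw [Real.mul_rpow (by positivity) (by positivity)] at h3
    have h4 : (1 + d) ^ (-r) * (1 + d) ^ r = 1 := by
      rw [← Real.rpow_add (by positivity), neg_add_cancel, Real.rpow_zero]
    calc (1 + |u|) ^ r = (1 + d) ^ (-r) * ((1 + d) ^ r * (1 + |u|) ^ r) := by
          rw [← mul_assoc, h4, one_mul]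
      _ ≤ _ := by gcongr

/-- Since v is the difference of v + x and x, one of these has absolute value at least |v|/2, and
its weight is at most 2^r times the weight of v. This makes convolutions of the weight bounded by
the weight. -/
theorem wt_mul_wt_add_le {r : ℝ} (hr : 0 ≤ r) (x v : ℝ) :
    wt (-r) x * wt (-r) (v + x) ≤ 2 ^ r * wt (-r) v * (wt (-r) x + wt (-r) (v + x)) := by
  have h1 : ∀ y : ℝ, 1 + |v| ≤ 2 * (1 + |y|) → wt (-r) y ≤ 2 ^ r * wt (-r) v := by
    intro y hy
    have h3 : (2 * (1 + |y|)) ^ (-r) ≤ (1 + |v|) ^ (-r) :=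
      Real.rpow_le_rpow_of_nonpos (by positivity) hy (by linarith)
    rw [Real.mul_rpow (by positivity) (by positivity), Real.rpow_neg (by norm_num)] at h3
    have h4 : (0 : ℝ) < 2 ^ r := by positivity
    unfold wt
    calc (1 + |y|) ^ (-r) = 2 ^ r * ((2 ^ r)⁻¹ * (1 + |y|) ^ (-r)) := by field_simp
      _ ≤ _ := by gcongr
  have hx := wt_pos (-r) x
  have hvx := wt_pos (-r) (v + x)
  have hv : 0 < 2 ^ r * wt (-r) v := mul_pos (by positivity) (wt_pos _ _)
  have htri : |v| ≤ |v + x| + |x| := by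
    have := abs_sub (v + x) x
    rwa [add_sub_cancel_right] at this
  rcases le_total (|x|) (|v + x|) with h | h
  · have := mul_le_mul_of_nonneg_left (h1 (v + x) (by linarith)) hx.le
    nlinarith [mul_pos hv hvx]
  · have := mul_le_mul_of_nonneg_left (h1 x (by linarith)) hvx.le
    nlinarith [mul_pos hv hx]

/-- Telescoping estimate for a negative power. -/
theorem mul_rpow_neg_le_sub {α h b : ℝ} (hα : 0 < α) (hh : 0 < h) (hb : h < b) :
    α * (h * b ^ (-(1 + α))) ≤ (b - h) ^ (-α) - b ^ (-α) := by
  have hb0 : 0 < b := hh.trans hb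
  have h1 : 0 < (b - h) / b := div_pos (by linarith) hb0
  have h2 : ((b - h) / b) ^ (-α) ≥ 1 + α * (h / b) := by
    rw [Real.rpow_def_of_pos h1]
    have h3 := Real.log_le_sub_one_of_pos h1
    have h4 := Real.add_one_le_exp (Real.log ((b - h) / b) * -α)
    have h5 : (b - h) / b - 1 = -(h / b) := by field_simp; ring
    rw [h5] at h3
    nlinarith
  have h6 : (b - h) ^ (-α) = ((b - h) / b) ^ (-α) * b ^ (-α) := by
    rw [← Real.mul_rpow h1.le hb0.le, div_mul_cancel₀ _ hb0.ne']
  have h7 : b ^ (-(1 + α)) = b ^ (-α) / b := by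
    rw [show -(1 + α) = -α - 1 by ring, Real.rpow_sub_one hb0.ne']
  have h8 : 0 < b ^ (-α) := by positivity
  rw [h6, h7]
  have := mul_le_mul_of_nonneg_right h2 h8.le
  calc α * (h * (b ^ (-α) / b)) = (1 + α * (h / b)) * b ^ (-α) - b ^ (-α) := by
        field_simp
        ring
    _ ≤ _ := by linarith

/-- Telescoping estimate for a positive power. -/
theorem mul_rpow_le_sub {s h b : ℝ} (hs : 0 < s) (hs₂ : s < 2) (hh : 0 < h) (hb : h ≤ b) :
    h * b ^ (s - 1) ≤ 3 / s * (b ^ s - (b - h) ^ s) := by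
  have hb0 : 0 < b := hh.trans_le hb
  set y := s * (h / b) with hy
  have hhb : h / b ≤ 1 := (div_le_one hb0).2 hb
  have hy0 : 0 < y := by positivity
  have hy2 : y ≤ 2 := by nlinarith
  have h1 : 0 ≤ (b - h) / b := div_nonneg (by linarith) hb0.le
  have h2 : ((b - h) / b) ^ s ≤ 1 - y / 3 := by
    have h3 : (b - h) / b ≤ Real.exp (-(h / b)) := by
      have := Real.add_one_le_exp (-(h / b))
      have h5 : (b - h) / b = -(h / b) + 1 := by field_simp; ring
      rwa [h5]
    have h4 : ((b - h) / b) ^ s ≤ Real.exp (-y) := by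
      refine (Real.rpow_le_rpow h1 h3 hs.le).trans_eq ?_
      rw [← Real.exp_mul, hy]
      congr 1
      ring
    have h5 : Real.exp (-y) ≤ 1 / (y + 1) := by
      rw [Real.exp_neg, ← one_div]
      exact one_div_le_one_div_of_le (by linarith) (Real.add_one_le_exp y)
    -- This amounts to y ≤ 2, hence the assumption s < 2 and the factor 3. For s > 1 the term is a
    -- right-endpoint Riemann sum of an increasing function, so some loss is unavoidable.
    have h6 : 1 / (y + 1) ≤ 1 - y / 3 := by
      rw [div_le_iff₀ (by linarith)]
      nlinarith
    linarith
  have h6 : (b - h) ^ s = ((b - h) / b) ^ s * b ^ s := by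
    rw [← Real.mul_rpow h1 hb0.le, div_mul_cancel₀ _ hb0.ne']
  rw [h6, Real.rpow_sub_one hb0.ne']
  have h8 : 0 < b ^ s := by positivity
  have := mul_le_mul_of_nonneg_right h2 h8.le
  calc h * (b ^ s / b) = 3 / s * (b ^ s - (1 - y / 3) * b ^ s) := by
        rw [hy]
        field_simp
        ring
    _ ≤ _ := by gcongr

theorem summable_of_le_telescope {a A : ℕ → ℝ} {B : ℝ} (ha : ∀ n, 0 ≤ a n)
    (h : ∀ n, a n ≤ A n - A (n + 1)) (hA : ∀ n, A 0 - A n ≤ B) :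
    Summable a ∧ ∑' n, a n ≤ B := by
  have hs : ∀ n, ∑ i ∈ Finset.range n, a i ≤ B := fun n =>
    ((Finset.sum_le_sum fun i _ => h i).trans_eq (Finset.sum_range_sub' A n)).trans (hA n)
  exact ⟨summable_of_sum_range_le ha hs, Real.tsum_le_of_sum_range_le ha hs⟩

theorem sum_wt_right {α h : ℝ} (hα : 0 < α) (hh : 0 < h) :
    Summable (fun n : ℕ => h * wt (-(1 + α)) (((n : ℝ) + 1) * h)) ∧
      ∑' n : ℕ, h * wt (-(1 + α)) (((n : ℝ) + 1) * h) ≤ 1 / α := by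
  refine summable_of_le_telescope (A := fun n => 1 / α * (1 + n * h) ^ (-α))
    (fun n => mul_nonneg hh.le (wt_pos _ _).le) (fun n => ?_) (fun n => ?_)
  · have hn : (0 : ℝ) ≤ n * h := by positivity
    have := mul_rpow_neg_le_sub hα hh (b := 1 + ((n : ℝ) + 1) * h) (by linarith)
    rw [show 1 + ((n : ℝ) + 1) * h - h = 1 + n * h by ring] at this
    rw [wt, abs_of_nonneg (by positivity)]
    push_cast
    rw [← mul_sub, one_div, inv_mul_eq_div, le_div_iff₀ hα]
    linarith
  · have : 0 ≤ 1 / α * (1 + n * h) ^ (-α) := by positivity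
    simp only [Nat.cast_zero, zero_mul, add_zero, Real.one_rpow, mul_one]
    linarith

theorem sum_wt {α h : ℝ} (hα : 0 < α) (hh : 0 < h) :
    Summable (fun k : ℤ => h * wt (-(1 + α)) (k * h)) ∧
      ∑' k : ℤ, h * wt (-(1 + α)) (k * h) ≤ h + 2 / α := by
  obtain ⟨hs, hle⟩ := sum_wt_right hα hh
  have h1 : HasSum (fun n : ℕ => h * wt (-(1 + α)) (((n : ℤ) : ℝ) * h))
      (h + ∑' n : ℕ, h * wt (-(1 + α)) (((n : ℝ) + 1) * h)) := by
    have : HasSum (fun n : ℕ => h * wt (-(1 + α)) (((n + 1 : ℕ) : ℝ) * h))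
      (∑' n : ℕ, h * wt (-(1 + α)) (((n : ℝ) + 1) * h)) := by
      push_cast
      exact hs.hasSum
    have h2 := (hasSum_nat_add_iff (f := fun n : ℕ => h * wt (-(1 + α)) ((n : ℝ) * h)) 1).1 this
    simp only [Finset.sum_range_one, Nat.cast_zero, zero_mul] at h2
    rw [show wt (-(1 + α)) 0 = 1 by simp [wt], mul_one] at h2
    rw [add_comm h]
    simpa only [Int.cast_natCast] using h2
  have h2 : HasSum (fun n : ℕ => h * wt (-(1 + α)) (((-((n : ℤ) + 1) : ℤ) : ℝ) * h))
      (∑' n : ℕ, h * wt (-(1 + α)) (((n : ℝ) + 1) * h)) := by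
    push_cast
    simp only [neg_mul, wt_neg]
    exact hs.hasSum
  have h3 := HasSum.of_nat_of_neg_add_one
    (f := fun k : ℤ => h * wt (-(1 + α)) (k * h)) h1 h2
  refine ⟨h3.summable, h3.tsum_eq.trans_le ?_⟩
  rw [show 2 / α = 1 / α + 1 / α by ring]
  linarith

theorem sum_wt_comp {α h : ℝ} (hα : 0 < α) (hh : 0 < h) {e : ℕ → ℤ}
    (he : Function.Injective e) :
    Summable (fun n : ℕ => h * wt (-(1 + α)) (e n * h)) ∧
      ∑' n : ℕ, h * wt (-(1 + α)) (e n * h) ≤ h + 2 / α := by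
  obtain ⟨hs, hle⟩ := sum_wt hα hh
  have h1 := hs.comp_injective he
  refine ⟨h1, le_trans ?_ hle⟩
  exact tsum_comp_le_tsum_of_inj hs (fun k => mul_nonneg hh.le (wt_pos _ _).le) he

/-- A majorant for jumps of length at most 1: the truncation at 1 makes the telescoping total at
most 1, whatever h is. -/
theorem sum_min_rpow {s h : ℝ} (hs : 0 < s) (hh : 0 < h) :
    Summable (fun n : ℕ => min (((n : ℝ) + 1) * h) 1 ^ s - min (n * h) 1 ^ s) ∧
      ∑' n : ℕ, (min (((n : ℝ) + 1) * h) 1 ^ s - min (n * h) 1 ^ s) ≤ 1 := by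
  refine summable_of_le_telescope (A := fun n : ℕ => -min (n * h) 1 ^ s) (fun n => ?_)
    (fun n => ?_) (fun n => ?_)
  · rw [sub_nonneg]
    refine Real.rpow_le_rpow (le_min (by positivity) zero_le_one) ?_ hs.le
    exact min_le_min_right _ (by nlinarith)
  · push_cast
    linarith
  · have h1 : min ((n : ℝ) * h) 1 ^ s ≤ 1 :=
      Real.rpow_le_one (le_min (by positivity) zero_le_one) (min_le_right _ _) hs.le
    simp only [Nat.cast_zero, zero_mul]
    rw [min_eq_left zero_le_one, Real.zero_rpow hs.ne']
    linarith

/-! ### Bounds for the discrete fractional Laplacian -/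

/-- The `n`-th term of the series defining `Lam`. -/
def lamTerm (α h : ℝ) (f : ℤ → ℝ) (j : ℤ) (n : ℕ) : ℝ :=
  beta α h ((n : ℤ) + 1) * (f (j + ((n : ℤ) + 1)) + f (j - ((n : ℤ) + 1)) - 2 * f j) * h

theorem Lam_eq_tsum (α h : ℝ) (f : ℤ → ℝ) (j : ℤ) : Lam α h f j = ∑' n, lamTerm α h f j n := rfl

theorem summable_beta {α : ℝ} (hα : 0 < α) (hα₂ : α < 2) {h : ℝ} (hh : 0 < h) :
    Summable fun n : ℕ => |beta α h ((n : ℤ) + 1)| := by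
  obtain ⟨C, hC, hb⟩ := abs_beta_le hα hα₂
  refine Summable.of_nonneg_of_le (fun n => abs_nonneg _) (fun n => hb h hh n) ?_
  refine Summable.mul_left _ ?_
  have h1 : Summable fun n : ℕ => ((n + 1 : ℕ) : ℝ) ^ (-(1 + α)) :=
    (summable_nat_add_iff 1).2 (Real.summable_nat_rpow.2 (by linarith))
  refine (h1.mul_right (h ^ (-(1 + α)))).congr fun n => ?_
  rw [Real.mul_rpow (by positivity) hh.le]
  push_cast
  rfl

theorem summable_lamTerm {α : ℝ} (hα : 0 < α) (hα₂ : α < 2) {h : ℝ} (hh : 0 < h) {f : ℤ → ℝ}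
    {B : ℝ} (hf : ∀ j, |f j| ≤ B) (j : ℤ) : Summable (lamTerm α h f j) := by
  refine Summable.of_norm_bounded (g := fun n : ℕ => |beta α h ((n : ℤ) + 1)| * (4 * B * h))
    ((summable_beta hα hα₂ hh).mul_right _) fun n => ?_
  rw [lamTerm, mul_assoc, Real.norm_eq_abs, abs_mul, abs_mul, abs_of_pos hh]
  gcongr
  have h1 := abs_le.1 (hf (j + ((n : ℤ) + 1)))
  have h2 := abs_le.1 (hf (j - ((n : ℤ) + 1)))
  have h3 := abs_le.1 (hf j)
  rw [abs_le]
  constructor <;> linarith [h1.1, h1.2, h2.1, h2.2, h3.1, h3.2]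

/-- The discrete fractional Laplacian preserves the decay `(1 + |v|)^(-(1+α))` of a function whose
second differences have the same decay. -/
theorem abs_Lam_le {α : ℝ} (hα : 0 < α) (hα₂ : α < 2) (h₀ : ℝ) :
    ∃ C : ℝ, 0 ≤ C ∧ ∀ h : ℝ, 0 < h → h ≤ h₀ → ∀ (u : ℤ → ℝ) (A : ℝ),
      (∀ j : ℤ, |u j| ≤ A * wt (-(1 + α)) (j * h)) →
      (∀ (j : ℤ) (n : ℕ), ((n : ℝ) + 1) * h ≤ 1 →
        |u (j + ((n : ℤ) + 1)) + u (j - ((n : ℤ) + 1)) - 2 * u j| ≤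
          A * (((n : ℝ) + 1) * h) ^ 2 * wt (-(1 + α)) (j * h)) →
      ∀ j : ℤ, |Lam α h u j| ≤ C * (A * wt (-(1 + α)) (j * h)) := by
  obtain ⟨Cb, hCb, hb⟩ := abs_beta_le hα hα₂
  set s := 2 - α with hs
  have hs0 : 0 < s := by linarith
  have hs2 : s < 2 := by linarith
  set P : ℝ := 2 ^ (1 + α) with hP
  have hP1 : 1 ≤ P := Real.one_le_rpow (by norm_num) (by linarith)
  refine ⟨Cb * (3 / s + 4 * P ^ 2) * (1 + 3 * |h₀ + 2 / α|), by positivity,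
    fun h hh hh₀ u A hu hu2 j => ?_⟩
  have hw := wt_pos (-(1 + α)) (j * h)
  have hA : 0 ≤ A := by
    have h1 := (abs_nonneg _).trans (hu j)
    exact nonneg_of_mul_nonneg_left h1 hw
  set w := wt (-(1 + α)) with hwdef
  -- T1 controls the jumps x ≤ 1, where x^{-(1+α)} x² h = h x^{s-1} telescopes. T2, T3 and T4
  -- control x > 1: they are the Riemann sums of the weight at the jump length and at the two
  -- endpoints, to which `wt_mul_wt_add_le` reduces every product. Each has total at most h + 2/α.
  set T1 : ℕ → ℝ := fun n => min (((n : ℝ) + 1) * h) 1 ^ s - min (n * h) 1 ^ s with hT1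
  set T2 : ℕ → ℝ := fun n => h * w (((n : ℝ) + 1) * h) with hT2
  set T3 : ℕ → ℝ := fun n => h * w (((j + ((n : ℤ) + 1) : ℤ) : ℝ) * h) with hT3
  set T4 : ℕ → ℝ := fun n => h * w (((j - ((n : ℤ) + 1) : ℤ) : ℝ) * h) with hT4
  obtain ⟨s1, b1⟩ := sum_min_rpow hs0 hh
  have sb2 := sum_wt_comp hα hh (e := fun n : ℕ => (n : ℤ) + 1) (fun a b hab => by
    simpa using hab)
  obtain ⟨s3, b3⟩ := sum_wt_comp hα hh (e := fun n : ℕ => j + ((n : ℤ) + 1)) (fun a b hab => by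
    simpa using hab)
  obtain ⟨s4, b4⟩ := sum_wt_comp hα hh (e := fun n : ℕ => j - ((n : ℤ) + 1)) (fun a b hab => by
    simpa using hab)
  push_cast at sb2
  obtain ⟨s2, b2⟩ := sb2
  have p1 : ∀ n, 0 ≤ T1 n := fun n => by
    rw [hT1, sub_nonneg]
    refine Real.rpow_le_rpow (le_min (by positivity) zero_le_one) ?_ hs0.le
    exact min_le_min_right _ (by nlinarith)
  have p2 : ∀ n, 0 ≤ T2 n := fun n => mul_nonneg hh.le (wt_pos _ _).le
  have p3 : ∀ n, 0 ≤ T3 n := fun n => mul_nonneg hh.le (wt_pos _ _).le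
  have p4 : ∀ n, 0 ≤ T4 n := fun n => mul_nonneg hh.le (wt_pos _ _).le
  have hterm : ∀ n, |lamTerm α h u j n| ≤
      Cb * (3 / s + 4 * P ^ 2) * (A * w (j * h)) * (T1 n + T2 n + T3 n + T4 n) := by
    intro n
    set x := ((n : ℝ) + 1) * h with hx
    have hx0 : 0 < x := by positivity
    rw [lamTerm, abs_mul, abs_mul, abs_of_pos hh]
    rcases le_or_gt x 1 with hx1 | hx1
    · have hxs : h * x ^ (s - 1) ≤ 3 / s * T1 n := by
        have := mul_rpow_le_sub hs0 hs2 hh (b := x) (by rw [hx]; nlinarith [n.cast_nonneg (α := ℝ)])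
        rw [hT1]
        simp only
        rw [← hx, min_eq_left hx1, min_eq_left (by rw [hx] at hx1; nlinarith)]
        rwa [show x - h = n * h by rw [hx]; ring] at this
      have hpow : x ^ (s - 1) = x ^ (-(1 + α)) * x ^ 2 := by
        rw [← Real.rpow_natCast x 2, ← Real.rpow_add hx0]
        congr 1
        push_cast
        rw [hs]
        ring
      calc _ ≤ Cb * x ^ (-(1 + α)) * (A * x ^ 2 * w (j * h)) * h := by
            gcongr
            · exact hb h hh n
            · exact hu2 j n hx1
        _ = Cb * (A * w (j * h)) * (h * x ^ (s - 1)) := by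
            rw [hpow]
            ring
        _ ≤ Cb * (A * w (j * h)) * (3 / s * T1 n) := by gcongr
        _ = Cb * (A * w (j * h)) * (3 / s * (T1 n + 0 + 0 + 0) + 0) := by ring
        _ ≤ Cb * (A * w (j * h)) * (3 / s * (T1 n + T2 n + T3 n + T4 n) +
              4 * P ^ 2 * (T1 n + T2 n + T3 n + T4 n)) := by
            gcongr
            · exact p2 n
            · exact p3 n
            · exact p4 n
            · have := p1 n
              have := p2 n
              have := p3 n
              have := p4 n
              positivity
        _ = _ := by ring
    · have hxw : x ^ (-(1 + α)) ≤ P * w x := by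
        have h3 : (2 * x) ^ (-(1 + α)) ≤ (1 + |x|) ^ (-(1 + α)) := by
          rw [abs_of_pos hx0]
          exact Real.rpow_le_rpow_of_nonpos (by positivity) (by linarith) (by linarith)
        rw [Real.mul_rpow (by norm_num) hx0.le, Real.rpow_neg (by norm_num), ← hP] at h3
        have hP0 : 0 < P := by linarith
        calc x ^ (-(1 + α)) = P * (P⁻¹ * x ^ (-(1 + α))) := by field_simp
          _ ≤ _ := by
            rw [hwdef, wt]
            gcongr
      set wp := w (((j + ((n : ℤ) + 1) : ℤ) : ℝ) * h) with hwp
      set wm := w (((j - ((n : ℤ) + 1) : ℤ) : ℝ) * h) with hwm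
      have hwx : 0 < w x := wt_pos _ _
      have c1 : w x * wp ≤ P * w (j * h) * (w x + wp) := by
        have := wt_mul_wt_add_le (r := 1 + α) (by linarith) x (j * h)
        rwa [show (j : ℝ) * h + x = ((j + ((n : ℤ) + 1) : ℤ) : ℝ) * h by
          rw [hx]; push_cast; ring] at this
      have c2 : w x * wm ≤ P * w (j * h) * (w x + wm) := by
        have := wt_mul_wt_add_le (r := 1 + α) (by linarith) (-x) (j * h)
        rwa [wt_neg, show (j : ℝ) * h + -x = ((j - ((n : ℤ) + 1) : ℤ) : ℝ) * h by
          rw [hx]; push_cast; ring] at this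
      have hsum : |u (j + ((n : ℤ) + 1)) + u (j - ((n : ℤ) + 1)) - 2 * u j| ≤
          A * (wp + wm + 2 * w (j * h)) := by
        have h1 := abs_le.1 (hu (j + ((n : ℤ) + 1)))
        have h2 := abs_le.1 (hu (j - ((n : ℤ) + 1)))
        have h3 := abs_le.1 (hu j)
        rw [abs_le]
        constructor <;> linarith [h1.1, h1.2, h2.1, h2.2, h3.1, h3.2]
      have hW : w x * (wp + wm + 2 * w (j * h)) ≤ 4 * P * w (j * h) * (w x + wp + wm) := by
        have hwp0 : 0 < wp := wt_pos _ _
        have hwm0 : 0 < wm := wt_pos _ _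
        have e1 : 0 ≤ P * w (j * h) * wp := by positivity
        have e2 : 0 ≤ P * w (j * h) * wm := by positivity
        have e3 : 1 * (w (j * h) * w x) ≤ P * (w (j * h) * w x) := by gcongr
        nlinarith
      have hPP : 0 ≤ 3 / s := by positivity
      calc _ ≤ Cb * (P * w x) * (A * (wp + wm + 2 * w (j * h))) * h := by
            gcongr
            exact (hb h hh n).trans (by gcongr)
        _ = Cb * P * A * h * (w x * (wp + wm + 2 * w (j * h))) := by ring
        _ ≤ Cb * P * A * h * (4 * P * w (j * h) * (w x + wp + wm)) := by gcongr
        _ = Cb * (0 + 4 * P ^ 2) * (A * w (j * h)) * (0 + h * w x + h * wp + h * wm) := by ring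
        _ ≤ _ := by
            gcongr
            · have := p2 n
              have := p3 n
              have := p4 n
              simp only [hT2, hT3, hT4] at *
              linarith
            · exact p1 n
  have hTs := ((s1.add s2).add s3).add s4
  have hTb : ∑' n, (T1 n + T2 n + T3 n + T4 n) ≤ 1 + 3 * |h₀ + 2 / α| := by
    rw [((s1.add s2).add s3).tsum_add s4, (s1.add s2).tsum_add s3, s1.tsum_add s2]
    have := le_abs_self (h₀ + 2 / α)
    linarith
  rw [Lam_eq_tsum, ← Real.norm_eq_abs]
  refine (tsum_of_norm_bounded (hTs.mul_left _).hasSum hterm).trans ?_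
  rw [tsum_mul_left]
  calc Cb * (3 / s + 4 * P ^ 2) * (A * w (j * h)) * ∑' n, (T1 n + T2 n + T3 n + T4 n) ≤
      Cb * (3 / s + 4 * P ^ 2) * (A * w (j * h)) * (1 + 3 * |h₀ + 2 / α|) := by gcongr
    _ = _ := by ring

/-- The double series over jumps and nodes converges absolutely, and for each fixed jump the second
differences of a summable sequence sum to zero. -/
theorem hasSum_Lam_zero {α : ℝ} (hα : 0 < α) (hα₂ : α < 2) {h : ℝ} (hh : 0 < h) {f : ℤ → ℝ}
    (hf : Summable f) : HasSum (Lam α h f) 0 := by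
  have hfa : Summable fun j => |f j| := hf.abs
  set S := ∑' j, |f j| with hS
  have hp : ∀ m : ℤ, HasSum (fun j => |f (j + m)|) S := fun m =>
    (Equiv.addRight m).hasSum_iff.2 hfa.hasSum
  have hp' : ∀ m : ℤ, HasSum (fun j => f (j + m)) (∑' j, f j) := fun m =>
    (Equiv.addRight m).hasSum_iff.2 hf.hasSum
  have hg : ∀ n : ℕ, HasSum (fun j : ℤ => |beta α h ((n : ℤ) + 1)| *
      (|f (j + ((n : ℤ) + 1))| + |f (j + -((n : ℤ) + 1))| + 2 * |f j|) * h)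
      (|beta α h ((n : ℤ) + 1)| * (S + S + 2 * S) * h) := fun n =>
    ((((hp _).add (hp _)).add (hfa.hasSum.mul_left 2)).mul_left _).mul_right h
  have hG : Summable fun p : ℕ × ℤ => |beta α h ((p.1 : ℤ) + 1)| *
      (|f (p.2 + ((p.1 : ℤ) + 1))| + |f (p.2 + -((p.1 : ℤ) + 1))| + 2 * |f p.2|) * h := by
    rw [summable_prod_of_nonneg fun p => by positivity]
    refine ⟨fun n => (hg n).summable, ?_⟩
    simp only [(hg _).tsum_eq]
    exact ((summable_beta hα hα₂ hh).mul_right _).mul_right _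
  have hF : Summable fun p : ℕ × ℤ => lamTerm α h f p.2 p.1 := by
    refine Summable.of_norm_bounded hG fun p => ?_
    rw [lamTerm, Real.norm_eq_abs, abs_mul, abs_mul, abs_of_pos hh, ← sub_eq_add_neg]
    gcongr
    refine (abs_sub _ _).trans ?_
    rw [abs_mul, abs_two]
    gcongr
    exact abs_add_le _ _
  have hz : ∀ n : ℕ, ∑' j : ℤ, lamTerm α h f j n = 0 := by
    intro n
    have := ((((hp' ((n : ℤ) + 1)).add (hp' (-((n : ℤ) + 1)))).sub
      (hf.hasSum.mul_left 2)).mul_left (beta α h ((n : ℤ) + 1))).mul_right h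
    refine Eq.trans ?_ (this.tsum_eq.trans (by ring))
    rfl
  have h1 : ∑' j : ℤ, ∑' n : ℕ, lamTerm α h f j n = 0 := by
    rw [Summable.tsum_comm (f := fun (n : ℕ) (j : ℤ) => lamTerm α h f j n) hF]
    simp [hz]
  have h2 : Summable fun j : ℤ => ∑' n : ℕ, lamTerm α h f j n := hF.prod_symm.prod
  have h3 := h2.hasSum
  rw [h1] at h3
  exact h3

/-! ### Grid symbols -/

/-- Families of grid functions of size `(1 + |v|)^r`, uniformly Lipschitz with the same weight. -/
def GridSymbol (h₀ r : ℝ) (u : ℝ → ℤ → ℝ) : Prop :=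
  ∃ C : ℝ, 0 ≤ C ∧ ∀ h : ℝ, 0 < h → h ≤ h₀ → ∀ j : ℤ,
    |u h j| ≤ C * wt r (j * h) ∧ |u h (j + 1) - u h j| ≤ C * h * wt r (j * h)

theorem wt_shift_le (r : ℝ) {h h₀ : ℝ} (hh : 0 < h) (hh₀ : h ≤ h₀) (j : ℤ) :
    wt r ((j + 1 : ℤ) * h) ≤ (1 + h₀) ^ |r| * wt r (j * h) ∧
      wt r (j * h) ≤ (1 + h₀) ^ |r| * wt r ((j + 1 : ℤ) * h) := by
  constructor <;> refine wt_le_of_abs_sub_le r ?_ <;> push_cast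
  · rw [show ((j : ℝ) + 1) * h - j * h = h by ring, abs_of_pos hh]
    exact hh₀
  · rw [show (j : ℝ) * h - (j + 1) * h = -h by ring, abs_neg, abs_of_pos hh]
    exact hh₀

section GridSymbol

variable {h₀ r s : ℝ} {u v : ℝ → ℤ → ℝ}

theorem gridSymbol_of_bounds {C D : ℝ}
    (hC : ∀ h : ℝ, 0 < h → h ≤ h₀ → ∀ j : ℤ, |u h j| ≤ C * wt r (j * h))
    (hD : ∀ h : ℝ, 0 < h → h ≤ h₀ → ∀ j : ℤ, |u h (j + 1) - u h j| ≤ D * h * wt r (j * h)) :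
    GridSymbol h₀ r u := by
  refine ⟨|C| + |D|, by positivity, fun h hh hh₀ j => ⟨(hC h hh hh₀ j).trans ?_,
    (hD h hh hh₀ j).trans ?_⟩⟩
  · have := wt_pos r (j * h)
    gcongr
    linarith [le_abs_self C, abs_nonneg D]
  · have := wt_pos r (j * h)
    gcongr
    linarith [le_abs_self D, abs_nonneg C]

theorem GridSymbol.shift (hu : GridSymbol h₀ r u) :
    GridSymbol h₀ r fun h j => u h (j + 1) := by
  obtain ⟨C, hC, H⟩ := hu
  refine gridSymbol_of_bounds (C := C * (1 + h₀) ^ |r|) (D := C * (1 + h₀) ^ |r|)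
    (fun h hh hh₀ j => ?_) (fun h hh hh₀ j => ?_)
  · refine (H h hh hh₀ (j + 1)).1.trans ?_
    rw [mul_assoc]
    exact mul_le_mul_of_nonneg_left (wt_shift_le r hh hh₀ j).1 hC
  · refine (H h hh hh₀ (j + 1)).2.trans ?_
    calc C * h * wt r ((j + 1 : ℤ) * h) ≤ C * h * ((1 + h₀) ^ |r| * wt r (j * h)) :=
          mul_le_mul_of_nonneg_left (wt_shift_le r hh hh₀ j).1 (by positivity)
      _ = _ := by ring

theorem GridSymbol.mul (hu : GridSymbol h₀ r u) (hv : GridSymbol h₀ s v) :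
    GridSymbol h₀ (r + s) fun h j => u h j * v h j := by
  obtain ⟨C', hC', H'⟩ := hu.shift
  obtain ⟨C, hC, H⟩ := hu
  obtain ⟨D, hD, K⟩ := hv
  refine gridSymbol_of_bounds (C := C * D) (D := C' * D + C * D)
    (fun h hh hh₀ j => ?_) (fun h hh hh₀ j => ?_)
  · have hr := wt_pos r (j * h)
    rw [abs_mul, wt_add]
    calc |u h j| * |v h j| ≤ (C * wt r (j * h)) * (D * wt s (j * h)) :=
          mul_le_mul (H h hh hh₀ j).1 (K h hh hh₀ j).1 (abs_nonneg _) (by positivity)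
      _ = _ := by ring
  · have hr := wt_pos r (j * h)
    have hs := wt_pos s (j * h)
    rw [wt_add, show u h (j + 1) * v h (j + 1) - u h j * v h j =
      u h (j + 1) * (v h (j + 1) - v h j) + (u h (j + 1) - u h j) * v h j by ring]
    refine (abs_add_le _ _).trans ?_
    rw [abs_mul, abs_mul]
    calc |u h (j + 1)| * |v h (j + 1) - v h j| + |u h (j + 1) - u h j| * |v h j| ≤
        (C' * wt r (j * h)) * (D * h * wt s (j * h)) +
          (C * h * wt r (j * h)) * (D * wt s (j * h)) :=
          add_le_add (mul_le_mul (H' h hh hh₀ j).1 (K h hh hh₀ j).2 (abs_nonneg _) (by positivity))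
            (mul_le_mul (H h hh hh₀ j).2 (K h hh hh₀ j).1 (abs_nonneg _) (by positivity))
      _ = _ := by ring

/-- The increment of 1/u is the increment of u divided by two neighbouring values of u, so the lower
bound turns the order r into -r. -/
theorem GridSymbol.inv (hu : GridSymbol h₀ r u) {c : ℝ} (hc : 0 < c)
    (hlow : ∀ h : ℝ, 0 < h → h ≤ h₀ → ∀ j : ℤ, c * wt r (j * h) ≤ u h j) :
    GridSymbol h₀ (-r) fun h j => (u h j)⁻¹ := by
  obtain ⟨C, hC, H⟩ := hu
  have hinv : ∀ h : ℝ, 0 < h → h ≤ h₀ → ∀ j : ℤ, (u h j)⁻¹ ≤ c⁻¹ * wt (-r) (j * h) := by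
    intro h hh hh₀ j
    have hr := wt_pos r (j * h)
    have h1 : wt (-r) (j * h) = (wt r (j * h))⁻¹ := Real.rpow_neg (by positivity) _
    rw [h1, ← mul_inv]
    exact inv_anti₀ (by positivity) (hlow h hh hh₀ j)
  have hpos : ∀ h : ℝ, 0 < h → h ≤ h₀ → ∀ j : ℤ, 0 < u h j := fun h hh hh₀ j =>
    lt_of_lt_of_le (mul_pos hc (wt_pos _ _)) (hlow h hh hh₀ j)
  refine gridSymbol_of_bounds (C := c⁻¹) (D := c⁻¹ * C * (c⁻¹ * (1 + h₀) ^ |-r|))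
    (fun h hh hh₀ j => ?_) (fun h hh hh₀ j => ?_)
  · rw [abs_of_pos (inv_pos.2 (hpos h hh hh₀ j))]
    exact hinv h hh hh₀ j
  · have p0 := hpos h hh hh₀ j
    have p1 := hpos h hh hh₀ (j + 1)
    have hr := wt_pos r (j * h)
    have hr' := wt_pos (-r) (j * h)
    have e : (u h (j + 1))⁻¹ - (u h j)⁻¹ =
        -((u h j)⁻¹ * (u h (j + 1) - u h j) * (u h (j + 1))⁻¹) := by
      field_simp
      ring
    have h1 : wt (-r) (j * h) * wt r (j * h) = 1 := by
      rw [← wt_add, neg_add_cancel]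
      simp [wt]
    rw [e, abs_neg, abs_mul, abs_mul, abs_of_pos (inv_pos.2 p0), abs_of_pos (inv_pos.2 p1)]
    calc (u h j)⁻¹ * |u h (j + 1) - u h j| * (u h (j + 1))⁻¹ ≤
        (c⁻¹ * wt (-r) (j * h)) * (C * h * wt r (j * h)) *
          (c⁻¹ * ((1 + h₀) ^ |-r| * wt (-r) (j * h))) := by
          gcongr
          · exact hinv h hh hh₀ j
          · exact (H h hh hh₀ j).2
          · exact (hinv h hh hh₀ (j + 1)).trans
              (mul_le_mul_of_nonneg_left (wt_shift_le (-r) hh hh₀ j).1 (by positivity))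
      _ = c⁻¹ * C * (c⁻¹ * (1 + h₀) ^ |-r|) * h * (wt (-r) (j * h) * wt r (j * h)) *
          wt (-r) (j * h) := by ring
      _ = _ := by rw [h1, mul_one]

end GridSymbol

/-! ### The discrete equilibrium -/

/-- The forward difference quotient of the discrete equilibrium. -/
def dM (α h : ℝ) (j : ℤ) : ℝ := (M α h (j + 1) - M α h j) / h

theorem abs_dens_le_near {α : ℝ} (hα : 0 < α) (hα₂ : α < 2) (k : ℕ) (d : ℝ) :
    ∃ C : ℝ, 0 ≤ C ∧ ∀ v y, |y - v| ≤ d → |dens α k y| ≤ C * wt (-(1 + α + k)) v := by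
  obtain ⟨C, hC, H⟩ := abs_dens_le_weight hα hα₂ k
  refine ⟨C * abs ((1 + d) ^ abs (-(1 + α + (k : ℝ)))), by positivity, fun v y hy => (H y).trans ?_⟩
  rw [mul_assoc]
  refine mul_le_mul_of_nonneg_left ?_ hC.le
  refine (wt_le_of_abs_sub_le _ hy).trans ?_
  exact mul_le_mul_of_nonneg_right (le_abs_self _) (wt_pos _ _).le

section Density

variable {α : ℝ}

theorem M_eq (hα : 0 < α) (h : ℝ) (j : ℤ) : M α h j = dens α 0 (j * h) := mu_eq_dens hα _

theorem M_neg (hα : 0 < α) (h : ℝ) (j : ℤ) : M α h (-j) = M α h j := by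
  rw [M_eq hα, M_eq hα]
  push_cast
  rw [neg_mul, dens_neg, pow_zero, one_mul]

theorem exists_le_M (hα : 0 < α) (hα₂ : α < 2) :
    ∃ c : ℝ, 0 < c ∧ ∀ (h : ℝ) (j : ℤ), c * wt (-(1 + α)) (j * h) ≤ M α h j := by
  obtain ⟨c, hc, H⟩ := exists_weight_le_dens_zero hα hα₂
  exact ⟨c, hc, fun h j => by rw [M_eq hα]; exact H _⟩

theorem M_pos (hα : 0 < α) (hα₂ : α < 2) (h : ℝ) (j : ℤ) : 0 < M α h j := by
  obtain ⟨c, hc, H⟩ := exists_le_M hα hα₂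
  exact lt_of_lt_of_le (mul_pos hc (wt_pos _ _)) (H h j)

/-- Increments of the `k`-th derivative of the density. -/
theorem abs_dens_sub_le (hα : 0 < α) (hα₂ : α < 2) (k : ℕ) (h₀ : ℝ) :
    ∃ C : ℝ, 0 ≤ C ∧ ∀ h, 0 < h → h ≤ h₀ → ∀ v,
      |dens α k (v + h) - dens α k v| ≤ C * h * wt (-(2 + α + k)) v := by
  obtain ⟨C, hC, H⟩ := abs_dens_le_near hα hα₂ (k + 1) h₀
  refine ⟨C, hC, fun h hh hh₀ v => ?_⟩
  have := abs_le_of_deriv_le (g := fun s => dens α k (v + s) - dens α k v)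
    (g' := fun s => dens α (k + 1) (v + s)) (r := h) (K := C * wt (-(2 + α + k)) v) hh.le (by simp)
    (fun s _ => (HasDerivAt.comp_const_add' (hasDerivAt_dens hα k (v + s))).sub_const _)
    (fun s hs => ?_)
  · exact this.trans_eq (by ring)
  · have h1 := H v (v + s) (by rw [add_sub_cancel_left, abs_of_nonneg hs.1]; linarith [hs.2])
    rwa [show -(1 + α + ((k + 1 : ℕ) : ℝ)) = -(2 + α + k) by push_cast; ring] at h1

/-- Symmetric second differences of the `k`-th derivative of the density. -/
theorem abs_dens_second_difference_le (hα : 0 < α) (hα₂ : α < 2) (k : ℕ) (d h₀ : ℝ) :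
    ∃ C : ℝ, 0 ≤ C ∧ ∀ v y x, |y - v| ≤ h₀ → 0 ≤ x → x ≤ d →
      |dens α k (y + x) + dens α k (y - x) - 2 * dens α k y| ≤
        C * x ^ 2 * wt (-(3 + α + k)) v := by
  obtain ⟨C, hC, H⟩ := abs_dens_le_near hα hα₂ (k + 2) (h₀ + d)
  refine ⟨2 * C, by positivity, fun v y x hy hx hxd => ?_⟩
  have := abs_second_difference_le (f₁ := dens α k) (f₂ := dens α (k + 1))
    (f₃ := dens α (k + 2)) (x := y) (r := x) (B := C * wt (-(3 + α + k)) v) hx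
    (fun z _ => hasDerivAt_dens hα k z) (fun z _ => hasDerivAt_dens hα (k + 1) z)
    (fun z hz => ?_)
  · exact this.trans_eq (by ring)
  · have hzy : |z - y| ≤ d := by
      rw [abs_le]
      constructor <;> linarith [hz.1, hz.2]
    have h1 := H v z (by
      have := abs_sub_le z y v
      linarith)
    rwa [show -(1 + α + ((k + 2 : ℕ) : ℝ)) = -(3 + α + k) by push_cast; ring] at h1

theorem gridSymbol_M (hα : 0 < α) (hα₂ : α < 2) (h₀ : ℝ) :
    GridSymbol h₀ (-(1 + α)) fun h j => M α h j := by
  obtain ⟨C, hC, H⟩ := abs_dens_le_weight hα hα₂ 0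
  obtain ⟨D, hD, K⟩ := abs_dens_sub_le hα hα₂ 0 h₀
  refine gridSymbol_of_bounds (C := C) (D := D) (fun h hh hh₀ j => ?_) (fun h hh hh₀ j => ?_)
  · rw [M_eq hα]
    simpa [wt] using H (j * h)
  · rw [M_eq hα, M_eq hα]
    push_cast
    rw [add_mul, one_mul]
    refine (K h hh hh₀ _).trans ?_
    have := wt_mono (r := -(2 + α + (0 : ℕ))) (s := -(1 + α)) (by push_cast; linarith) (j * h)
    gcongr

theorem gridSymbol_dM (hα : 0 < α) (hα₂ : α < 2) (h₀ : ℝ) :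
    GridSymbol h₀ (-(2 + α)) (dM α) := by
  obtain ⟨C, hC, H⟩ := abs_dens_sub_le hα hα₂ 0 h₀
  obtain ⟨D, hD, K⟩ := abs_dens_second_difference_le hα hα₂ 0 h₀ h₀
  refine gridSymbol_of_bounds (C := C) (D := D) (fun h hh hh₀ j => ?_) (fun h hh hh₀ j => ?_)
  · rw [dM, M_eq hα, M_eq hα, abs_div, abs_of_pos hh, div_le_iff₀ hh]
    push_cast
    rw [add_mul, one_mul]
    have := H h hh hh₀ (j * h)
    rw [Nat.cast_zero, add_zero] at this
    linarith
  · have h1 := K (j * h) ((j + 1) * h) h (by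
      rw [show ((j : ℝ) + 1) * h - j * h = h by ring, abs_of_pos hh]
      exact hh₀) hh.le hh₀
    rw [Nat.cast_zero, add_zero] at h1
    have e : dM α h (j + 1) - dM α h j = (dens α 0 ((j + 1) * h + h) +
        dens α 0 ((j + 1) * h - h) - 2 * dens α 0 ((j + 1) * h)) / h := by
      rw [dM, dM, M_eq hα, M_eq hα, M_eq hα]
      push_cast
      rw [show ((j : ℝ) + 1) * h + h = (j + 1 + 1) * h by ring,
        show ((j : ℝ) + 1) * h - h = j * h by ring]
      ring
    rw [e, abs_div, abs_of_pos hh, div_le_iff₀ hh]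
    refine h1.trans ?_
    have h2 := wt_mono (r := -(3 + α)) (s := -(2 + α)) (by linarith) (j * h)
    calc D * h ^ 2 * wt (-(3 + α)) (j * h) ≤ D * h ^ 2 * wt (-(2 + α)) (j * h) := by gcongr
      _ = _ := by ring

theorem Lam_dM (hα : 0 < α) (hα₂ : α < 2) {h : ℝ} (hh : 0 < h) (j : ℤ) :
    Lam α h (dM α h) j = (Lam α h (M α h) (j + 1) - Lam α h (M α h) j) / h := by
  obtain ⟨B, hB, H⟩ := abs_dens_le α 0
  have hb : ∀ j, |M α h j| ≤ B := fun j => by rw [M_eq hα]; exact H _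
  rw [Lam_eq_tsum, Lam_eq_tsum, Lam_eq_tsum, ← (summable_lamTerm hα hα₂ hh hb _).tsum_sub
    (summable_lamTerm hα hα₂ hh hb _), ← tsum_div_const]
  refine tsum_congr fun n => ?_
  simp only [lamTerm, dM]
  rw [show j + ((n : ℤ) + 1) + 1 = j + 1 + ((n : ℤ) + 1) by ring,
    show j - ((n : ℤ) + 1) + 1 = j + 1 - ((n : ℤ) + 1) by ring]
  ring

/-- Both bounds come from `abs_Lam_le`, applied to M for the size and to `dM` for the increments,
because `Lam` commutes with forward differences. -/
theorem gridSymbol_Lam_M (hα : 0 < α) (hα₂ : α < 2) (h₀ : ℝ) :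
    GridSymbol h₀ (-(1 + α)) fun h j => Lam α h (M α h) j := by
  obtain ⟨C, hC, H⟩ := abs_Lam_le hα hα₂ h₀
  obtain ⟨C₀, hC₀, H₀⟩ := gridSymbol_M hα hα₂ h₀
  obtain ⟨C₁, hC₁, H₁⟩ := gridSymbol_dM hα hα₂ h₀
  obtain ⟨D₀, hD₀, K₀⟩ := abs_dens_second_difference_le hα hα₂ 0 1 |h₀|
  obtain ⟨D₁, hD₁, K₁⟩ := abs_dens_second_difference_le hα hα₂ 1 1 |h₀|
  have hle : ∀ (a s v : ℝ), 0 ≤ a → s ≤ -(1 + α) → a * wt s v ≤ a * wt (-(1 + α)) v :=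
    fun a s v ha hs => mul_le_mul_of_nonneg_left (wt_mono hs v) ha
  refine gridSymbol_of_bounds (C := C * (C₀ + D₀)) (D := C * (C₁ + D₁))
    (fun h hh hh₀ j => ?_) (fun h hh hh₀ j => ?_)
  · rw [mul_assoc]
    refine H h hh hh₀ (M α h) (C₀ + D₀) (fun j => ?_) (fun j n hn => ?_) j
    · have hw := wt_pos (-(1 + α)) (j * h)
      refine (H₀ h hh hh₀ j).1.trans ?_
      gcongr
      linarith
    · have hw := wt_pos (-(1 + α)) (j * h)
      have hx : 0 ≤ ((n : ℝ) + 1) * h := by positivity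
      have h1 := K₀ (j * h) (j * h) (((n : ℝ) + 1) * h) (by simp) hx hn
      rw [M_eq hα, M_eq hα, M_eq hα]
      push_cast
      rw [add_mul, sub_mul]
      refine h1.trans ((hle _ (-(3 + α + (0 : ℕ))) _ (by positivity) (by push_cast; linarith)).trans ?_)
      gcongr
      linarith
  · have e : Lam α h (M α h) (j + 1) - Lam α h (M α h) j = Lam α h (dM α h) j * h := by
      rw [Lam_dM hα hα₂ hh]
      field_simp
    rw [e, abs_mul, abs_of_pos hh]
    have key := H h hh hh₀ (dM α h) (C₁ + D₁) (fun j => ?_) (fun j n hn => ?_) j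
    · calc |Lam α h (dM α h) j| * h ≤ C * ((C₁ + D₁) * wt (-(1 + α)) (j * h)) * h := by gcongr
        _ = _ := by ring
    · have hw := wt_pos (-(1 + α)) (j * h)
      refine (H₁ h hh hh₀ j).1.trans ((hle _ _ _ hC₁ (by linarith)).trans ?_)
      gcongr
      linarith
    · have hw := wt_pos (-(1 + α)) (j * h)
      set x := ((n : ℝ) + 1) * h with hxdef
      have hx : 0 ≤ x := by positivity
      -- Shifting the second difference of the density by s and differentiating in s gives a second
      -- difference of its derivative. Integrated up to s = h this produces the factor h that
      -- cancels the denominator of `dM`.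
      have h1 := abs_le_of_deriv_le (r := h) (K := D₁ * x ^ 2 * wt (-(3 + α + (1 : ℕ))) (j * h))
        (g := fun s => (dens α 0 (j * h + x + s) + dens α 0 (j * h - x + s) -
          2 * dens α 0 (j * h + s)) - (dens α 0 (j * h + x) + dens α 0 (j * h - x) -
          2 * dens α 0 (j * h)))
        (g' := fun s => dens α 1 (j * h + x + s) + dens α 1 (j * h - x + s) -
          2 * dens α 1 (j * h + s)) hh.le (by simp)
        (fun s hs => (((HasDerivAt.comp_const_add' (hasDerivAt_dens hα 0 _)).add
          (HasDerivAt.comp_const_add' (hasDerivAt_dens hα 0 _))).sub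
          ((HasDerivAt.comp_const_add' (hasDerivAt_dens hα 0 _)).const_mul 2)).sub_const _)
        (fun s hs => by
          rw [show (j : ℝ) * h + x + s = j * h + s + x by ring,
            show (j : ℝ) * h - x + s = j * h + s - x by ring]
          refine K₁ (j * h) (j * h + s) x ?_ hx hn
          rw [add_sub_cancel_left, abs_of_nonneg hs.1]
          exact hs.2.trans (hh₀.trans (le_abs_self _)))
      have e2 : dM α h (j + ((n : ℤ) + 1)) + dM α h (j - ((n : ℤ) + 1)) - 2 * dM α h j =
          ((dens α 0 (j * h + x + h) + dens α 0 (j * h - x + h) -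
          2 * dens α 0 (j * h + h)) - (dens α 0 (j * h + x) + dens α 0 (j * h - x) -
          2 * dens α 0 (j * h))) / h := by
        simp only [dM, M_eq hα]
        push_cast
        rw [show ((j : ℝ) + (n + 1) + 1) * h = j * h + x + h by rw [hxdef]; ring,
          show ((j : ℝ) + (n + 1)) * h = j * h + x by rw [hxdef]; ring,
          show ((j : ℝ) - (n + 1) + 1) * h = j * h - x + h by rw [hxdef]; ring,
          show ((j : ℝ) - (n + 1)) * h = j * h - x by rw [hxdef]; ring,
          show ((j : ℝ) + 1) * h = j * h + h by ring]
        ring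
      rw [e2, abs_div, abs_of_pos hh, div_le_iff₀ hh]
      have h3 : D₁ * x ^ 2 * wt (-(3 + α + (1 : ℕ))) (j * h) ≤
          (C₁ + D₁) * x ^ 2 * wt (-(1 + α)) (j * h) := by
        refine (hle _ (-(3 + α + (1 : ℕ))) _ (by positivity) (by push_cast; linarith)).trans ?_
        gcongr
        linarith
      exact h1.trans (mul_le_mul_of_nonneg_right h3 hh.le)

/-! ### The discrete velocity flux -/

theorem Lam_neg (α h : ℝ) {f : ℤ → ℝ} (hf : ∀ j, f (-j) = f j) (j : ℤ) :
    Lam α h f (-j) = Lam α h f j := by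
  rw [Lam_eq_tsum, Lam_eq_tsum]
  refine tsum_congr fun n => ?_
  rw [lamTerm, lamTerm, hf, show -j + ((n : ℤ) + 1) = -(j - (n + 1)) by ring,
    show -j - ((n : ℤ) + 1) = -(j + (n + 1)) by ring, hf, hf]
  ring

theorem sum_Icc_neg_succ (a : ℤ → ℝ) (n : ℕ) :
    ∑ k ∈ Finset.Icc (-((n + 1 : ℕ) : ℤ)) ((n + 1 : ℕ) : ℤ), a k =
      ∑ k ∈ Finset.Icc (-(n : ℤ)) (n : ℤ), a k + (a ((n : ℤ) + 1) + a (-((n : ℤ) + 1))) := by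
  have h1 : Finset.Icc (-((n + 1 : ℕ) : ℤ)) ((n + 1 : ℕ) : ℤ) =
      insert ((n : ℤ) + 1) (insert (-((n : ℤ) + 1)) (Finset.Icc (-(n : ℤ)) (n : ℤ))) := by
    ext k
    simp only [Finset.mem_insert, Finset.mem_Icc]
    push_cast
    omega
  rw [h1, Finset.sum_insert (by simp; omega), Finset.sum_insert (by simp)]
  ring

/-- A symmetric sum gains two equal terms per step, because ΛM is even, and the factor 1/2 leaves
one. Across the origin the two halves of the k = 0 term add up. -/
theorem VM_sub_VM (hα : 0 < α) (h : ℝ) (j : ℤ) :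
    VM α h (j + 1) - VM α h j = -(Lam α h (M α h) (j + 1) * h) := by
  have hneg := Lam_neg α h (M_neg hα h)
  obtain ⟨n, rfl | rfl⟩ : ∃ n : ℕ, j = n ∨ j = Int.negSucc n := by
    rcases j with n | n
    · exact ⟨n, Or.inl rfl⟩
    · exact ⟨n, Or.inr rfl⟩
  · have e1 : VM α h ((n : ℤ) + 1) = -(1 / 2) *
        ∑ k ∈ Finset.Icc (-((n + 1 : ℕ) : ℤ)) ((n + 1 : ℕ) : ℤ), Lam α h (M α h) k * h := rfl
    have e2 : VM α h (n : ℤ) = -(1 / 2) *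
        ∑ k ∈ Finset.Icc (-(n : ℤ)) (n : ℤ), Lam α h (M α h) k * h := rfl
    rw [e1, e2, sum_Icc_neg_succ, hneg]
    ring
  · rcases n with _ | n
    · have e1 : VM α h (Int.negSucc 0 + 1) = -(1 / 2) *
        ∑ k ∈ Finset.Icc (-((0 : ℕ) : ℤ)) ((0 : ℕ) : ℤ), Lam α h (M α h) k * h := rfl
      have e2 : VM α h (Int.negSucc 0) = 1 / 2 *
        ∑ k ∈ Finset.Icc (-((0 : ℕ) : ℤ)) ((0 : ℕ) : ℤ), Lam α h (M α h) k * h := rfl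
      rw [e1, e2]
      simp
      ring
    · have e0 : Int.negSucc (n + 1) + 1 = Int.negSucc n := rfl
      have e1 : VM α h (Int.negSucc n) = 1 / 2 *
        ∑ k ∈ Finset.Icc (-(n : ℤ)) (n : ℤ), Lam α h (M α h) k * h := rfl
      have e2 : VM α h (Int.negSucc (n + 1)) = 1 / 2 *
        ∑ k ∈ Finset.Icc (-((n + 1 : ℕ) : ℤ)) ((n + 1 : ℕ) : ℤ), Lam α h (M α h) k * h := rfl
      rw [e0, e1, e2, sum_Icc_neg_succ, show Int.negSucc n = -((n : ℤ) + 1) from rfl, hneg]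
      ring

theorem tendsto_sum_Icc_neg {a : ℤ → ℝ} {S : ℝ} (ha : HasSum a S) :
    Tendsto (fun n : ℕ => ∑ k ∈ Finset.Icc (-(n : ℤ)) (n : ℤ), a k) atTop (𝓝 S) := by
  refine ha.comp (tendsto_atTop_finset_of_monotone (fun m n hmn => ?_) fun k => ⟨k.natAbs, ?_⟩)
  · exact Finset.Icc_subset_Icc (by omega) (by omega)
  · rw [Finset.mem_Icc]
    omega

/-- The symmetric partial sums tend to 0, so each equals minus its tail. The tail is bounded by
telescoping from n to n + m and then letting m tend to infinity. -/
theorem abs_sum_Icc_neg_le (hα : 0 < α) {h C : ℝ} (hh : 0 < h) {a : ℤ → ℝ}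
    (ha : HasSum a 0) (hC : ∀ j : ℤ, |a j| ≤ C * wt (-(1 + α)) (j * h)) (n : ℕ) :
    |∑ k ∈ Finset.Icc (-(n : ℤ)) (n : ℤ), a k * h| ≤ 2 * C / α * (1 + n * h) ^ (-α) := by
  have hC0 : 0 ≤ C := nonneg_of_mul_nonneg_left ((abs_nonneg _).trans (hC 0)) (wt_pos _ _)
  set S : ℕ → ℝ := fun n => ∑ k ∈ Finset.Icc (-(n : ℤ)) (n : ℤ), a k * h with hS
  have hstep : ∀ m : ℕ, |S (n + m) - S n| ≤
      2 * C / α * ((1 + n * h) ^ (-α) - (1 + ((n + m : ℕ) : ℝ) * h) ^ (-α)) := by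
    intro m
    induction m with
    | zero => simp
    | succ m ih =>
      set q := n + m with hq
      have e : S (n + (m + 1)) = S q + (a ((q : ℤ) + 1) * h + a (-((q : ℤ) + 1)) * h) :=
        sum_Icc_neg_succ (fun k => a k * h) q
      have hb : ∀ j : ℤ, |(j : ℝ)| = q + 1 →
          |a j * h| ≤ C / α * ((1 + q * h) ^ (-α) - (1 + ((q : ℝ) + 1) * h) ^ (-α)) := by
        intro j hj
        have h1 := mul_rpow_neg_le_sub hα hh (b := 1 + ((q : ℝ) + 1) * h) (by
          have : 0 ≤ (q : ℝ) * h := by positivity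
          linarith)
        rw [show 1 + ((q : ℝ) + 1) * h - h = 1 + q * h by ring] at h1
        have h2 := hC j
        rw [wt, abs_mul, hj, abs_of_pos hh] at h2
        rw [abs_mul, abs_of_pos hh]
        calc |a j| * h ≤ C * (1 + ((q : ℝ) + 1) * h) ^ (-(1 + α)) * h := by gcongr
          _ = C / α * (α * (h * (1 + ((q : ℝ) + 1) * h) ^ (-(1 + α)))) := by field_simp
          _ ≤ _ := by gcongr
      have hq0 : (0 : ℝ) ≤ (q : ℝ) + 1 := by positivity
      have h1 := abs_le.1 (hb ((q : ℤ) + 1) (by push_cast; exact abs_of_nonneg hq0))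
      have h2 := abs_le.1 (hb (-((q : ℤ) + 1)) (by
        push_cast
        rw [abs_of_nonpos (by linarith)]
        ring))
      have h3 := abs_le.1 ih
      have e3 : ((n + (m + 1) : ℕ) : ℝ) = (q : ℝ) + 1 := by
        rw [hq]
        push_cast
        ring
      rw [e, e3, abs_le, show 2 * C / α = 2 * (C / α) by ring]
      rw [show 2 * C / α = 2 * (C / α) by ring] at h3
      constructor <;> linarith [h1.1, h1.2, h2.1, h2.2, h3.1, h3.2]
  have hlim : Tendsto S atTop (𝓝 0) := by
    have := tendsto_sum_Icc_neg (ha.mul_right h)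
    rwa [zero_mul] at this
  have hlim2 : Tendsto (fun m => |S (n + m) - S n|) atTop (𝓝 |0 - S n|) := by
    have := (tendsto_add_atTop_iff_nat n).2 hlim
    simp only [add_comm _ n] at this
    exact (this.sub_const _).abs
  have := le_of_tendsto' hlim2 fun m => (hstep m).trans
    (mul_le_mul_of_nonneg_left (sub_le_self _ (by positivity)) (by positivity))
  rwa [zero_sub, abs_neg] at this

theorem gridSymbol_VM (hα : 0 < α) (hα₂ : α < 2) {h₀ : ℝ} :
    GridSymbol h₀ (-α) (VM α) := by
  obtain ⟨C, hC, H⟩ := gridSymbol_Lam_M hα hα₂ h₀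
  obtain ⟨C', hC', H'⟩ := (gridSymbol_Lam_M hα hα₂ h₀).shift
  have hsum : ∀ h : ℝ, 0 < h → HasSum (Lam α h (M α h)) 0 := by
    intro h hh
    refine hasSum_Lam_zero hα hα₂ hh ?_
    obtain ⟨B, hB, HB⟩ := abs_dens_le_weight hα hα₂ 0
    refine Summable.of_norm_bounded ((sum_wt hα hh).1.mul_left (B / h)) fun j => ?_
    have := HB (j * h)
    rw [Nat.cast_zero, add_zero] at this
    rw [M_eq hα, Real.norm_eq_abs, wt]
    refine this.trans_eq ?_
    field_simp
  have hbase : ∀ h : ℝ, 0 < h → h ≤ h₀ → ∀ n : ℕ,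
      |∑ k ∈ Finset.Icc (-(n : ℤ)) (n : ℤ), Lam α h (M α h) k * h| ≤
        2 * C / α * wt (-α) (n * h) := by
    intro h hh hh₀ n
    have := abs_sum_Icc_neg_le hα hh (hsum h hh) (fun j => (H h hh hh₀ j).1) n
    have e : |(n : ℝ) * h| = n * h := abs_of_nonneg (by positivity)
    rwa [wt, e]
  refine gridSymbol_of_bounds (C := 2 * C / α * (1 + h₀) ^ |-α|) (D := C')
    (fun h hh hh₀ j => ?_) (fun h hh hh₀ j => ?_)
  · have h1 : 1 ≤ (1 + h₀) ^ |-α| :=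
      Real.one_le_rpow (by linarith) (abs_nonneg _)
    have hw := wt_pos (-α) (j * h)
    rcases j with n | n
    · have h2 := hbase h hh hh₀ n
      have e : VM α h (Int.ofNat n) = -(1 / 2) *
        ∑ k ∈ Finset.Icc (-(n : ℤ)) (n : ℤ), Lam α h (M α h) k * h := rfl
      rw [e, abs_mul, abs_neg, abs_of_pos (by norm_num : (0 : ℝ) < 1 / 2)]
      simp only [Int.ofNat_eq_natCast, Int.cast_natCast] at hw ⊢
      have h3 : 2 * C / α * 1 * wt (-α) (n * h) ≤
          2 * C / α * (1 + h₀) ^ |-α| * wt (-α) (n * h) := by gcongr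
      have := abs_nonneg (∑ k ∈ Finset.Icc (-(n : ℤ)) (n : ℤ), Lam α h (M α h) k * h)
      linarith
    · have h2 := hbase h hh hh₀ n
      have e : VM α h (Int.negSucc n) = 1 / 2 *
        ∑ k ∈ Finset.Icc (-(n : ℤ)) (n : ℤ), Lam α h (M α h) k * h := rfl
      have h3 := (wt_shift_le (-α) hh hh₀ (n : ℤ)).2
      -- The index -n-1 carries the sum over [-n, n], whereas its weight is taken at (n+1)h.
      -- Comparing with nh costs the factor (1+h₀)^α.
      have e2 : wt (-α) (((Int.negSucc n : ℤ) : ℝ) * h) = wt (-α) (((n : ℤ) + 1 : ℤ) * h) := by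
        rw [← wt_neg, show Int.negSucc n = -((n : ℤ) + 1) from rfl]
        push_cast
        congr 1
        ring
      rw [e, abs_mul, abs_of_pos (by norm_num : (0 : ℝ) < 1 / 2), e2]
      rw [Int.cast_natCast] at h3
      have h4 : 2 * C / α * wt (-α) (n * h) ≤
          2 * C / α * ((1 + h₀) ^ |-α| * wt (-α) (((n : ℤ) + 1 : ℤ) * h)) := by gcongr
      have := abs_nonneg (∑ k ∈ Finset.Icc (-(n : ℤ)) (n : ℤ), Lam α h (M α h) k * h)
      linarith
  · rw [VM_sub_VM hα, abs_neg, abs_mul, abs_of_pos hh]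
    have h1 := (H' h hh hh₀ j).1
    have h2 := wt_mono (r := -(1 + α)) (s := -α) (by linarith) (j * h)
    calc |Lam α h (M α h) (j + 1)| * h ≤ C' * wt (-(1 + α)) (j * h) * h := by gcongr
      _ ≤ C' * wt (-α) (j * h) * h := by gcongr
      _ = _ := by ring

end Density

/-! ### The commutator -/

/-- The quotient `(ΛM)_j / M_j`. -/
def lamRatio (α h : ℝ) (j : ℤ) : ℝ := Lam α h (M α h) j * (M α h j)⁻¹

/-- The quotient `(VM)_{j+1/2} (dM)_j / (M_j M_{j+1})`. -/
def fluxRatio (α h : ℝ) (j : ℤ) : ℝ := VM α h j * dM α h j * (M α h j)⁻¹ * (M α h (j + 1))⁻¹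

/-- The difference quotient of the left coefficient of the flux. -/
def leftQuot (α h : ℝ) (j : ℤ) : ℝ := -(lamRatio α h (j + 1) + fluxRatio α h j) / 2

/-- The difference quotient of the right coefficient of the flux. -/
def rightQuot (α h : ℝ) (j : ℤ) : ℝ :=
  leftQuot α h j - (fluxRatio α h (j + 1) - fluxRatio α h j) / 2

section Commutator

variable {α : ℝ}

theorem gridSymbol_inv_M (hα : 0 < α) (hα₂ : α < 2) (h₀ : ℝ) :
    GridSymbol h₀ (1 + α) fun h j => (M α h j)⁻¹ := by
  obtain ⟨c, hc, H⟩ := exists_le_M hα hα₂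
  have := (gridSymbol_M hα hα₂ h₀).inv hc fun h _ _ j => H h j
  rwa [neg_neg] at this

theorem gridSymbol_lamRatio (hα : 0 < α) (hα₂ : α < 2) (h₀ : ℝ) :
    GridSymbol h₀ 0 (lamRatio α) := by
  have := (gridSymbol_Lam_M hα hα₂ h₀).mul (gridSymbol_inv_M hα hα₂ h₀)
  rwa [neg_add_cancel] at this

/-- The orders add up to zero: -α - (2+α) + 2(1+α) = 0. Without the decay of VM the quotient could
not be bounded this way. -/
theorem gridSymbol_fluxRatio (hα : 0 < α) (hα₂ : α < 2) (h₀ : ℝ) :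
    GridSymbol h₀ 0 (fluxRatio α) := by
  have := (((gridSymbol_VM (h₀ := h₀) hα hα₂).mul (gridSymbol_dM hα hα₂ h₀)).mul
    (gridSymbol_inv_M hα hα₂ h₀)).mul (gridSymbol_inv_M hα hα₂ h₀).shift
  rwa [show -α + -(2 + α) + (1 + α) + (1 + α) = 0 by ring] at this

/-- The coefficients of the commutator are bounded, vary slowly and almost agree. -/
theorem exists_quot_bounds (hα : 0 < α) (hα₂ : α < 2) (h₀ : ℝ) :
    ∃ K : ℝ, 0 ≤ K ∧ ∀ h : ℝ, 0 < h → h ≤ h₀ → ∀ j : ℤ, |leftQuot α h j| ≤ K ∧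
      |leftQuot α h (j + 1) - leftQuot α h j| ≤ K * h ∧
      |rightQuot α h j - leftQuot α h j| ≤ K * h := by
  obtain ⟨A, hA, HA⟩ := gridSymbol_lamRatio hα hα₂ h₀
  obtain ⟨B, hB, HB⟩ := gridSymbol_fluxRatio hα hα₂ h₀
  have hw : ∀ v, wt 0 v = 1 := fun v => by simp [wt]
  simp only [hw, mul_one] at HA HB
  refine ⟨A + B, by positivity, fun h hh hh₀ j => ?_⟩
  have a1 := abs_le.1 (HA h hh hh₀ (j + 1)).1
  have a2 := abs_le.1 (HA h hh hh₀ (j + 1)).2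
  have b1 := abs_le.1 (HB h hh hh₀ j).1
  have b2 := abs_le.1 (HB h hh hh₀ j).2
  have hAh : 0 ≤ A * h := by positivity
  have hBh : 0 ≤ B * h := by positivity
  refine ⟨?_, ?_, ?_⟩
  · rw [abs_le, leftQuot]
    constructor <;> linarith [a1.1, a1.2, b1.1, b1.2]
  · rw [abs_le, leftQuot, leftQuot]
    constructor <;> nlinarith [a2.1, a2.2, b2.1, b2.2]
  · rw [abs_le, rightQuot]
    constructor <;> nlinarith [b2.1, b2.2]

theorem leftQuot_eq (hα : 0 < α) (hα₂ : α < 2) {h : ℝ} (hh : 0 < h) (j : ℤ) :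
    VM α h (j + 1) / (2 * M α h (j + 1)) - VM α h j / (2 * M α h j) = h * leftQuot α h j := by
  have h1 := VM_sub_VM hα h j
  have m0 := (M_pos hα hα₂ h j).ne'
  have m1 := (M_pos hα hα₂ h (j + 1)).ne'
  rw [leftQuot, lamRatio, fluxRatio, dM, sub_eq_iff_eq_add.1 h1]
  field_simp
  ring

theorem rightQuot_eq (hα : 0 < α) (hα₂ : α < 2) {h : ℝ} (hh : 0 < h) (j : ℤ) :
    VM α h (j + 1) / (2 * M α h (j + 1 + 1)) - VM α h j / (2 * M α h (j + 1)) =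
      h * rightQuot α h j := by
  -- The two flux coefficients at one interface differ by (h/2)`fluxRatio`, so their difference
  -- quotients differ by half an increment of `fluxRatio`.
  have key : ∀ i : ℤ, VM α h i / (2 * M α h (i + 1)) =
      VM α h i / (2 * M α h i) - h / 2 * fluxRatio α h i := by
    intro i
    have m0 := (M_pos hα hα₂ h i).ne'
    have m1 := (M_pos hα hα₂ h (i + 1)).ne'
    rw [fluxRatio, dM]
    field_simp
    ring
  rw [key, key, rightQuot]
  linear_combination leftQuot_eq hα hα₂ hh j

/-- A coefficient commutes with `D` up to its own increments, so only difference quotients of the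
flux coefficients survive. Centring at i + 2 keeps every index a nonnegative shift of i. -/
theorem D_Gam_sub_Gam_D (hα : 0 < α) (hα₂ : α < 2) {h : ℝ} (hh : 0 < h) (f : ℤ → ℝ) (i : ℤ) :
    2 * h * (D h (Gam α h f) (i + 1 + 1) - Gam α h (D h f) (i + 1 + 1)) =
      leftQuot α h (i + 1 + 1) * f (i + 1 + 1 + 1) + leftQuot α h (i + 1) * f (i + 1) +
      rightQuot α h (i + 1 + 1) * f (i + 1 + 1 + 1 + 1) + rightQuot α h (i + 1) * f (i + 1 + 1) -
      leftQuot α h (i + 1) * f (i + 1 + 1) - leftQuot α h i * f i -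
      rightQuot α h (i + 1) * f (i + 1 + 1 + 1) - rightQuot α h i * f (i + 1) := by
  have l0 := leftQuot_eq hα hα₂ hh i
  have l1 := leftQuot_eq hα hα₂ hh (i + 1)
  have l2 := leftQuot_eq hα hα₂ hh (i + 1 + 1)
  have r0 := rightQuot_eq hα hα₂ hh i
  have r1 := rightQuot_eq hα hα₂ hh (i + 1)
  have r2 := rightQuot_eq hα hα₂ hh (i + 1 + 1)
  have hfl : ∀ (g : ℤ → ℝ) (k : ℤ), flux α h g k =
      VM α h k / (2 * M α h k) * g k + VM α h k / (2 * M α h (k + 1)) * g (k + 1) := by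
    intro g k
    rw [flux]
    ring
  simp only [D, Gam, hfl]
  simp only [add_sub_cancel_right]
  generalize VM α h i / (2 * M α h i) = p0 at *
  generalize VM α h (i + 1) / (2 * M α h (i + 1)) = p1 at *
  generalize VM α h (i + 1 + 1) / (2 * M α h (i + 1 + 1)) = p2 at *
  generalize VM α h (i + 1 + 1 + 1) / (2 * M α h (i + 1 + 1 + 1)) = p3 at *
  generalize VM α h i / (2 * M α h (i + 1)) = q0 at *
  generalize VM α h (i + 1) / (2 * M α h (i + 1 + 1)) = q1 at *
  generalize VM α h (i + 1 + 1) / (2 * M α h (i + 1 + 1 + 1)) = q2 at *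
  generalize VM α h (i + 1 + 1 + 1) / (2 * M α h (i + 1 + 1 + 1 + 1)) = q3 at *
  have hne := hh.ne'
  -- One more factor h makes the coefficients appear as h·`leftQuot` and h·`rightQuot`, which are
  -- the differences given by the six identities above.
  rw [← mul_right_inj' hne]
  field_simp
  linear_combination (f (i + 1 + 1 + 1) * l2 + f (i + 1) * l1 +
    f (i + 1 + 1 + 1 + 1) * r2 + f (i + 1 + 1) * r1 - f (i + 1 + 1) * l1 - f i * l0 -
    f (i + 1 + 1 + 1) * r1 - f (i + 1) * r0)

/-- Boundedness of f makes the series converge, so that `D` may be applied term by term; the bound B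
enters no constant. -/
theorem D_Lam_eq_Lam_D (hα : 0 < α) (hα₂ : α < 2) {h : ℝ} (hh : 0 < h) {f : ℤ → ℝ} {B : ℝ}
    (hf : ∀ j, |f j| ≤ B) (j : ℤ) : D h (Lam α h f) j = Lam α h (D h f) j := by
  rw [D, Lam_eq_tsum, Lam_eq_tsum, Lam_eq_tsum, ← (summable_lamTerm hα hα₂ hh hf _).tsum_sub
    (summable_lamTerm hα hα₂ hh hf _), ← tsum_div_const]
  refine tsum_congr fun n => ?_
  simp only [lamTerm, D]
  rw [show j + ((n : ℤ) + 1) + 1 = j + 1 + ((n : ℤ) + 1) by ring,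
    show j - ((n : ℤ) + 1) + 1 = j + 1 - ((n : ℤ) + 1) by ring,
    show j + ((n : ℤ) + 1) - 1 = j - 1 + ((n : ℤ) + 1) by ring,
    show j - ((n : ℤ) + 1) - 1 = j - 1 - ((n : ℤ) + 1) by ring]
  ring

theorem comm_eq (hα : 0 < α) (hα₂ : α < 2) {h : ℝ} (hh : 0 < h) {f : ℤ → ℝ} {B : ℝ}
    (hf : ∀ j, |f j| ≤ B) (j : ℤ) :
    comm (D h) (L α h) f j = D h (Gam α h f) j - Gam α h (D h f) j := by
  have h1 : D h (L α h f) j = D h (Gam α h f) j + D h (Lam α h f) j := by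
    simp only [D, L]
    ring
  rw [comm, Pi.sub_apply, h1, L, D_Lam_eq_Lam_D hα hα₂ hh hf]
  ring

/-- Pointwise bound for the commutator. -/
theorem exists_abs_comm_le (hα : 0 < α) (hα₂ : α < 2) (h₀ : ℝ) :
    ∃ K : ℝ, 0 ≤ K ∧ ∀ h : ℝ, 0 < h → h ≤ h₀ → ∀ (f : ℤ → ℝ) (B : ℝ), (∀ j, |f j| ≤ B) →
      ∀ j, |comm (D h) (L α h) f j| ≤ K * (|D h f (j + 1)| + |D h f (j + -1)| +
        |f (j + 2)| + |f (j + 1)| + |f (j + 0)| + |f (j + -1)| + |f (j + -2)|) := by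
  obtain ⟨K, hK, H⟩ := exists_quot_bounds hα hα₂ h₀
  refine ⟨K, hK, fun h hh hh₀ f B hf j => ?_⟩
  obtain ⟨i, rfl⟩ : ∃ i, j = i + 1 + 1 := ⟨j - 2, by ring⟩
  have hid := D_Gam_sub_Gam_D hα hα₂ hh f i
  rw [← comm_eq hα hα₂ hh hf] at hid
  obtain ⟨-, p0, q0⟩ := H h hh hh₀ i
  obtain ⟨-, p1, q1⟩ := H h hh hh₀ (i + 1)
  obtain ⟨b2, -, q2⟩ := H h hh hh₀ (i + 1 + 1)
  have e1 : i + 1 + 1 + 2 = i + 1 + 1 + 1 + 1 := by ring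
  have e2 : i + 1 + 1 + -1 = i + 1 := by ring
  have e3 : i + 1 + 1 + -2 = i := by ring
  have d1 : f (i + 1 + 1 + 1 + 1) - f (i + 1 + 1) = 2 * h * D h f (i + 1 + 1 + 1) := by
    rw [D, add_sub_cancel_right, mul_div_cancel₀ _ (by positivity)]
  have d2 : f (i + 1 + 1) - f i = 2 * h * D h f (i + 1) := by
    rw [D, add_sub_cancel_right, mul_div_cancel₀ _ (by positivity)]
  rw [e1, e2, e3, add_zero]
  set P2 := leftQuot α h (i + 1 + 1)
  set P1 := leftQuot α h (i + 1)
  set P0 := leftQuot α h i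
  set Q2 := rightQuot α h (i + 1 + 1)
  set Q1 := rightQuot α h (i + 1)
  set Q0 := rightQuot α h i
  have c1 : |P2 - Q1| ≤ 2 * (K * h) := by
    rw [abs_le] at *
    constructor <;> linarith [p1.1, p1.2, q1.1, q1.2]
  have c2 : |P1 - Q0| ≤ 2 * (K * h) := by
    rw [abs_le] at *
    constructor <;> linarith [p0.1, p0.2, q0.1, q0.2]
  have c3 : |P2 - P0| ≤ 2 * (K * h) := by
    rw [abs_le] at *
    constructor <;> linarith [p0.1, p0.2, p1.1, p1.2]
  -- The coefficient P2 is frozen for both extreme values of f; f_{i+4} - f_i then splits into two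
  -- centred differences, and every other coefficient is a difference of quotients, hence O(h).
  have hid2 : 2 * h * comm (D h) (L α h) f (i + 1 + 1) =
      2 * h * (P2 * (D h f (i + 1 + 1 + 1) + D h f (i + 1))) +
      ((Q2 - P2) * f (i + 1 + 1 + 1 + 1) + (P2 - Q1) * f (i + 1 + 1 + 1) +
        (Q1 - P1) * f (i + 1 + 1) + (P1 - Q0) * f (i + 1) + (P2 - P0) * f i) := by
    linear_combination hid + P2 * d1 + P2 * d2
  have hKh : 0 ≤ K * h := by positivity
  have t0 : |P2 * (D h f (i + 1 + 1 + 1) + D h f (i + 1))| ≤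
      K * (|D h f (i + 1 + 1 + 1)| + |D h f (i + 1)|) := by
    rw [abs_mul]
    exact mul_le_mul b2 (abs_add_le _ _) (abs_nonneg _) hK
  have tm : ∀ a b c : ℝ, |a| ≤ c → |a * b| ≤ c * |b| := fun a b c hac => by
    rw [abs_mul]
    exact mul_le_mul_of_nonneg_right hac (abs_nonneg _)
  have q2' : |Q2 - P2| ≤ 2 * (K * h) := by linarith
  have q1' : |Q1 - P1| ≤ 2 * (K * h) := by linarith
  have t1 := tm _ (f (i + 1 + 1 + 1 + 1)) _ q2'
  have t2 := tm _ (f (i + 1 + 1 + 1)) _ c1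
  have t3 := tm _ (f (i + 1 + 1)) _ q1'
  have t4 := tm _ (f (i + 1)) _ c2
  have t5 := tm _ (f i) _ c3
  have hfin : |2 * h * comm (D h) (L α h) f (i + 1 + 1)| ≤ 2 * h * (K * (|D h f (i + 1 + 1 + 1)| +
      |D h f (i + 1)| + |f (i + 1 + 1 + 1 + 1)| + |f (i + 1 + 1 + 1)| + |f (i + 1 + 1)| +
      |f (i + 1)| + |f i|)) := by
    rw [hid2]
    refine (abs_add_le _ _).trans ?_
    have t0' := mul_le_mul_of_nonneg_left t0 (show 0 ≤ 2 * h by positivity)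
    rw [abs_mul, abs_of_pos (show 0 < 2 * h by positivity)]
    have a1 := abs_add_le ((Q2 - P2) * f (i + 1 + 1 + 1 + 1) + (P2 - Q1) * f (i + 1 + 1 + 1) +
      (Q1 - P1) * f (i + 1 + 1) + (P1 - Q0) * f (i + 1)) ((P2 - P0) * f i)
    have a2 := abs_add_le ((Q2 - P2) * f (i + 1 + 1 + 1 + 1) + (P2 - Q1) * f (i + 1 + 1 + 1) +
      (Q1 - P1) * f (i + 1 + 1)) ((P1 - Q0) * f (i + 1))
    have a3 := abs_add_le ((Q2 - P2) * f (i + 1 + 1 + 1 + 1) + (P2 - Q1) * f (i + 1 + 1 + 1))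
      ((Q1 - P1) * f (i + 1 + 1))
    have a4 := abs_add_le ((Q2 - P2) * f (i + 1 + 1 + 1 + 1)) ((P2 - Q1) * f (i + 1 + 1 + 1))
    linarith
  rw [abs_mul, abs_of_pos (show 0 < 2 * h by positivity)] at hfin
  exact le_of_mul_le_mul_left hfin (by positivity)

/-! ### Weighted square-summable sequences -/

/-- Neighbouring values of the discrete equilibrium are comparable. -/
theorem exists_inv_M_le (hα : 0 < α) (hα₂ : α < 2) {h₀ : ℝ} (hh₀ : 0 < h₀) :
    ∃ C : ℝ, 0 < C ∧ ∀ h : ℝ, 0 < h → h ≤ h₀ → ∀ m : ℤ, |m| ≤ 2 → ∀ j : ℤ,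
      (M α h j)⁻¹ ≤ C * (M α h (j + m))⁻¹ := by
  obtain ⟨c, hc, H⟩ := exists_le_M hα hα₂
  obtain ⟨A, hA, HA⟩ := gridSymbol_M hα hα₂ h₀
  set d := (1 + 2 * h₀) ^ |-(1 + α)| with hd
  have hd0 : 0 < d := by positivity
  refine ⟨(A + 1) * d / c, by positivity, fun h hh hle m hm j => ?_⟩
  have p0 := M_pos hα hα₂ h j
  have p1 := M_pos hα hα₂ h (j + m)
  have hw := wt_pos (-(1 + α)) (j * h)
  have h1 : M α h (j + m) ≤ (A + 1) * d / c * M α h j := by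
    have h2 : wt (-(1 + α)) (((j + m : ℤ) : ℝ) * h) ≤ d * wt (-(1 + α)) (j * h) := by
      refine wt_le_of_abs_sub_le _ ?_
      have hm' : |(m : ℝ)| ≤ 2 := by exact_mod_cast hm
      push_cast
      rw [show ((j : ℝ) + m) * h - j * h = m * h by ring, abs_mul, abs_of_pos hh]
      gcongr
    have hw2 := wt_pos (-(1 + α)) (((j + m : ℤ) : ℝ) * h)
    calc M α h (j + m) ≤ A * wt (-(1 + α)) (((j + m : ℤ) : ℝ) * h) :=
          (le_abs_self _).trans (HA h hh hle (j + m)).1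
      _ ≤ (A + 1) * (d * wt (-(1 + α)) (j * h)) := by
          gcongr
          linarith
      _ = (A + 1) * d / c * (c * wt (-(1 + α)) (j * h)) := by field_simp
      _ ≤ _ := by
          gcongr
          exact H h j
  rw [← div_eq_mul_inv, le_div_iff₀ p1, inv_mul_le_iff₀ p0, mul_comm (M α h j)]
  exact h1

theorem memL2_shift {h C : ℝ} (hh : 0 < h) {γ : ℤ → ℝ} {m : ℤ}
    (hγ0 : ∀ j, 0 ≤ γ j) (hγ : ∀ j, γ j ≤ C * γ (j + m)) {a : ℤ → ℝ} (ha : MemL2 h γ a) :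
    (Summable fun j => a (j + m) ^ 2 * γ j * h) ∧
      ∑' j, a (j + m) ^ 2 * γ j * h ≤ C * ∑' j, a j ^ 2 * γ j * h := by
  have hle : ∀ j, a (j + m) ^ 2 * γ j * h ≤ C * (a (j + m) ^ 2 * γ (j + m) * h) := fun j => by
    calc a (j + m) ^ 2 * γ j * h ≤ a (j + m) ^ 2 * (C * γ (j + m)) * h := by
          gcongr
          exact hγ j
      _ = _ := by ring
  have hsh : HasSum (fun j => a (j + m) ^ 2 * γ (j + m) * h) (∑' j, a j ^ 2 * γ j * h) :=
    (Equiv.addRight m).hasSum_iff.2 (Summable.hasSum ha)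
  have hs : Summable fun j => a (j + m) ^ 2 * γ j * h :=
    Summable.of_nonneg_of_le (fun j => mul_nonneg (mul_nonneg (sq_nonneg _) (hγ0 j)) hh.le) hle
      (hsh.mul_left C).summable
  exact ⟨hs, hasSum_le hle hs.hasSum (hsh.mul_left C)⟩

theorem memL2_D (hα : 0 < α) (hα₂ : α < 2) {h : ℝ} (hh : 0 < h) {f : ℤ → ℝ}
    (hf : MemL2 h (M α h)⁻¹ f) : MemL2 h (M α h)⁻¹ (D h f) := by
  -- The mesh h itself serves as h₀: only membership is needed here, not a uniform constant.
  obtain ⟨C, hC, H⟩ := exists_inv_M_le hα hα₂ hh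
  have hγ0 : ∀ j, 0 ≤ (M α h)⁻¹ j := fun j => inv_nonneg.2 (M_pos hα hα₂ h j).le
  have s1 := (memL2_shift hh hγ0 (H h hh le_rfl 1 (by norm_num)) hf).1
  have s2 := (memL2_shift hh hγ0 (H h hh le_rfl (-1) (by norm_num)) hf).1
  refine Summable.of_nonneg_of_le (fun j => mul_nonneg (mul_nonneg (sq_nonneg _) (hγ0 j)) hh.le)
    (fun j => ?_) ((s1.add s2).mul_left (2 / (2 * h) ^ 2))
  have hsq : D h f j ^ 2 ≤ 2 / (2 * h) ^ 2 * (f (j + 1) ^ 2 + f (j + -1) ^ 2) := by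
    rw [D, div_pow, ← sub_eq_add_neg, div_mul_eq_mul_div]
    gcongr
    nlinarith [sq_nonneg (f (j + 1) + f (j - 1))]
  calc D h f j ^ 2 * (M α h)⁻¹ j * h ≤
      2 / (2 * h) ^ 2 * (f (j + 1) ^ 2 + f (j + -1) ^ 2) * (M α h)⁻¹ j * h := by
        have := hγ0 j
        gcongr
    _ = _ := by ring

theorem exists_bound_of_memL2 (hα : 0 < α) (hα₂ : α < 2) {h : ℝ} (hh : 0 < h) {f : ℤ → ℝ}
    (hf : MemL2 h (M α h)⁻¹ f) : ∃ B, ∀ j, |f j| ≤ B := by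
  obtain ⟨A, -, HA⟩ := abs_dens_le α 0
  set E := ∑' j, f j ^ 2 * (M α h)⁻¹ j * h with hE
  have hnn : ∀ j, 0 ≤ f j ^ 2 * (M α h)⁻¹ j * h := fun j =>
    mul_nonneg (mul_nonneg (sq_nonneg _) (inv_nonneg.2 (M_pos hα hα₂ h j).le)) hh.le
  have hE0 : 0 ≤ E := tsum_nonneg hnn
  -- M ≤ A gives f_j² ≤ EA/h, and |x| ≤ x² + 1 avoids a square root.
  refine ⟨E * A / h + 1, fun j => ?_⟩
  have h1 : f j ^ 2 * (M α h)⁻¹ j * h ≤ E := Summable.le_tsum hf j fun i _ => hnn i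
  have hM := M_pos hα hα₂ h j
  have hMA : M α h j ≤ A := by
    rw [M_eq hα]
    exact (le_abs_self _).trans (HA _)
  have h2 : f j ^ 2 ≤ E * A / h := by
    rw [le_div_iff₀ hh]
    calc f j ^ 2 * h = f j ^ 2 * (M α h)⁻¹ j * h * M α h j := by
          rw [Pi.inv_apply]
          field_simp
      _ ≤ E * A := by gcongr
  nlinarith [sq_abs (f j), sq_nonneg (|f j| - 1)]

theorem exists_normL2_comm_le (hα : 0 < α) (hα₂ : α < 2) {h₀ : ℝ} (hh₀ : 0 < h₀) :
    ∃ C : ℝ, 0 < C ∧ ∀ h : ℝ, 0 < h → h ≤ h₀ → ∀ f : ℤ → ℝ, MemL2 h (M α h)⁻¹ f →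
      MemL2 h (M α h)⁻¹ (comm (D h) (L α h) f) ∧
      normL2 h (M α h)⁻¹ (comm (D h) (L α h) f) ≤
        C * (normL2 h (M α h)⁻¹ f + normL2 h (M α h)⁻¹ (D h f)) := by
  obtain ⟨K, hK, HK⟩ := exists_abs_comm_le hα hα₂ h₀
  obtain ⟨C, hC, HC⟩ := exists_inv_M_le hα hα₂ hh₀
  -- The 35 is 7·5: Cauchy–Schwarz over seven shifted terms, of which five are values of f and two
  -- are values of Df. The added 1 keeps the constant positive.
  refine ⟨Real.sqrt (35 * K ^ 2 * C) + 1, by positivity, fun h hh hle f hf => ?_⟩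
  obtain ⟨B, hB⟩ := exists_bound_of_memL2 hα hα₂ hh hf
  have hDf := memL2_D hα hα₂ hh hf
  have hcomm := HK h hh hle f B hB
  set γ := (M α h)⁻¹ with hγdef
  have hγ0 : ∀ j, 0 ≤ γ j := fun j => inv_nonneg.2 (M_pos hα hα₂ h j).le
  set E := ∑' j, f j ^ 2 * γ j * h with hE
  set F := ∑' j, D h f j ^ 2 * γ j * h with hF
  have hE0 : 0 ≤ E := tsum_nonneg fun j => mul_nonneg (mul_nonneg (sq_nonneg _) (hγ0 j)) hh.le
  have hF0 : 0 ≤ F := tsum_nonneg fun j => mul_nonneg (mul_nonneg (sq_nonneg _) (hγ0 j)) hh.le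
  obtain ⟨s1, b1⟩ := memL2_shift hh hγ0 (HC h hh hle 1 (by norm_num)) hDf
  obtain ⟨s2, b2⟩ := memL2_shift hh hγ0 (HC h hh hle (-1) (by norm_num)) hDf
  obtain ⟨s3, b3⟩ := memL2_shift hh hγ0 (HC h hh hle 2 (by norm_num)) hf
  obtain ⟨s4, b4⟩ := memL2_shift hh hγ0 (HC h hh hle 1 (by norm_num)) hf
  obtain ⟨s5, b5⟩ := memL2_shift hh hγ0 (HC h hh hle 0 (by norm_num)) hf
  obtain ⟨s6, b6⟩ := memL2_shift hh hγ0 (HC h hh hle (-1) (by norm_num)) hf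
  obtain ⟨s7, b7⟩ := memL2_shift hh hγ0 (HC h hh hle (-2) (by norm_num)) hf
  have hsum := ((((((s1.hasSum.add s2.hasSum).add s3.hasSum).add s4.hasSum).add s5.hasSum).add
    s6.hasSum).add s7.hasSum).mul_left (7 * K ^ 2)
  have hsq : ∀ x₁ x₂ x₃ x₄ x₅ x₆ x₇ : ℝ, (|x₁| + |x₂| + |x₃| + |x₄| + |x₅| + |x₆| + |x₇|) ^ 2 ≤
      7 * (x₁ ^ 2 + x₂ ^ 2 + x₃ ^ 2 + x₄ ^ 2 + x₅ ^ 2 + x₆ ^ 2 + x₇ ^ 2) := by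
    intro x₁ x₂ x₃ x₄ x₅ x₆ x₇
    have := sq_sum_le_card_mul_sum_sq (s := (Finset.univ : Finset (Fin 7)))
      (f := ![|x₁|, |x₂|, |x₃|, |x₄|, |x₅|, |x₆|, |x₇|])
    simpa [Fin.sum_univ_succ, add_assoc] using this
  have hterm : ∀ j, comm (D h) (L α h) f j ^ 2 * γ j * h ≤ 7 * K ^ 2 *
      (D h f (j + 1) ^ 2 * γ j * h + D h f (j + -1) ^ 2 * γ j * h + f (j + 2) ^ 2 * γ j * h +
        f (j + 1) ^ 2 * γ j * h + f (j + 0) ^ 2 * γ j * h + f (j + -1) ^ 2 * γ j * h +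
        f (j + -2) ^ 2 * γ j * h) := by
    intro j
    have h1 : comm (D h) (L α h) f j ^ 2 ≤ K ^ 2 * (7 * (D h f (j + 1) ^ 2 + D h f (j + -1) ^ 2 +
        f (j + 2) ^ 2 + f (j + 1) ^ 2 + f (j + 0) ^ 2 + f (j + -1) ^ 2 + f (j + -2) ^ 2)) := by
      rw [← sq_abs]
      refine (pow_le_pow_left₀ (abs_nonneg _) (hcomm j) 2).trans ?_
      rw [mul_pow]
      exact mul_le_mul_of_nonneg_left (hsq _ _ _ _ _ _ _) (sq_nonneg K)
    have h2 := mul_le_mul_of_nonneg_right (mul_le_mul_of_nonneg_right h1 (hγ0 j)) hh.le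
    refine h2.trans_eq ?_
    ring
  have hmem : MemL2 h γ (comm (D h) (L α h) f) :=
    Summable.of_nonneg_of_le (fun j => mul_nonneg (mul_nonneg (sq_nonneg _) (hγ0 j)) hh.le) hterm
      hsum.summable
  refine ⟨hmem, ?_⟩
  have htot : ∑' j, comm (D h) (L α h) f j ^ 2 * γ j * h ≤ 35 * K ^ 2 * C * (E + F) := by
    refine (hasSum_le hterm (Summable.hasSum hmem) hsum).trans ?_
    have hK2 : 0 ≤ 7 * K ^ 2 := by positivity
    have hCE : 0 ≤ C * E := by positivity
    have hCF : 0 ≤ C * F := by positivity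
    calc _ ≤ 7 * K ^ 2 * (5 * (C * (E + F))) := by
          refine mul_le_mul_of_nonneg_left ?_ hK2
          linarith
      _ = _ := by ring
  have hEF : Real.sqrt (E + F) ≤ Real.sqrt E + Real.sqrt F := by
    rw [Real.sqrt_le_left (by positivity)]
    nlinarith [Real.sq_sqrt hE0, Real.sq_sqrt hF0, Real.sqrt_nonneg E, Real.sqrt_nonneg F,
      mul_nonneg (Real.sqrt_nonneg E) (Real.sqrt_nonneg F)]
  calc normL2 h γ (comm (D h) (L α h) f) ≤ Real.sqrt (35 * K ^ 2 * C * (E + F)) :=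
        Real.sqrt_le_sqrt htot
    _ = Real.sqrt (35 * K ^ 2 * C) * Real.sqrt (E + F) := Real.sqrt_mul (by positivity) _
    _ ≤ (Real.sqrt (35 * K ^ 2 * C) + 1) * (Real.sqrt E + Real.sqrt F) := by
        gcongr
        linarith

end Commutator

/-- Cauchy–Schwarz inequality for the weighted inner product. -/
theorem abs_innerL2_le {h : ℝ} {γ a b : ℤ → ℝ} (hγ : ∀ j, 0 ≤ γ j * h) (ha : MemL2 h γ a)
    (hb : MemL2 h γ b) : |innerL2 h γ a b| ≤ normL2 h γ a * normL2 h γ b := by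
  have hsq : ∀ (c : ℤ → ℝ) (j : ℤ),
      (|c j| * Real.sqrt (γ j * h)) ^ (2 : ℝ) = c j ^ 2 * γ j * h := by
    intro c j
    rw [Real.rpow_two, mul_pow, sq_abs, Real.sq_sqrt (hγ j), mul_assoc]
  -- Hölder with p = q = 2, the square root of the weight γh being absorbed into each factor.
  obtain ⟨hs, hle⟩ := Real.summable_and_inner_le_Lp_mul_Lq_tsum_of_nonneg
    Real.HolderConjugate.two_two
    (f := fun j => |a j| * Real.sqrt (γ j * h)) (g := fun j => |b j| * Real.sqrt (γ j * h))
    (fun j => by positivity) (fun j => by positivity) (by simp only [hsq]; exact ha)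
    (by simp only [hsq]; exact hb)
  simp only [hsq] at hle
  rw [← Real.sqrt_eq_rpow, ← Real.sqrt_eq_rpow] at hle
  refine le_trans ?_ hle
  rw [innerL2, ← Real.norm_eq_abs]
  refine tsum_of_norm_bounded hs.hasSum fun j => le_of_eq ?_
  have := Real.mul_self_sqrt (hγ j)
  rw [Real.norm_eq_abs, mul_assoc, abs_mul, abs_mul, abs_of_nonneg (hγ j)]
  linear_combination (-(|a j| * |b j|)) * this

end

end LevyFP

theorem mainTheorem10 (α : ℝ) (hα₀ : 0 < α) (hα₂ : α < 2) (h₀ : ℝ) (hh₀ : 0 < h₀) :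
    ∃ C : ℝ, 0 < C ∧
      ∀ h : ℝ, 0 < h → h ≤ h₀ →
      ∀ f g : ℤ → ℝ,
        LevyFP.MemL2 h (LevyFP.M α h)⁻¹ f → LevyFP.MemL2 h (LevyFP.M α h)⁻¹ g →
          LevyFP.MemL2 h (LevyFP.M α h)⁻¹ (LevyFP.comm (LevyFP.D h) (LevyFP.L α h) f) ∧
          |LevyFP.innerL2 h (LevyFP.M α h)⁻¹
              (LevyFP.comm (LevyFP.D h) (LevyFP.L α h) f) g|
            ≤ C * (LevyFP.normL2 h (LevyFP.M α h)⁻¹ f * LevyFP.normL2 h (LevyFP.M α h)⁻¹ g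
                + LevyFP.normL2 h (LevyFP.M α h)⁻¹ (LevyFP.D h f)
                  * LevyFP.normL2 h (LevyFP.M α h)⁻¹ g) := by
  obtain ⟨C, hC, H⟩ := LevyFP.exists_normL2_comm_le hα₀ hα₂ hh₀
  refine ⟨C, hC, fun h hh hle f g hf hg => ?_⟩
  obtain ⟨hmem, hnorm⟩ := H h hh hle f hf
  refine ⟨hmem, ?_⟩
  have hγ : ∀ j, 0 ≤ (LevyFP.M α h)⁻¹ j * h := fun j =>
    mul_nonneg (inv_nonneg.2 (LevyFP.M_pos hα₀ hα₂ h j).le) hh.le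
  calc _ ≤ LevyFP.normL2 h (LevyFP.M α h)⁻¹ (LevyFP.comm (LevyFP.D h) (LevyFP.L α h) f) *
        LevyFP.normL2 h (LevyFP.M α h)⁻¹ g := LevyFP.abs_innerL2_le hγ hmem hg
    _ ≤ C * (LevyFP.normL2 h (LevyFP.M α h)⁻¹ f +
          LevyFP.normL2 h (LevyFP.M α h)⁻¹ (LevyFP.D h f)) *
        LevyFP.normL2 h (LevyFP.M α h)⁻¹ g :=
      mul_le_mul_of_nonneg_right hnorm (Real.sqrt_nonneg _)
    _ = _ := by ring
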